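/- Let $S$ be a finite set of points in the plane $\mathbb{R}^2$, not all on one line. A polygonalization of $S$ is a simple polygon whose vertex set is exactly $S$ (vertices with interior angle $\pi$ are allowed). A vertex of a simple polygon is reflex if its interior angle is greater than $\pi$. The reflexivity $\rho(S)$ is the minimum number of reflex vertices over all polygonalizations of $S$, and $\rho(n)$ is the maximum of $\rho(S)$ over all sets $S$ of $n$ points in the plane that are not all on one line (with $\rho(n)=0$ for $n\le 2$, where there are no such sets). Then, for every $n$, $$\left\lfloor \frac n4\right\rfloor \le \rho(n)\le \left\lceil \frac n2\right\rceil .$$ -/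

import Mathlib

/-- The Euclidean plane. -/
abbrev Plane : Type := EuclideanSpace ℝ (Fin 2)

namespace Polygon

variable {n : ℕ}

/-- A closed polygon in the plane is simple if it has at least three vertices, its vertices are
pairwise distinct, and two different (closed) edges meet at most in common endpoints.
Edge `i` joins vertex `i` to its cyclic successor `finRotate n i`. Three consecutive vertices may
be collinear (a vertex with interior angle `π`). -/
def IsSimple (P : Polygon Plane n) : Prop :=
  3 ≤ n ∧ Function.Injective P.vertices ∧
    ∀ i j : Fin n, i ≠ j →
      P.edgeSet ℝ i ∩ P.edgeSet ℝ j ⊆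
        ({P i, P (finRotate n i)} : Set Plane) ∩ {P j, P (finRotate n j)}

/-- The interior region of a polygon: the points off the boundary that lie in a bounded connected
component of the complement of the boundary. -/
def interiorRegion (P : Polygon Plane n) : Set Plane :=
  {x | x ∉ P.boundary ℝ ∧
    Bornology.IsBounded (connectedComponentIn (P.boundary ℝ)ᶜ x)}

open Classical in
/-- The interior angle, in `[0, 2π]`, of a simple polygon at vertex `i`. With `u` and `w` the two
neighbours of the vertex `v`, the edges at `v` cut a small disc around `v` into a convex sector of
angle `∠ u v w` and its complement of angle `2π - ∠ u v w`; the interior angle is the angle of the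
sector on the interior side. The convex sector is recognized by the points of the segment from
`v` to the midpoint of `u w` that are close to `v`. (If `∠ u v w = π`, both values are `π`.) -/
noncomputable def interiorAngle (P : Polygon Plane n) (i : Fin n) : ℝ :=
  if ∀ᶠ t : ℝ in nhdsWithin 0 (Set.Ioi 0),
      AffineMap.lineMap (P i) (midpoint ℝ (P ((finRotate n).symm i)) (P (finRotate n i))) t
        ∈ P.interiorRegion
  then EuclideanGeometry.angle (P ((finRotate n).symm i)) (P i) (P (finRotate n i))
  else 2 * Real.pi - EuclideanGeometry.angle (P ((finRotate n).symm i)) (P i) (P (finRotate n i))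

/-- A vertex is reflex if its interior angle is greater than `π`. -/
def IsReflex (P : Polygon Plane n) (i : Fin n) : Prop :=
  Real.pi < P.interiorAngle i

/-- The number of reflex vertices. -/
noncomputable def reflexCount (P : Polygon Plane n) : ℕ :=
  Set.ncard {i : Fin n | P.IsReflex i}

/-- A polygonalization of `S` is a simple polygon whose vertex set is `S`. -/
def IsPolygonalization (P : Polygon Plane n) (S : Finset Plane) : Prop :=
  P.IsSimple ∧ Set.range P.vertices = (S : Set Plane)

end Polygon

/-- The reflexivity of `S`: the minimum number of reflex vertices of a polygonalization of `S`
(it would be `⊤` if `S` had no polygonalization). -/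
noncomputable def reflexivity (S : Finset Plane) : ℕ∞ :=
  ⨅ (n : ℕ) (P : Polygon Plane n) (_ : P.IsPolygonalization S), (P.reflexCount : ℕ∞)

/-- The worst-case reflexivity: the maximum of the reflexivity over all sets of `n` points in the
plane that do not all lie on one line (collinear points have no polygonalization). For `n ≤ 2`
there are no such sets and the value is `0`. -/
noncomputable def worstCaseReflexivity (n : ℕ) : ℕ∞ :=
  ⨆ (S : Finset Plane) (_ : S.card = n) (_ : ¬ Collinear ℝ (S : Set Plane)), reflexivity S

/-! Three ingredients carry the proof.

Reflex vertices are right turns. The definition of the interior uses bounded components, but the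
Jordan curve theorem is not needed. The winding number is locally constant off the boundary,
vanishes far away and jumps across every edge. At a vertex that is extreme in some direction, a ray
escapes to infinity; this marks one side of the polygon as outer, and the mark is carried along thin
triangles beside the edges and through the sectors at the vertices. On the other side the winding
number cannot vanish as well, so the points there lie in bounded components. Hence, after a possible
reversal, the reflex vertices are exactly the right turns (`IsCcw.isReflex_iff`,
`IsSimple.exists_isCcw`).

Upper bound, in the stronger form `n / 2`. Let `a` be extreme, let `p` be the nearest point on a
hull edge at `a`, and let `o` be a point of the segment `p a` close to `p`. A path from `a` through
all other points to `p` is built greedily, each segment touching the hull of the remaining points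
only in its end; such a path, closed by `p a`, is a simple polygon (`isCcw_of_peels`). From the
current end `v` the path goes either to the tangent point of the remaining set `A`, which causes no
right turn there, or to the first point `q` of `A` in the angular order around `o`, which may cost
one. The potential is the number of points of `A` inside the hull of `A`, `v` and `o`: a right turn
is paid for by two points that stop being inner, up to a debt of one point while `q` is postponed
(`IsPivot.exists_path`).

Lower bound. Take points `h i` on a parabola and, for `k` of the hull edges, a point slightly inside
the edge `h i h (i+1)`. In a counterclockwise polygonalization, if this edge is used, then the inner
point next to it is reflex, because the triangle between them is met by no edge
(`IsCcw.turn_innerPoint_neg`). If it is not used, then the path from `h i` to `h (i+1)` closed by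
the hull edge is a clockwise polygon, and one of its extreme vertices off that edge is reflex in the
original polygon (`IsCcw.exists_turn_neg_between`). Within each of the two cases different edges
give different vertices, so there are at least `k / 2` reflex vertices (`IsCcw.le_reflexCount`). -/

/-! ### Coordinates of the plane -/

/-- The determinant of two vectors of the plane. -/
def det2 (a b : Plane) : ℝ := a 0 * b 1 - a 1 * b 0

/-- The standard scalar product of two vectors of the plane. -/
def dotp (a b : Plane) : ℝ := a 0 * b 0 + a 1 * b 1

/-- The vector `a` turned counterclockwise by a right angle. -/
noncomputable def perp (a : Plane) : Plane := !₂[-a 1, a 0]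

@[simp] lemma perp_zero_coord (a : Plane) : perp a 0 = -a 1 := by simp [perp]

@[simp] lemma perp_one_coord (a : Plane) : perp a 1 = a 0 := by simp [perp]

lemma plane_ext {a b : Plane} (h0 : a 0 = b 0) (h1 : a 1 = b 1) : a = b := by
  ext i
  fin_cases i
  · exact h0
  · exact h1

lemma plane_ne_zero_iff (a : Plane) : a ≠ 0 ↔ 0 < dotp a a := by
  constructor
  · intro h
    by_contra hc
    apply h
    have h0 : a 0 = 0 := by simp only [dotp] at hc; nlinarith [mul_self_nonneg (a 0), mul_self_nonneg (a 1)]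
    have h1 : a 1 = 0 := by simp only [dotp] at hc; nlinarith [mul_self_nonneg (a 0), mul_self_nonneg (a 1)]
    exact plane_ext (by simpa using h0) (by simpa using h1)
  · rintro h rfl
    simp [dotp] at h

/-- The plane as the complex numbers. -/
noncomputable def toComplex (p : Plane) : ℂ := ⟨p 0, p 1⟩

@[simp] lemma toComplex_re (p : Plane) : (toComplex p).re = p 0 := rfl

@[simp] lemma toComplex_im (p : Plane) : (toComplex p).im = p 1 := rfl

lemma toComplex_injective : Function.Injective toComplex := fun a b h =>
  plane_ext (by simpa using congrArg Complex.re h) (by simpa using congrArg Complex.im h)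

lemma toComplex_sub (a b : Plane) : toComplex (a - b) = toComplex a - toComplex b := by
  apply Complex.ext <;> simp

lemma continuous_toComplex : Continuous toComplex := by
  have : toComplex = fun p : Plane => (p 0 : ℂ) + (p 1 : ℂ) * Complex.I := by
    funext p
    apply Complex.ext <;> simp
  rw [this]
  fun_prop

lemma norm_toComplex (p : Plane) : ‖toComplex p‖ = ‖p‖ := by
  rw [EuclideanSpace.norm_eq, Complex.norm_def, Complex.normSq_apply]
  simp [pow_two]

/-! ### The winding number of a polygon -/

/-- The quotient whose argument is the angle under which `[a, b]` is seen from `x`. -/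
noncomputable def viewRatio (a b x : Plane) : ℂ :=
  (toComplex b - toComplex x) / (toComplex a - toComplex x)

lemma toComplex_sub_ne_zero {a b : Plane} (h : a ≠ b) : toComplex a - toComplex b ≠ 0 :=
  sub_ne_zero.2 fun h' => h (toComplex_injective h')

/-- A real quotient `r ≤ 0` would make `x` the convex combination of `a` and `b` with weights `-r /
(1 - r)` and `1 / (1 - r)`. This is what makes the viewing angle continuous off the segment. -/
lemma viewRatio_mem_slitPlane {a b x : Plane} (h : x ∉ segment ℝ a b) :
    viewRatio a b x ∈ Complex.slitPlane := by
  have hax : a ≠ x := fun h' => h (h' ▸ left_mem_segment ℝ a b)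
  by_contra hc
  rw [Complex.mem_slitPlane_iff, not_or, not_lt, not_not] at hc
  obtain ⟨hre, him⟩ := hc
  set r := (viewRatio a b x).re
  have hv : viewRatio a b x = (r : ℂ) := Complex.ext (by simp [r]) (by simpa using him)
  have h1 : toComplex b - toComplex x = r * (toComplex a - toComplex x) := by
    rw [← hv, viewRatio, div_mul_cancel₀ _ (toComplex_sub_ne_zero hax)]
  have e0 : b 0 - x 0 = r * (a 0 - x 0) := by simpa using congrArg Complex.re h1
  have e1 : b 1 - x 1 = r * (a 1 - x 1) := by simpa using congrArg Complex.im h1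
  have hr : (1 - r) ≠ 0 := by linarith
  apply h
  refine ⟨-r / (1 - r), 1 / (1 - r), div_nonneg (by linarith) (by linarith),
    div_nonneg (by linarith) (by linarith), by field_simp; ring, ?_⟩
  apply plane_ext
  · simp; field_simp; linarith
  · simp; field_simp; linarith

lemma continuousAt_viewRatio {a b x : Plane} (h : a ≠ x) : ContinuousAt (viewRatio a b) x := by
  unfold viewRatio
  exact ((continuous_const.sub continuous_toComplex).continuousAt).div
    ((continuous_const.sub continuous_toComplex).continuousAt) (toComplex_sub_ne_zero h)

lemma continuousAt_arg_viewRatio {a b x : Plane} (h : x ∉ segment ℝ a b) :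
    ContinuousAt (fun y => (viewRatio a b y).arg) x :=
  (Complex.continuousAt_arg (viewRatio_mem_slitPlane h)).comp
    (continuousAt_viewRatio fun h' => h (h' ▸ left_mem_segment ℝ a b))

namespace Polygon

variable {n : ℕ}

lemma edgeSet_eq_segment (P : Polygon Plane n) (i : Fin n) :
    P.edgeSet ℝ i = segment ℝ (P i) (P (finRotate n i)) := by
  rw [edgeSet, affineSegment_eq_segment]

lemma mem_boundary_iff (P : Polygon Plane n) (x : Plane) :
    x ∈ P.boundary ℝ ↔ ∃ i, x ∈ segment ℝ (P i) (P (finRotate n i)) := by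
  simp [boundary, edgeSet_eq_segment]

/-- The total angle (in `2πℤ`) by which the polygon winds around a point off its boundary. -/
noncomputable def winding (P : Polygon Plane n) (x : Plane) : ℝ :=
  ∑ i, (viewRatio (P i) (P (finRotate n i)) x).arg

/-- After normalization the quotients telescope around the cycle, so the exponential of `i` times
the total angle is `1`. -/
lemma winding_mem (P : Polygon Plane n) {x : Plane} (hx : x ∉ P.boundary ℝ) :
    ∃ k : ℤ, P.winding x = k * (2 * Real.pi) := by
  rw [mem_boundary_iff, not_exists] at hx
  have hne : ∀ i, toComplex (P i) - toComplex x ≠ 0 := fun i =>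
    toComplex_sub_ne_zero fun h' => hx i (h' ▸ left_mem_segment ℝ _ _)
  set g : Fin n → ℂ := fun i =>
    (toComplex (P i) - toComplex x) / (‖toComplex (P i) - toComplex x‖ : ℂ) with hg
  have hgne : ∀ i, g i ≠ 0 := fun i => div_ne_zero (hne i) (by simpa using hne i)
  have harg : ∀ i, Complex.exp ((viewRatio (P i) (P (finRotate n i)) x).arg * Complex.I)
      = g (finRotate n i) / g i := by
    intro i
    have h1 := Complex.norm_mul_exp_arg_mul_I (viewRatio (P i) (P (finRotate n i)) x)
    have h2 : viewRatio (P i) (P (finRotate n i)) x ≠ 0 := div_ne_zero (hne _) (hne _)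
    have h3 : (‖viewRatio (P i) (P (finRotate n i)) x‖ : ℂ) ≠ 0 := by simpa using h2
    rw [← mul_right_inj' h3, h1, hg]
    simp only [viewRatio, norm_div, Complex.ofReal_div]
    have := hne i
    have := hne (finRotate n i)
    have h4 : (‖toComplex (P i) - toComplex x‖ : ℂ) ≠ 0 := by simpa using hne i
    have h5 : (‖toComplex (P (finRotate n i)) - toComplex x‖ : ℂ) ≠ 0 := by
      simpa using hne (finRotate n i)
    field_simp
  have hexp : Complex.exp (P.winding x * Complex.I) = 1 := by
    rw [winding, Complex.ofReal_sum, Finset.sum_mul, Complex.exp_sum]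
    simp_rw [harg]
    rw [Finset.prod_div_distrib, Equiv.prod_comp (finRotate n) g,
      div_self (Finset.prod_ne_zero_iff.2 fun i _ => hgne i)]
  obtain ⟨k, hk⟩ := Complex.exp_eq_one_iff.1 hexp
  refine ⟨k, ?_⟩
  have := congrArg Complex.im hk
  simpa using this

lemma continuousAt_winding (P : Polygon Plane n) {x : Plane} (hx : x ∉ P.boundary ℝ) :
    ContinuousAt P.winding x := by
  rw [mem_boundary_iff, not_exists] at hx
  unfold winding
  exact tendsto_finsetSum _ fun i _ => continuousAt_arg_viewRatio (hx i)

/-- The total angle is continuous with values in `2πℤ`; if it took two values on a connected set, it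
would also take the smaller one plus `π`. -/
lemma winding_eq_of_isPreconnected (P : Polygon Plane n) {T : Set Plane}
    (hT : T ⊆ (P.boundary ℝ)ᶜ) (hc : IsPreconnected T) {x y : Plane} (hx : x ∈ T) (hy : y ∈ T) :
    P.winding x = P.winding y := by
  have hcont : ContinuousOn P.winding T := fun z hz =>
    (P.continuousAt_winding (hT hz)).continuousWithinAt
  have hpi := Real.pi_pos
  have key : ∀ a ∈ T, ∀ b ∈ T, ¬ P.winding a < P.winding b := by
    intro a ha b hb hab
    obtain ⟨k, hk⟩ := P.winding_mem (hT ha)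
    obtain ⟨l, hl⟩ := P.winding_mem (hT hb)
    have hkl : (k : ℝ) < l := by
      rw [hk, hl] at hab
      exact lt_of_mul_lt_mul_right hab (by positivity)
    have hkl' : (k : ℝ) + 1 ≤ l := by exact_mod_cast (by exact_mod_cast hkl : k < l)
    have hmem : P.winding a + Real.pi ∈ Set.Icc (P.winding a) (P.winding b) := by
      constructor
      · linarith
      · rw [hk, hl]; nlinarith
    obtain ⟨c, hcT, hcv⟩ := hc.intermediate_value ha hb hcont hmem
    obtain ⟨m, hm⟩ := P.winding_mem (hT hcT)
    rw [hm, hk] at hcv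
    have h1 : (2 * m : ℝ) = 2 * k + 1 := by
      have : (2 * (m : ℝ) - (2 * k + 1)) * Real.pi = 0 := by linarith
      rcases mul_eq_zero.1 this with h | h
      · linarith
      · linarith
    have h2 : 2 * m = 2 * k + 1 := by exact_mod_cast h1
    omega
  exact le_antisymm (not_lt.1 (key y hy x hx)) (not_lt.1 (key x hx y hy))

/-- Seen from far away every quotient is close to `1`, so each of the `n` angles is at most `1 / (n
+ 1)` and their sum is a multiple of `2π` of size at most `1`. -/
lemma exists_winding_eq_zero (P : Polygon Plane n) :
    ∃ R : ℝ, ∀ x, R < ‖x‖ → x ∉ P.boundary ℝ → P.winding x = 0 := by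
  have hpi := Real.pi_pos
  have h1 : ContinuousAt Complex.arg 1 := Complex.continuousAt_arg (by simp)
  obtain ⟨δ, hδ, hd⟩ := Metric.continuousAt_iff.1 h1 (1 / (n + 1)) (by positivity)
  obtain ⟨M, hM⟩ := (Set.finite_range fun i => ‖P i‖).bddAbove
  have hM' : ∀ i, ‖P i‖ ≤ M := fun i => hM ⟨i, rfl⟩
  refine ⟨2 * |M| / δ + |M| + 1, fun x hx hxb => ?_⟩
  have hA : ∀ i, |(viewRatio (P i) (P (finRotate n i)) x).arg| ≤ 1 / (n + 1) := by
    intro i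
    have hpos : 2 * |M| / δ + 1 < ‖toComplex (P i) - toComplex x‖ := by
      rw [← toComplex_sub, norm_toComplex]
      have := norm_sub_norm_le x (P i)
      rw [norm_sub_rev] at this
      have := hM' i
      have := le_abs_self M
      linarith
    have hfrac : 0 ≤ 2 * |M| / δ := by positivity
    have hne : toComplex (P i) - toComplex x ≠ 0 := norm_pos_iff.1 (by linarith)
    have hr : viewRatio (P i) (P (finRotate n i)) x - 1
        = (toComplex (P (finRotate n i)) - toComplex (P i)) / (toComplex (P i) - toComplex x) := by
      rw [viewRatio]
      field_simp
      ring
    have hlt : dist (viewRatio (P i) (P (finRotate n i)) x) 1 < δ := by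
      rw [dist_eq_norm, hr, norm_div, div_lt_iff₀ (by linarith)]
      have : ‖toComplex (P (finRotate n i)) - toComplex (P i)‖ ≤ 2 * |M| := by
        rw [← toComplex_sub, norm_toComplex]
        have := norm_sub_le (P (finRotate n i)) (P i)
        have := hM' i
        have := hM' (finRotate n i)
        have := le_abs_self M
        linarith
      have h3 : 2 * |M| = δ * (2 * |M| / δ) := by field_simp
      nlinarith
    have := hd hlt
    rw [Complex.arg_one, Real.dist_eq, sub_zero] at this
    exact this.le
  obtain ⟨k, hk⟩ := P.winding_mem hxb
  have hle : |P.winding x| ≤ 1 := by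
    calc |P.winding x| ≤ ∑ i, |(viewRatio (P i) (P (finRotate n i)) x).arg| :=
          Finset.abs_sum_le_sum_abs _ _
      _ ≤ ∑ _i : Fin n, (1 / (n + 1) : ℝ) := Finset.sum_le_sum fun i _ => hA i
      _ = n / (n + 1) := by simp; ring
      _ ≤ 1 := by rw [div_le_one (by positivity)]; linarith
  rw [hk, abs_mul, abs_of_pos (by positivity : (0 : ℝ) < 2 * Real.pi)] at hle
  have hk0 : k = 0 := by
    by_contra hk0
    have : (1 : ℝ) ≤ |(k : ℝ)| := by exact_mod_cast Int.one_le_abs hk0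
    have := Real.pi_gt_three
    nlinarith
  rw [hk, hk0]
  simp

end Polygon

/-! ### The jump of the winding number across an edge -/

open Filter Topology

lemma midpoint_coord (x y : Plane) (i : Fin 2) : midpoint ℝ x y i = (x i + y i) / 2 := by
  rw [midpoint_eq_smul_add]
  simp
  ring

lemma viewRatio_midpoint_add {a b : Plane} (h : a ≠ b) (t : ℝ) :
    viewRatio a b (midpoint ℝ a b + t • perp (b - a)) =
      (1 / 2 - t * Complex.I) / (-(1 / 2) - t * Complex.I) := by
  have hE := toComplex_sub_ne_zero h.symm
  have h2 : (-(1 / 2) - t * Complex.I) ≠ 0 := fun h => by simpa using congrArg Complex.re h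
  have hm : toComplex (midpoint ℝ a b + t • perp (b - a)) = (toComplex a + toComplex b) / 2 +
      t * Complex.I * (toComplex b - toComplex a) := by
    apply Complex.ext
    · simp [midpoint_coord]; ring
    · simp [midpoint_coord]
  have e1 : toComplex b - toComplex (midpoint ℝ a b + t • perp (b - a)) =
      (1 / 2 - t * Complex.I) * (toComplex b - toComplex a) := by rw [hm]; ring
  have e2 : toComplex a - toComplex (midpoint ℝ a b + t • perp (b - a)) =
      (-(1 / 2) - t * Complex.I) * (toComplex b - toComplex a) := by rw [hm]; ring
  rw [viewRatio, e1, e2, mul_div_mul_right _ _ hE]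

lemma half_ratio_im (t : ℝ) :
    ((1 / 2 - t * Complex.I) / (-(1 / 2) - t * Complex.I)).im = t / (1 / 4 + t ^ 2) := by
  rw [Complex.div_im]
  simp [Complex.normSq_apply]
  field_simp
  ring

lemma tendsto_half_ratio : Tendsto (fun t : ℝ => (1 / 2 - t * Complex.I) / (-(1 / 2) - t * Complex.I))
    (𝓝 0) (𝓝 (-1)) := by
  have : ContinuousAt (fun t : ℝ => (1 / 2 - t * Complex.I) / (-(1 / 2) - t * Complex.I)) 0 := by
    apply ContinuousAt.div
    · fun_prop
    · fun_prop
    · intro h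
      simpa using congrArg Complex.re h
  simpa [ContinuousAt] using this

/-- A property holds at all points close to `p` on the open ray with direction `d`. -/
def Germ (F : Plane → Prop) (p d : Plane) : Prop :=
  ∀ᶠ t : ℝ in 𝓝[>] 0, F (p + t • d)

namespace Polygon

variable {n : ℕ}

/-- At the midpoint of an edge the angles of all other edges are continuous, while the angle of this
edge tends to `π` from one side and to `-π` from the other. The two one-sided limits therefore
differ by `2π`. -/
lemma not_winding_eq_zero_both_sides (P : Polygon Plane n) (i : Fin n)
    (hne : P i ≠ P (finRotate n i))
    (hm : ∀ j, j ≠ i → midpoint ℝ (P i) (P (finRotate n i)) ∉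
      segment ℝ (P j) (P (finRotate n j)))
    (h1 : Germ (fun x => P.winding x = 0) (midpoint ℝ (P i) (P (finRotate n i)))
      (perp (P (finRotate n i) - P i)))
    (h2 : Germ (fun x => P.winding x = 0) (midpoint ℝ (P i) (P (finRotate n i)))
      (-perp (P (finRotate n i) - P i))) : False := by
  set a := P i
  set b := P (finRotate n i)
  set m := midpoint ℝ a b
  set v := perp (b - a)
  set O : Plane → ℝ := fun x => ∑ j ∈ Finset.univ.erase i,
    (viewRatio (P j) (P (finRotate n j)) x).arg with hO
  have hW : ∀ x, P.winding x = (viewRatio a b x).arg + O x := fun x =>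
    (Finset.add_sum_erase _ _ (Finset.mem_univ i)).symm
  have hOc : ContinuousAt O m :=
    tendsto_finsetSum _ fun j hj => continuousAt_arg_viewRatio (hm j (Finset.ne_of_mem_erase hj))
  have hline : ∀ w : Plane, Tendsto (fun t : ℝ => m + t • w) (𝓝[>] 0) (𝓝 m) := by
    intro w
    have : ContinuousAt (fun t : ℝ => m + t • w) 0 := by fun_prop
    have h := this.tendsto
    simp only [zero_smul, add_zero] at h
    exact h.mono_left nhdsWithin_le_nhds
  have hup : Tendsto (fun t : ℝ => (viewRatio a b (m + t • v)).arg) (𝓝[>] 0) (𝓝 Real.pi) := by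
    have := Complex.tendsto_arg_nhdsWithin_im_nonneg_of_re_neg_of_im_zero
      (z := -1) (by simp) (by simp)
    refine this.comp (tendsto_nhdsWithin_iff.2 ⟨?_, ?_⟩)
    · simp_rw [m, v, viewRatio_midpoint_add hne]
      exact tendsto_half_ratio.mono_left nhdsWithin_le_nhds
    · filter_upwards [self_mem_nhdsWithin] with t ht
      have ht : 0 < t := ht
      simp only [m, v, viewRatio_midpoint_add hne, half_ratio_im]
      positivity
  have hdown : Tendsto (fun t : ℝ => (viewRatio a b (m + t • -v)).arg) (𝓝[>] 0)
      (𝓝 (-Real.pi)) := by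
    have := Complex.tendsto_arg_nhdsWithin_im_neg_of_re_neg_of_im_zero
      (z := -1) (by simp) (by simp)
    have hneg : ∀ t : ℝ, t • -v = (-t) • v := fun t => by rw [smul_neg, neg_smul]
    refine this.comp (tendsto_nhdsWithin_iff.2 ⟨?_, ?_⟩)
    · simp_rw [hneg, m, v, viewRatio_midpoint_add hne]
      have h0 : Tendsto (fun t : ℝ => -t) (𝓝[>] 0) (𝓝 0) := by
        have : ContinuousAt (fun t : ℝ => -t) 0 := by fun_prop
        have h := this.tendsto
        simp only [neg_zero] at h
        exact h.mono_left nhdsWithin_le_nhds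
      exact tendsto_half_ratio.comp h0
    · filter_upwards [self_mem_nhdsWithin] with t ht
      have ht : 0 < t := ht
      simp only [hneg, m, v, viewRatio_midpoint_add hne, half_ratio_im]
      rw [neg_div, neg_sq]
      have : 0 < t / (1 / 4 + t ^ 2) := by positivity
      linarith
  have u1 : Tendsto (fun _ : ℝ => (0 : ℝ)) (𝓝[>] 0) (𝓝 (Real.pi + O m)) := by
    refine (hup.add (hOc.tendsto.comp (hline v))).congr' ?_
    filter_upwards [h1] with t ht
    simpa [hW] using ht
  have u2 : Tendsto (fun _ : ℝ => (0 : ℝ)) (𝓝[>] 0) (𝓝 (-Real.pi + O m)) := by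
    refine (hdown.add (hOc.tendsto.comp (hline (-v)))).congr' ?_
    filter_upwards [h2] with t ht
    simpa [hW] using ht
  have e1 := tendsto_nhds_unique u1 tendsto_const_nhds
  have e2 := tendsto_nhds_unique u2 tendsto_const_nhds
  have := Real.pi_pos
  linarith

/-- A property of points that is constant on connected sets off the boundary. -/
def LocConst (P : Polygon Plane n) (F : Plane → Prop) : Prop :=
  ∀ T ⊆ (P.boundary ℝ)ᶜ, IsPreconnected T → ∀ x ∈ T, ∀ y ∈ T, F x → F y

/-- The connected set `T` is a bridge: it contains the beginnings of both rays and avoids the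
boundary. -/
lemma LocConst.germ_of_germ {P : Polygon Plane n} {F : Plane → Prop} (hF : P.LocConst F)
    {T : Set Plane} (hT : T ⊆ (P.boundary ℝ)ᶜ) (hc : IsPreconnected T) {p d p' d' : Plane}
    (h : Germ (· ∈ T) p d) (h' : Germ (· ∈ T) p' d') (hg : Germ F p d) : Germ F p' d' := by
  obtain ⟨t, ht, hFt⟩ := (Filter.Eventually.and h hg).exists
  filter_upwards [h'] with s hs
  exact hF T hT hc _ ht _ hs hFt

end Polygon

/-! ### Thin triangles beside edges, and sectors at vertices -/

lemma det2_smul_left (t : ℝ) (a b : Plane) : det2 (t • a) b = t * det2 a b := by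
  simp [det2]; ring

lemma det2_smul_right (t : ℝ) (a b : Plane) : det2 a (t • b) = t * det2 a b := by
  simp [det2]; ring

lemma det2_add_left (a b c : Plane) : det2 (a + b) c = det2 a c + det2 b c := by
  simp [det2]; ring

lemma det2_add_right (a b c : Plane) : det2 a (b + c) = det2 a b + det2 a c := by
  simp [det2]; ring

@[simp] lemma det2_self (a : Plane) : det2 a a = 0 := by
  simp [det2]; ring

lemma det2_neg_left (a b : Plane) : det2 (-a) b = -det2 a b := by
  simp [det2]; ring

lemma det2_neg_right (a b : Plane) : det2 a (-b) = -det2 a b := by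
  simp [det2]; ring

@[simp] lemma det2_zero_left (a : Plane) : det2 0 a = 0 := by simp [det2]

@[simp] lemma det2_zero_right (a : Plane) : det2 a 0 = 0 := by simp [det2]

lemma det2_swap (a b : Plane) : det2 a b = -det2 b a := by
  simp [det2]; ring

lemma det2_perp (a b : Plane) : det2 a (perp b) = dotp a b := by
  simp [det2, dotp]

lemma det2_perp_left (a b : Plane) : det2 (perp a) b = -dotp a b := by
  simp [det2, dotp]; ring

lemma det2_perp_self_pos {a : Plane} (h : a ≠ 0) : 0 < det2 a (perp a) := by
  rw [det2_perp]
  exact (plane_ne_zero_iff a).1 h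

/-- A thin triangle with apex `p` along the vector `h` avoids a segment that meets
the axis of the triangle at most in a common endpoint at the apex. -/
lemma eventually_thin_avoids {c d p h v : Plane} (hv : det2 h v ≠ 0)
    (H : ∀ s ∈ Set.Icc (0 : ℝ) (1 / 2), p + s • h ∈ segment ℝ c d → c = p ∨ d = p)
    (H0 : ∀ s ∈ Set.Ioc (0 : ℝ) (1 / 2), p + s • h ∉ segment ℝ c d) :
    ∀ᶠ τ : ℝ in 𝓝[>] 0, ∀ s ∈ Set.Ioc (0 : ℝ) (1 / 2), p + s • (h + τ • v) ∉ segment ℝ c d := by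
  have ends : ∀ d : Plane, ∀ᶠ τ : ℝ in 𝓝[>] 0, ∀ s ∈ Set.Ioc (0 : ℝ) (1 / 2),
      p + s • (h + τ • v) ∉ segment ℝ p d := by
    intro d
    -- If `d - p` is parallel to the axis, the tilted ray leaves its line at once because `det2 h v
    -- ≠ 0`; otherwise a small tilt does not make the ray parallel to `d - p`.
    have hev : ∀ᶠ τ : ℝ in 𝓝[>] 0, det2 h (d - p) = 0 ∨ det2 h (d - p) ≠ -(τ * det2 v (d - p)) := by
      by_cases hc : det2 h (d - p) = 0
      · exact Eventually.of_forall fun _ => Or.inl hc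
      · have : ContinuousAt (fun τ : ℝ => det2 h (d - p) + τ * det2 v (d - p)) 0 := by fun_prop
        have h2 := this.eventually_ne (by simpa using hc : det2 h (d - p) + 0 * det2 v (d - p) ≠ 0)
        filter_upwards [nhdsWithin_le_nhds h2] with τ hτ
        right
        intro h3
        exact hτ (by linarith)
    filter_upwards [hev, self_mem_nhdsWithin] with τ hτ hpos s hs hmem
    have hpos : 0 < τ := hpos
    obtain ⟨x, y, hx, hy, hxy, e⟩ := hmem
    have e' : s • (h + τ • v) = y • (d - p) := by
      have : x = 1 - y := by linarith
      subst this
      have h4 : p + y • (d - p) = p + s • (h + τ • v) := by rw [← e]; module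
      exact (add_left_cancel h4).symm
    have c1 := congrArg (fun z => det2 z (d - p)) e'
    have c2 := congrArg (fun z => det2 h z) e'
    simp only [det2_smul_left, det2_add_left, det2_self, mul_zero] at c1
    simp only [det2_smul_right, det2_add_right, det2_self, zero_add] at c2
    have hs0 := hs.1
    have c1' : det2 h (d - p) = -(τ * det2 v (d - p)) := by
      rcases mul_eq_zero.1 c1 with h | h
      · linarith
      · linarith
    rcases hτ with h0 | h0
    · rw [h0, mul_zero] at c2
      rcases mul_eq_zero.1 c2 with h | h
      · linarith
      · rcases mul_eq_zero.1 h with h | h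
        · linarith
        · exact hv h
    · exact h0 c1'
  by_cases hcp : c = p
  · subst hcp; exact ends d
  by_cases hdp : d = p
  · subst hdp
    rw [segment_symm]
    exact ends c
  -- A segment that does not end at the apex misses the compact axis, hence has a positive distance
  -- `δ` from it, and the triangle stays within `τ * ‖v‖` of the axis.
  set A : Set Plane := (fun s : ℝ => p + s • h) '' Set.Icc 0 (1 / 2)
  have hA : IsCompact A := isCompact_Icc.image (by fun_prop)
  have hd : Disjoint A (segment ℝ c d) := by
    rw [Set.disjoint_left]
    rintro _ ⟨s, hs, rfl⟩ hm
    rcases H s hs hm with h | h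
    · exact hcp h
    · exact hdp h
  have hcl : IsClosed (segment ℝ c d) := by
    rw [← convexHull_pair]
    exact (Set.toFinite {c, d}).isClosed_convexHull ℝ
  obtain ⟨δ, hδ, hdis⟩ := hd.exists_cthickenings hA hcl
  have hτ : ∀ᶠ τ : ℝ in 𝓝[>] 0, τ * ‖v‖ < δ := by
    have : ContinuousAt (fun τ : ℝ => τ * ‖v‖) 0 := by fun_prop
    exact nhdsWithin_le_nhds (this.eventually_lt continuousAt_const (by simpa using hδ))
  filter_upwards [hτ, self_mem_nhdsWithin] with τ hτ hpos s hs hmem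
  have hpos : 0 < τ := hpos
  refine Set.disjoint_left.1 hdis ?_ (Metric.self_subset_cthickening _ hmem)
  refine Metric.mem_cthickening_of_dist_le _ (p + s • h) _ _ ⟨s, ⟨hs.1.le, hs.2⟩, rfl⟩ ?_
  have : p + s • (h + τ • v) - (p + s • h) = (s * τ) • v := by module
  rw [dist_eq_norm, this, norm_smul, Real.norm_of_nonneg (by have := hs.1; positivity)]
  have h1 : s * (τ * ‖v‖) ≤ 1 * (τ * ‖v‖) :=
    mul_le_mul_of_nonneg_right (by linarith [hs.2]) (by positivity)
  linarith

/-- The directions strictly to the left of a path that comes in along `-a` and leaves along `b`. -/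
def LeftSector (b a d : Plane) : Prop :=
  (0 < det2 b a ∧ 0 < det2 b d ∧ 0 < det2 d a) ∨
    (det2 b a ≤ 0 ∧ (0 < det2 b d ∨ 0 < det2 d a))

lemma finRotate_ne_self {n : ℕ} (h : 2 ≤ n) (i : Fin n) : finRotate n i ≠ i := by
  obtain ⟨m, rfl⟩ : ∃ m, n = m + 1 := ⟨n - 1, by omega⟩
  intro he
  have h1 := congrArg Fin.val he
  rw [coe_finRotate] at h1
  split_ifs at h1 with h2
  · rw [h2, Fin.val_last] at h1; omega
  · omega

lemma finRotate_finRotate_ne_self {n : ℕ} (h : 3 ≤ n) (i : Fin n) :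
    finRotate n (finRotate n i) ≠ i := by
  obtain ⟨m, rfl⟩ : ∃ m, n = m + 1 := ⟨n - 1, by omega⟩
  intro he
  have h1 := congrArg Fin.val he
  by_cases h2 : i = Fin.last m
  · subst h2
    rw [finRotate_last, coe_finRotate_of_ne_last (by simp [Fin.ext_iff]; omega)] at h1
    simp at h1
    omega
  · have h3 := coe_finRotate_of_ne_last h2
    rw [coe_finRotate] at h1
    split_ifs at h1 with h4
    · rw [h4, Fin.val_last] at h3
      omega
    · omega

lemma forall_of_finRotate {n : ℕ} {p : Fin n → Prop} (h : ∀ i, p i → p (finRotate n i))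
    {i : Fin n} (hi : p i) (j : Fin n) : p j := by
  obtain ⟨m, rfl⟩ : ∃ m, n = m + 1 := ⟨n - 1, by have := i.2; omega⟩
  have h0 : p 0 := by
    have : ∀ k : ℕ, ∀ i : Fin (m + 1), i.val + k = m → p i → p 0 := by
      intro k
      induction k with
      | zero =>
        intro i hk hi
        have : i = Fin.last m := Fin.ext (by simpa using hk)
        subst this
        simpa using h _ hi
      | succ k ih =>
        intro i hk hi
        refine ih (finRotate _ i) ?_ (h i hi)
        rw [coe_finRotate_of_ne_last (fun h => by subst h; simp at hk)]
        omega
    exact this (m - i.val) i (by have := i.2; omega) hi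
  obtain ⟨k, hk⟩ := j
  induction k with
  | zero => exact h0
  | succ k ih =>
    have := h _ (ih (by omega))
    rwa [finRotate_of_lt (by omega)] at this

namespace Polygon

variable {n : ℕ} {P : Polygon Plane n}

lemma IsSimple.ne_next (hs : P.IsSimple) (i : Fin n) : P i ≠ P (finRotate n i) := fun h =>
  finRotate_ne_self (by have := hs.1; omega) i (hs.2.1 h).symm

lemma IsSimple.inter (hs : P.IsSimple) {i j : Fin n} (hij : i ≠ j) {x : Plane}
    (hi : x ∈ segment ℝ (P i) (P (finRotate n i))) (hj : x ∈ segment ℝ (P j) (P (finRotate n j))) :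
    (x = P i ∨ x = P (finRotate n i)) ∧ (x = P j ∨ x = P (finRotate n j)) := by
  have := hs.2.2 i j hij
  rw [edgeSet_eq_segment, edgeSet_eq_segment] at this
  simpa using this ⟨hi, hj⟩

/-- `v` and `q` are the two ends of an edge. -/
def IsEdge (P : Polygon Plane n) (v q : Plane) : Prop :=
  ∃ k, (v = P k ∧ q = P (finRotate n k)) ∨ (v = P (finRotate n k) ∧ q = P k)

lemma IsEdge.ne {v q : Plane} (hs : P.IsSimple) (h : P.IsEdge v q) : v ≠ q := by
  obtain ⟨k, ⟨rfl, rfl⟩ | ⟨rfl, rfl⟩⟩ := h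
  exacts [hs.ne_next k, (hs.ne_next k).symm]

lemma IsEdge.eventually_thin {v q w : Plane} (hs : P.IsSimple) (he : P.IsEdge v q)
    (hw : det2 (q - v) w ≠ 0) :
    ∀ᶠ τ : ℝ in 𝓝[>] 0, ∀ s ∈ Set.Ioc (0 : ℝ) (1 / 2),
      v + s • ((q - v) + τ • w) ∉ P.boundary ℝ := by
  have hne := he.ne hs
  obtain ⟨k, hk⟩ := he
  have hseg : segment ℝ v q = segment ℝ (P k) (P (finRotate n k)) := by
    rcases hk with ⟨rfl, rfl⟩ | ⟨rfl, rfl⟩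
    · rfl
    · exact segment_symm ..
  have hqv : q - v ≠ 0 := sub_ne_zero.2 hne.symm
  have all : ∀ j, ∀ᶠ τ : ℝ in 𝓝[>] 0, ∀ s ∈ Set.Ioc (0 : ℝ) (1 / 2),
      v + s • ((q - v) + τ • w) ∉ segment ℝ (P j) (P (finRotate n j)) := by
    intro j
    by_cases hjk : j = k
    · subst hjk
      rw [← hseg]
      filter_upwards [self_mem_nhdsWithin] with τ hτ s hs' hmem
      have hτ : 0 < τ := hτ
      rw [segment_eq_image'] at hmem
      obtain ⟨θ, _, e⟩ := hmem
      have c := congrArg (fun z => det2 (q - v) z) (add_left_cancel e)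
      simp only [det2_smul_right, det2_add_right, det2_self] at c
      have := mul_ne_zero (mul_ne_zero hs'.1.ne' hτ.ne') hw
      apply this
      linarith
    · have base : ∀ s ∈ Set.Icc (0 : ℝ) (1 / 2),
          v + s • (q - v) ∈ segment ℝ (P j) (P (finRotate n j)) →
          s = 0 ∧ (P j = v ∨ P (finRotate n j) = v) := by
        intro s hs' hm
        have hm2 : v + s • (q - v) ∈ segment ℝ (P k) (P (finRotate n k)) := by
          rw [← hseg, segment_eq_image']
          exact ⟨s, ⟨hs'.1, by linarith [hs'.2]⟩, rfl⟩
        obtain ⟨h1, h2⟩ := hs.inter hjk hm hm2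
        have h3 : v + s • (q - v) = v ∨ v + s • (q - v) = q := by
          rcases hk with ⟨rfl, rfl⟩ | ⟨rfl, rfl⟩
          · exact h2
          · exact h2.symm
        have hs0 : s = 0 := by
          rcases h3 with h3 | h3
          · have : s • (q - v) = 0 := by simpa using h3
            exact (smul_eq_zero.1 this).resolve_right hqv
          · exfalso
            have : (1 - s) • (q - v) = 0 := by
              have : (1 - s) • (q - v) = q - (v + s • (q - v)) := by module
              rw [this, h3, sub_self]
            have := (smul_eq_zero.1 this).resolve_right hqv
            linarith [hs'.2]
        refine ⟨hs0, ?_⟩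
        subst hs0
        simp only [zero_smul, add_zero] at h1
        exact h1.imp Eq.symm Eq.symm
      exact eventually_thin_avoids hw (fun s hs' hm => (base s hs' hm).2)
        fun s hs' hm => hs'.1.ne' (base s ⟨hs'.1.le, hs'.2⟩ hm).1
  filter_upwards [eventually_all.2 all] with τ hτ s hs' hm
  obtain ⟨j, hj⟩ := (mem_boundary_iff P _).1 hm
  exact hτ j s hs' hj

/-- What happens close to one side of an edge is the same at its midpoint and at its ends. -/
lemma IsEdge.eventually_germ_iff {F : Plane → Prop} {v q w : Plane} (hs : P.IsSimple)
    (he : P.IsEdge v q) (hF : P.LocConst F) (hw : det2 (q - v) w ≠ 0) :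
    ∀ᶠ τ : ℝ in 𝓝[>] 0, (Germ F v ((q - v) + τ • w) ↔ Germ F (midpoint ℝ v q) w) := by
  obtain ⟨κ, hκ, hsub⟩ := mem_nhdsGT_iff_exists_Ioo_subset.1 (he.eventually_thin hs hw)
  have hκ : 0 < κ := hκ
  -- The half of a thin triangle with apex `v`: its points with `s = 1/2` fill the ray from the
  -- midpoint, and for each fixed `τ` it contains a ray from `v`.
  set T : Set Plane := (fun z : ℝ × ℝ => v + z.1 • ((q - v) + z.2 • w)) ''
    (Set.Ioc 0 (1 / 2) ×ˢ Set.Ioo 0 κ) with hTdef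
  have hT : T ⊆ (P.boundary ℝ)ᶜ := by
    rintro _ ⟨⟨s, τ⟩, ⟨h1, h2⟩, rfl⟩
    exact hsub h2 s h1
  have hc : IsPreconnected T :=
    (isPreconnected_Ioc.prod isPreconnected_Ioo).image _ (by fun_prop)
  have hmid : Germ (· ∈ T) (midpoint ℝ v q) w := by
    filter_upwards [Ioo_mem_nhdsGT (show (0 : ℝ) < κ / 2 by positivity)] with t ht
    refine ⟨(1 / 2, 2 * t), ⟨⟨by norm_num, le_rfl⟩, ⟨by simpa using ht.1, ?_⟩⟩, ?_⟩
    · have := ht.2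
      dsimp only
      linarith
    · rw [midpoint_eq_smul_add]
      simp only [invOf_eq_inv]
      module
  filter_upwards [Ioo_mem_nhdsGT hκ] with τ hτ
  have hend : Germ (· ∈ T) v ((q - v) + τ • w) := by
    filter_upwards [Ioo_mem_nhdsGT (show (0 : ℝ) < 1 / 2 by norm_num)] with t ht
    exact ⟨(t, τ), ⟨⟨ht.1, ht.2.le⟩, hτ⟩, rfl⟩
  exact ⟨hF.germ_of_germ hT hc hend hmid, hF.germ_of_germ hT hc hmid hend⟩

/-- `p` and `q` are the two neighbours of the vertex `i`, in some order. -/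
def IsNeighbors (P : Polygon Plane n) (i : Fin n) (p q : Plane) : Prop :=
  (p = P ((finRotate n).symm i) ∧ q = P (finRotate n i)) ∨
    (p = P (finRotate n i) ∧ q = P ((finRotate n).symm i))

lemma IsNeighbors.symm {i : Fin n} {p q : Plane} (h : P.IsNeighbors i p q) :
    P.IsNeighbors i q p := by
  rcases h with h | h
  exacts [Or.inr h.symm, Or.inl h.symm]

lemma isNeighbors (P : Polygon Plane n) (i : Fin n) :
    P.IsNeighbors i (P ((finRotate n).symm i)) (P (finRotate n i)) := Or.inl ⟨rfl, rfl⟩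

lemma IsNeighbors.isEdge {i : Fin n} {p q : Plane} (h : P.IsNeighbors i p q) :
    P.IsEdge (P i) q := by
  rcases h with ⟨rfl, rfl⟩ | ⟨rfl, rfl⟩
  · exact ⟨i, Or.inl ⟨rfl, rfl⟩⟩
  · exact ⟨(finRotate n).symm i, Or.inr ⟨by rw [Equiv.apply_symm_apply], rfl⟩⟩

lemma IsSimple.vertex_mem {i j : Fin n} (hs : P.IsSimple)
    (h : P i ∈ segment ℝ (P j) (P (finRotate n j))) : j = i ∨ j = (finRotate n).symm i := by
  by_cases hji : j = i
  · exact Or.inl hji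
  · rcases (hs.inter hji h (left_mem_segment ℝ _ _)).1 with h1 | h1
    · exact Or.inl (hs.2.1 h1).symm
    · exact Or.inr ((Equiv.eq_symm_apply _).2 (hs.2.1 h1).symm)

lemma isClosed_segment_plane (c d : Plane) : IsClosed (segment ℝ c d) := by
  rw [← convexHull_pair]
  exact (Set.toFinite {c, d}).isClosed_convexHull ℝ

/-- Close to a vertex, the boundary consists of the two edges at this vertex. -/
lemma IsNeighbors.exists_ball {i : Fin n} {p q : Plane} (hs : P.IsSimple)
    (h : P.IsNeighbors i p q) :
    ∃ r > 0, ∀ x ∈ Metric.ball (P i) r, x ∈ P.boundary ℝ →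
      x ∈ segment ℝ (P i) p ∨ x ∈ segment ℝ (P i) q := by
  have ev : ∀ j, ∀ᶠ x in 𝓝 (P i), x ∈ segment ℝ (P j) (P (finRotate n j)) →
      j = i ∨ j = (finRotate n).symm i := by
    intro j
    by_cases hj : P i ∈ segment ℝ (P j) (P (finRotate n j))
    · exact Eventually.of_forall fun _ _ => hs.vertex_mem hj
    · filter_upwards [(isClosed_segment_plane _ _).isOpen_compl.mem_nhds hj] with x hx hx'
      exact absurd hx' hx
  obtain ⟨r, hr, hb⟩ := Metric.eventually_nhds_iff_ball.1 (eventually_all.2 ev)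
  refine ⟨r, hr, fun x hx hxb => ?_⟩
  obtain ⟨j, hj⟩ := (mem_boundary_iff P _).1 hxb
  have h1 : x ∈ segment ℝ (P i) (P (finRotate n i)) ∨
      x ∈ segment ℝ (P i) (P ((finRotate n).symm i)) := by
    rcases hb x hx j hj with rfl | rfl
    · exact Or.inl hj
    · rw [Equiv.apply_symm_apply] at hj
      rw [segment_symm] at hj
      exact Or.inr hj
  rcases h with ⟨rfl, rfl⟩ | ⟨rfl, rfl⟩
  exacts [h1.symm, h1]

/-- A property that is locally constant off the boundary has the same truth value close to a
vertex for all directions of a convex cone without the directions of the two edges. -/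
lemma IsNeighbors.germ_of_cone {F : Plane → Prop} {i : Fin n} {p q : Plane} (hs : P.IsSimple)
    (h : P.IsNeighbors i p q) (hF : P.LocConst F) {K : Set Plane} (hK : Convex ℝ K)
    (hcone : ∀ d ∈ K, ∀ t : ℝ, 0 < t → t • d ∈ K)
    (hp : ∀ t : ℝ, 0 ≤ t → t • (p - P i) ∉ K) (hq : ∀ t : ℝ, 0 ≤ t → t • (q - P i) ∉ K)
    {d d' : Plane} (hd : d ∈ K) (hd' : d' ∈ K) (hg : Germ F (P i) d) : Germ F (P i) d' := by
  obtain ⟨r, hr, hb⟩ := h.exists_ball hs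
  set T : Set Plane := ((fun x => P i + x) '' K) ∩ Metric.ball (P i) r
  have hTc : Convex ℝ T := (hK.translate (P i)).inter (convex_ball _ _)
  have hT : T ⊆ (P.boundary ℝ)ᶜ := by
    rintro _ ⟨⟨x, hx, rfl⟩, hball⟩ hxb
    rcases hb _ hball hxb with h1 | h1
    · rw [segment_eq_image'] at h1
      obtain ⟨θ, hθ, e⟩ := h1
      have := add_left_cancel e
      exact hp θ hθ.1 (this ▸ hx)
    · rw [segment_eq_image'] at h1
      obtain ⟨θ, hθ, e⟩ := h1
      have := add_left_cancel e
      exact hq θ hθ.1 (this ▸ hx)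
  have hgerm : ∀ d ∈ K, Germ (· ∈ T) (P i) d := by
    intro d hd
    have hcont : ContinuousAt (fun t : ℝ => P i + t • d) 0 := by fun_prop
    have hball : ∀ᶠ t : ℝ in 𝓝[>] 0, P i + t • d ∈ Metric.ball (P i) r :=
      nhdsWithin_le_nhds (hcont.eventually_mem (by simpa using Metric.ball_mem_nhds (P i) hr))
    filter_upwards [hball, self_mem_nhdsWithin] with t ht hpos
    exact ⟨⟨_, hcone d hd t hpos, rfl⟩, ht⟩
  exact hF.germ_of_germ hT hTc.isPreconnected (hgerm d hd) (hgerm d' hd') hg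

end Polygon

lemma convex_det2_pos (b : Plane) : Convex ℝ {d : Plane | 0 < det2 b d} :=
  convex_halfSpace_gt ⟨fun x y => det2_add_right b x y, fun c x => by
    simp [det2_smul_right]⟩ 0

lemma exists_smul_of_det2_eq_zero {a b : Plane} (ha : a ≠ 0) (h : det2 a b = 0) :
    b = (dotp a b / dotp a a) • a := by
  have hpos := (plane_ne_zero_iff a).1 ha
  have hpos' : a 0 * a 0 + a 1 * a 1 ≠ 0 := hpos.ne'
  simp only [det2] at h
  apply plane_ext
  · simp only [dotp, PiLp.smul_apply, smul_eq_mul]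
    rw [div_mul_eq_mul_div, eq_div_iff hpos']
    linear_combination (-a 1) * h
  · simp only [dotp, PiLp.smul_apply, smul_eq_mul]
    rw [div_mul_eq_mul_div, eq_div_iff hpos']
    linear_combination (a 0) * h

lemma det2_sub_midpoint_left (v p q : Plane) :
    det2 (q - v) (midpoint ℝ p q - v) = det2 (q - v) (p - v) / 2 := by
  simp only [det2, PiLp.sub_apply, midpoint_coord]
  ring

lemma det2_sub_midpoint_right (v p q : Plane) :
    det2 (midpoint ℝ p q - v) (p - v) = det2 (q - v) (p - v) / 2 := by
  simp only [det2, PiLp.sub_apply, midpoint_coord]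
  ring

/-- A property holds close to the midpoint of the segment from `x` to `y` on its left. -/
def LeftSide (F : Plane → Prop) (x y : Plane) : Prop :=
  Germ F (midpoint ℝ x y) (perp (y - x))

namespace Polygon

variable {n : ℕ} {P : Polygon Plane n}

lemma IsNeighbors.inter_eq {i : Fin n} {p q x : Plane} (hs : P.IsSimple)
    (h : P.IsNeighbors i p q) (hp : x ∈ segment ℝ (P i) p) (hq : x ∈ segment ℝ (P i) q) :
    x = P i := by
  have key : x ∈ segment ℝ (P i) (P ((finRotate n).symm i)) →
      x ∈ segment ℝ (P i) (P (finRotate n i)) → x = P i := by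
    intro h1 h2
    have hne : finRotate n i ≠ (finRotate n).symm i := fun h =>
      finRotate_finRotate_ne_self hs.1 i ((Equiv.eq_symm_apply _).1 h)
    have hne' : i ≠ (finRotate n).symm i := fun h =>
      finRotate_ne_self (by have := hs.1; omega) i ((Equiv.eq_symm_apply _).1 h)
    rw [segment_symm] at h1
    have h3 := hs.inter hne' h2 (j := (finRotate n).symm i) (by rwa [Equiv.apply_symm_apply])
    rw [Equiv.apply_symm_apply] at h3
    rcases h3 with ⟨h4 | h4, h5 | h5⟩
    · exact h4
    · exact h4
    · exact absurd (hs.2.1 (h4.symm.trans h5)) hne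
    · exact h5
  rcases h with ⟨rfl, rfl⟩ | ⟨rfl, rfl⟩
  exacts [key hp hq, key hq hp]

/-- If the two edges left the vertex in the same direction, the end of the shorter one would lie on
the longer one. -/
lemma IsNeighbors.not_same_direction {i : Fin n} {p q : Plane} (hs : P.IsSimple)
    (h : P.IsNeighbors i p q) (hdet : det2 (q - P i) (p - P i) = 0) :
    dotp (q - P i) (p - P i) ≤ 0 := by
  by_contra hdot
  rw [not_le] at hdot
  have hq : q - P i ≠ 0 := sub_ne_zero.2 (h.isEdge.ne hs).symm
  have hp : p - P i ≠ 0 := sub_ne_zero.2 (h.symm.isEdge.ne hs).symm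
  have hμ := exists_smul_of_det2_eq_zero hq hdet
  set μ := dotp (q - P i) (p - P i) / dotp (q - P i) (q - P i)
  have hμ0 : 0 < μ := div_pos hdot ((plane_ne_zero_iff _).1 hq)
  rcases le_total μ 1 with h1 | h1
  · have : p ∈ segment ℝ (P i) q := by
      rw [segment_eq_image']
      exact ⟨μ, ⟨hμ0.le, h1⟩, by dsimp only; rw [← hμ]; simp⟩
    exact hp (sub_eq_zero.2 (h.inter_eq hs (right_mem_segment ℝ _ _) this))
  · have : q ∈ segment ℝ (P i) p := by
      rw [segment_eq_image']
      refine ⟨μ⁻¹, ⟨by positivity, inv_le_one_of_one_le₀ h1⟩, ?_⟩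
      dsimp only
      rw [hμ, smul_smul, inv_mul_cancel₀ hμ0.ne']
      simp
    exact hq (sub_eq_zero.2 (h.inter_eq hs this (right_mem_segment ℝ _ _)))

/-- A sector of angle less than `π` is an intersection of two half-planes, a convex cone without
edge directions. A larger one is the union of two half-planes, and one passes from one to the other
through a common direction. -/
lemma IsNeighbors.germ_of_leftSector {F : Plane → Prop} {i : Fin n} {p q d d' : Plane}
    (hs : P.IsSimple) (h : P.IsNeighbors i p q) (hF : P.LocConst F)
    (hd : LeftSector (q - P i) (p - P i) d) (hd' : LeftSector (q - P i) (p - P i) d')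
    (hg : Germ F (P i) d) : Germ F (P i) d' := by
  have hq : q - P i ≠ 0 := sub_ne_zero.2 (h.isEdge.ne hs).symm
  have hsame := h.not_same_direction hs
  set a := p - P i with ha
  set b := q - P i with hb
  have conv1 := convex_det2_pos b
  have conv2 : Convex ℝ {d : Plane | 0 < det2 d a} := by
    have := convex_det2_pos (-a)
    simpa only [det2_swap (-a), det2_neg_right, neg_neg] using this
  have cone1 : ∀ d : Plane, 0 < det2 b d → ∀ t : ℝ, 0 < t → 0 < det2 b (t • d) := by
    intro d hd t ht
    rw [det2_smul_right]
    positivity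
  have cone2 : ∀ d : Plane, 0 < det2 d a → ∀ t : ℝ, 0 < t → 0 < det2 (t • d) a := by
    intro d hd t ht
    rw [det2_smul_left]
    positivity
  by_cases hba : 0 < det2 b a
  · have e : ∀ d, LeftSector b a d → 0 < det2 b d ∧ 0 < det2 d a := by
      rintro d (h | h)
      · exact h.2
      · exact absurd h.1 (not_le.2 hba)
    refine h.germ_of_cone hs hF (conv1.inter conv2)
      (fun d hd t ht => ⟨cone1 d hd.1 t ht, cone2 d hd.2 t ht⟩)
      (fun t ht hm => ?_) (fun t ht hm => ?_) (e d hd) (e d' hd') hg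
    · have := hm.2
      simp [← ha, det2_smul_left] at this
    · have := hm.1
      simp [← hb, det2_smul_right] at this
  · have hba' := not_lt.1 hba
    have e : ∀ d, LeftSector b a d → 0 < det2 b d ∨ 0 < det2 d a := by
      rintro d (h | h)
      · exact absurd h.1 hba
      · exact h.2
    have g1 : ∀ d d', 0 < det2 b d → 0 < det2 b d' → Germ F (P i) d → Germ F (P i) d' := by
      intro d d' hd hd' hg
      refine h.germ_of_cone hs hF conv1 cone1 (fun t ht hm => ?_) (fun t ht hm => ?_) hd hd' hg
      · have hm : 0 < det2 b (t • a) := hm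
        rw [det2_smul_right] at hm
        nlinarith
      · have hm : 0 < det2 b (t • b) := hm
        simp [det2_smul_right] at hm
    have g2 : ∀ d d', 0 < det2 d a → 0 < det2 d' a → Germ F (P i) d → Germ F (P i) d' := by
      intro d d' hd hd' hg
      refine h.germ_of_cone hs hF conv2 cone2 (fun t ht hm => ?_) (fun t ht hm => ?_) hd hd' hg
      · have hm : 0 < det2 (t • a) a := hm
        simp [det2_smul_left] at hm
      · have hm : 0 < det2 (t • b) a := hm
        rw [det2_smul_left] at hm
        nlinarith
    -- A direction in both half-planes: opposite to both edges, or perpendicular to them when the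
    -- vertex is straight.
    obtain ⟨c, hc1, hc2⟩ : ∃ c, 0 < det2 b c ∧ 0 < det2 c a := by
      rcases hba'.lt_or_eq with h0 | h0
      · refine ⟨-(a + b), ?_, ?_⟩
        · rw [det2_neg_right, det2_add_right, det2_self]
          linarith
        · rw [det2_neg_left, det2_add_left, det2_self]
          linarith
      · refine ⟨perp b, det2_perp_self_pos hq, ?_⟩
        rw [det2_perp_left]
        rcases (hsame h0).lt_or_eq with h1 | h1
        · linarith
        · exfalso
          have hp : a ≠ 0 := sub_ne_zero.2 (h.symm.isEdge.ne hs).symm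
          have h2 := exists_smul_of_det2_eq_zero hq h0
          rw [h1, zero_div, zero_smul] at h2
          exact hp h2
    rcases e d hd with h1 | h1 <;> rcases e d' hd' with h2 | h2
    · exact g1 _ _ h1 h2 hg
    · exact g2 _ _ hc2 h2 (g1 _ _ h1 hc1 hg)
    · exact g1 _ _ hc1 h2 (g2 _ _ h1 hc2 hg)
    · exact g2 _ _ h1 h2 hg

lemma IsNeighbors.eventually_leftSector_next {i : Fin n} {p q : Plane} (hs : P.IsSimple)
    (h : P.IsNeighbors i p q) : ∀ᶠ τ : ℝ in 𝓝[>] 0,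
      LeftSector (q - P i) (p - P i) ((q - P i) + τ • perp (q - P i)) := by
  have hq : q - P i ≠ 0 := sub_ne_zero.2 (h.isEdge.ne hs).symm
  set a := p - P i
  set b := q - P i
  have h1 : ∀ τ : ℝ, 0 < τ → 0 < det2 b (b + τ • perp b) := by
    intro τ hτ
    rw [det2_add_right, det2_self, det2_smul_right, zero_add]
    exact mul_pos hτ (det2_perp_self_pos hq)
  by_cases hba : 0 < det2 b a
  · have hc : ContinuousAt (fun τ : ℝ => det2 b a + τ * det2 (perp b) a) 0 := by fun_prop
    have := hc.eventually_const_lt (show (0 : ℝ) < det2 b a + 0 * det2 (perp b) a by simpa)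
    filter_upwards [nhdsWithin_le_nhds this, self_mem_nhdsWithin] with τ h2 hτ
    refine Or.inl ⟨hba, h1 τ hτ, ?_⟩
    rwa [det2_add_left, det2_smul_left]
  · filter_upwards [self_mem_nhdsWithin] with τ hτ
    exact Or.inr ⟨not_lt.1 hba, Or.inl (h1 τ hτ)⟩

lemma IsNeighbors.eventually_leftSector_prev {i : Fin n} {p q : Plane} (hs : P.IsSimple)
    (h : P.IsNeighbors i p q) : ∀ᶠ τ : ℝ in 𝓝[>] 0,
      LeftSector (q - P i) (p - P i) ((p - P i) + τ • perp (P i - p)) := by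
  have hp : p - P i ≠ 0 := sub_ne_zero.2 (h.symm.isEdge.ne hs).symm
  have hneg : P i - p = -(p - P i) := by abel
  rw [hneg]
  set a := p - P i
  set b := q - P i
  have h1 : ∀ τ : ℝ, 0 < τ → 0 < det2 (a + τ • perp (-a)) a := by
    intro τ hτ
    rw [det2_add_left, det2_self, det2_smul_left, zero_add, det2_perp_left]
    have := (plane_ne_zero_iff a).1 hp
    have e : -dotp (-a) a = dotp a a := by simp [dotp]; ring
    rw [e]
    positivity
  by_cases hba : 0 < det2 b a
  · have hc : ContinuousAt (fun τ : ℝ => det2 b a + τ * det2 b (perp (-a))) 0 := by fun_prop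
    have := hc.eventually_const_lt (show (0 : ℝ) < det2 b a + 0 * det2 b (perp (-a)) by simpa)
    filter_upwards [nhdsWithin_le_nhds this, self_mem_nhdsWithin] with τ h2 hτ
    refine Or.inl ⟨hba, ?_, h1 τ hτ⟩
    rwa [det2_add_right, det2_smul_right]
  · filter_upwards [self_mem_nhdsWithin] with τ hτ
    exact Or.inr ⟨not_lt.1 hba, Or.inr (h1 τ hτ)⟩

lemma IsNeighbors.germ_iff_leftSide_next {F : Plane → Prop} {i : Fin n} {p q d : Plane}
    (hs : P.IsSimple) (h : P.IsNeighbors i p q) (hF : P.LocConst F)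
    (hd : LeftSector (q - P i) (p - P i) d) : Germ F (P i) d ↔ LeftSide F (P i) q := by
  have hq : q - P i ≠ 0 := sub_ne_zero.2 (h.isEdge.ne hs).symm
  obtain ⟨τ, h1, h2⟩ := ((h.eventually_leftSector_next hs).and
    (h.isEdge.eventually_germ_iff hs hF (det2_perp_self_pos hq).ne')).exists
  rw [LeftSide, ← h2]
  exact ⟨h.germ_of_leftSector hs hF hd h1, h.germ_of_leftSector hs hF h1 hd⟩

lemma IsNeighbors.germ_iff_leftSide_prev {F : Plane → Prop} {i : Fin n} {p q d : Plane}
    (hs : P.IsSimple) (h : P.IsNeighbors i p q) (hF : P.LocConst F)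
    (hd : LeftSector (q - P i) (p - P i) d) : Germ F (P i) d ↔ LeftSide F p (P i) := by
  have hp : P i - p ≠ 0 := sub_ne_zero.2 (h.symm.isEdge.ne hs)
  have hdet : det2 (p - P i) (perp (P i - p)) ≠ 0 := by
    have hneg : p - P i = -(P i - p) := by abel
    rw [hneg, det2_neg_left, neg_ne_zero]
    exact (det2_perp_self_pos hp).ne'
  obtain ⟨τ, h1, h2⟩ := ((h.eventually_leftSector_prev hs).and
    (h.symm.isEdge.eventually_germ_iff hs hF hdet)).exists
  rw [LeftSide, midpoint_comm, ← h2]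
  exact ⟨h.germ_of_leftSector hs hF hd h1, h.germ_of_leftSector hs hF h1 hd⟩

/-- All directions of the left sector carry the same germ, which agrees with the left side of either
edge; so the left side can be followed through the vertex. -/
lemma IsNeighbors.leftSide_iff {F : Plane → Prop} {i : Fin n} {p q : Plane}
    (hs : P.IsSimple) (h : P.IsNeighbors i p q) (hF : P.LocConst F) :
    LeftSide F p (P i) ↔ LeftSide F (P i) q := by
  obtain ⟨τ, h1⟩ := (h.eventually_leftSector_next hs).exists
  rw [← h.germ_iff_leftSide_next hs hF h1, ← h.germ_iff_leftSide_prev hs hF h1]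

lemma IsSimple.leftSide_of_leftSide {F : Plane → Prop} (hs : P.IsSimple) (hF : P.LocConst F)
    {i : Fin n} (h : LeftSide F (P i) (P (finRotate n i))) (j : Fin n) :
    LeftSide F (P j) (P (finRotate n j)) := by
  refine forall_of_finRotate (p := fun j => LeftSide F (P j) (P (finRotate n j)))
    (fun k hk => ?_) h j
  have := (P.isNeighbors (finRotate n k)).leftSide_iff hs hF
  rw [Equiv.symm_apply_apply] at this
  exact this.1 hk

lemma IsSimple.rightSide_of_rightSide {F : Plane → Prop} (hs : P.IsSimple) (hF : P.LocConst F)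
    {i : Fin n} (h : LeftSide F (P (finRotate n i)) (P i)) (j : Fin n) :
    LeftSide F (P (finRotate n j)) (P j) := by
  refine forall_of_finRotate (p := fun j => LeftSide F (P (finRotate n j)) (P j))
    (fun k hk => ?_) h j
  have := (P.isNeighbors (finRotate n k)).symm.leftSide_iff hs hF
  rw [Equiv.symm_apply_apply] at this
  exact this.2 hk

end Polygon

/-! ### Extreme vertices, orientation and reflex vertices -/

lemma dotp_add_right (a b c : Plane) : dotp a (b + c) = dotp a b + dotp a c := by
  simp [dotp]; ring

lemma dotp_sub_right (a b c : Plane) : dotp a (b - c) = dotp a b - dotp a c := by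
  simp [dotp]; ring

lemma dotp_smul_right (t : ℝ) (a b : Plane) : dotp a (t • b) = t * dotp a b := by
  simp [dotp]; ring

lemma dotp_le_of_mem_segment {c x y z : Plane} {r : ℝ} (hz : z ∈ segment ℝ x y)
    (hx : dotp c x ≤ r) (hy : dotp c y ≤ r) : dotp c z ≤ r := by
  obtain ⟨s, t, hs, ht, hst, rfl⟩ := hz
  rw [dotp_add_right, dotp_smul_right, dotp_smul_right]
  have hs' : s = 1 - t := by linarith
  subst hs'
  nlinarith

namespace Polygon

variable {n : ℕ} {P : Polygon Plane n}

/-- The vertex `i` is the unique vertex that maximizes some linear functional. -/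
def IsExtreme (P : Polygon Plane n) (i : Fin n) : Prop :=
  ∃ c, ∀ j, j ≠ i → dotp c (P j) < dotp c (P i)

/-- The turn at a vertex: positive for a left turn, negative for a right turn. -/
noncomputable def turn (P : Polygon Plane n) (i : Fin n) : ℝ :=
  det2 (P i - P ((finRotate n).symm i)) (P (finRotate n i) - P i)

lemma turn_eq (P : Polygon Plane n) (i : Fin n) :
    P.turn i = det2 (P (finRotate n i) - P i) (P ((finRotate n).symm i) - P i) := by
  simp only [turn, det2, PiLp.sub_apply]
  ring

lemma locConst_winding (P : Polygon Plane n) (Q : ℝ → Prop) :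
    P.LocConst fun x => Q (P.winding x) := fun T hT hc x hx y hy h => by
  have h : Q (P.winding x) := h
  rw [P.winding_eq_of_isPreconnected hT hc hx hy] at h
  exact h

lemma locConst_interiorRegion (P : Polygon Plane n) (Q : Prop → Prop) :
    P.LocConst fun x => Q (x ∈ P.interiorRegion) := fun T hT hc x hx y hy h => by
  have e : connectedComponentIn (P.boundary ℝ)ᶜ x = connectedComponentIn (P.boundary ℝ)ᶜ y :=
    connectedComponentIn_eq (hc.subset_connectedComponentIn hx hT hy)
  have : (y ∈ P.interiorRegion) = (x ∈ P.interiorRegion) := by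
    simp only [interiorRegion, Set.mem_ofPred_eq, e, eq_iff_iff]
    exact and_congr_left fun _ => ⟨fun _ => hT hx, fun _ => hT hy⟩
  have h : Q (x ∈ P.interiorRegion) := h
  rw [← this] at h
  exact h

/-- The winding number is constant on the component of `x` and vanishes far away, so the component
is bounded. -/
lemma mem_interiorRegion_of_winding_ne_zero {x : Plane} (hx : x ∉ P.boundary ℝ)
    (h : P.winding x ≠ 0) : x ∈ P.interiorRegion := by
  refine ⟨hx, ?_⟩
  obtain ⟨R, hR⟩ := P.exists_winding_eq_zero
  rw [isBounded_iff_forall_norm_le]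
  refine ⟨R, fun y hy => ?_⟩
  by_contra hlt
  have hsub := connectedComponentIn_subset (P.boundary ℝ)ᶜ x
  apply h
  rw [P.winding_eq_of_isPreconnected hsub isPreconnected_connectedComponentIn
    (mem_connectedComponentIn hx) hy]
  exact hR y (not_le.1 hlt) (hsub hy)

/-- The points outside the polygon. -/
def IsOuter (P : Polygon Plane n) (x : Plane) : Prop :=
  x ∉ P.interiorRegion ∧ P.winding x = 0

lemma locConst_isOuter (P : Polygon Plane n) : P.LocConst P.IsOuter :=
  fun T hT hc x hx y hy h => ⟨P.locConst_interiorRegion (fun q => ¬q) T hT hc x hx y hy h.1,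
    P.locConst_winding (fun q => q = 0) T hT hc x hx y hy h.2⟩

/-- On the ray in direction `c` the functional exceeds its maximum over the polygon, so the whole
ray avoids the boundary and leads to infinity. -/
lemma germ_isOuter_of_extreme {i : Fin n} {c : Plane} (h3 : 3 ≤ n)
    (hc : ∀ j, j ≠ i → dotp c (P j) < dotp c (P i)) : c ≠ 0 ∧ Germ P.IsOuter (P i) c := by
  have hc0 : c ≠ 0 := by
    rintro rfl
    have := hc (finRotate n i) (finRotate_ne_self (by omega) i)
    simp [dotp] at this
  have hcc := (plane_ne_zero_iff c).1 hc0
  have hle : ∀ j, dotp c (P j) ≤ dotp c (P i) := by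
    intro j
    by_cases hj : j = i
    · rw [hj]
    · exact (hc j hj).le
  set T : Set Plane := (fun t : ℝ => P i + t • c) '' Set.Ioi 0 with hTdef
  have hT : T ⊆ (P.boundary ℝ)ᶜ := by
    rintro _ ⟨t, ht, rfl⟩ hb
    have ht : 0 < t := ht
    obtain ⟨j, hj⟩ := (mem_boundary_iff P _).1 hb
    have := dotp_le_of_mem_segment hj (hle j) (hle _)
    rw [dotp_add_right, dotp_smul_right] at this
    nlinarith [mul_pos ht hcc]
  have hpre : IsPreconnected T := isPreconnected_Ioi.image _ (by fun_prop)
  have hnorm : 0 < ‖c‖ := norm_pos_iff.2 hc0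
  have hfar : ∀ R : ℝ, ∃ y ∈ T, R < ‖y‖ := by
    intro R
    refine ⟨P i + ((|R| + ‖P i‖ + 1) / ‖c‖) • c, ⟨_, Set.mem_Ioi.2 (by positivity), rfl⟩, ?_⟩
    have h1 := norm_sub_le (P i + ((|R| + ‖P i‖ + 1) / ‖c‖) • c) (P i)
    rw [add_sub_cancel_left, norm_smul, Real.norm_of_nonneg (by positivity),
      div_mul_cancel₀ _ hnorm.ne'] at h1
    have := le_abs_self R
    linarith
  refine ⟨hc0, ?_⟩
  filter_upwards [self_mem_nhdsWithin] with t ht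
  have hx : P i + t • c ∈ T := ⟨t, ht, rfl⟩
  refine ⟨fun hint => ?_, ?_⟩
  · obtain ⟨R, hR⟩ := isBounded_iff_forall_norm_le.1 hint.2
    obtain ⟨y, hy, hlt⟩ := hfar R
    exact absurd (hR y (hpre.subset_connectedComponentIn hx hT hy)) (not_le.2 hlt)
  · obtain ⟨R, hR⟩ := P.exists_winding_eq_zero
    obtain ⟨y, hy, hlt⟩ := hfar R
    rw [P.winding_eq_of_isPreconnected hT hpre hx hy]
    exact hR y hlt (hT hy)

/-- Outside the large sector, `c` would be a nonnegative combination of `a` and `b`, which is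
impossible as both have a negative product with `c`. -/
lemma mem_leftSector_of_extreme {a b c : Plane} (hc : c ≠ 0) (ha : dotp c a < 0)
    (hb : dotp c b < 0) (hab : 0 < det2 b a) : LeftSector a b c := by
  refine Or.inr ⟨by rw [det2_swap]; linarith, ?_⟩
  by_contra hcon
  rw [not_or, not_lt, not_lt] at hcon
  have hcc := (plane_ne_zero_iff c).1 hc
  have key : dotp c c * det2 b a = -det2 c b * dotp c a - det2 a c * dotp c b := by
    simp only [dotp, det2]; ring
  nlinarith [mul_pos hcc hab, mul_nonneg (neg_nonneg.2 hcon.1) (neg_nonneg.2 hb.le),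
    mul_nonneg (neg_nonneg.2 hcon.2) (neg_nonneg.2 ha.le)]

lemma IsNeighbors.dotp_neg {i : Fin n} {p q c : Plane} (h3 : 3 ≤ n) (h : P.IsNeighbors i p q)
    (hc : ∀ j, j ≠ i → dotp c (P j) < dotp c (P i)) :
    dotp c (p - P i) < 0 ∧ dotp c (q - P i) < 0 := by
  have h1 := hc _ (finRotate_ne_self (by omega) i)
  have h2 := hc ((finRotate n).symm i) fun he => finRotate_ne_self (n := n) (by omega) i
    (by conv_lhs => rw [← he]
        rw [Equiv.apply_symm_apply])
  rw [dotp_sub_right, dotp_sub_right]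
  rcases h with ⟨rfl, rfl⟩ | ⟨rfl, rfl⟩
  · exact ⟨by linarith, by linarith⟩
  · exact ⟨by linarith, by linarith⟩

lemma IsNeighbors.leftSide_isOuter {i : Fin n} {p q : Plane} (hs : P.IsSimple)
    (h : P.IsNeighbors i p q) (hi : P.IsExtreme i) (hdet : 0 < det2 (q - P i) (p - P i)) :
    LeftSide P.IsOuter q (P i) := by
  obtain ⟨c, hc⟩ := hi
  obtain ⟨hc0, hg⟩ := germ_isOuter_of_extreme hs.1 hc
  obtain ⟨hp, hq⟩ := h.dotp_neg hs.1 hc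
  exact (h.symm.germ_iff_leftSide_prev hs P.locConst_isOuter
    (mem_leftSector_of_extreme hc0 hp hq hdet)).1 hg

/-- At a straight vertex the neighbours lie in opposite directions, and no linear functional
decreases towards both. -/
lemma IsExtreme.turn_ne_zero {i : Fin n} (hs : P.IsSimple) (hi : P.IsExtreme i) :
    P.turn i ≠ 0 := by
  intro h0
  obtain ⟨c, hc⟩ := hi
  obtain ⟨h1, h2⟩ := (P.isNeighbors i).dotp_neg hs.1 hc
  rw [turn_eq] at h0
  have h3 := (P.isNeighbors i).not_same_direction hs h0
  have hq : P (finRotate n i) - P i ≠ 0 := sub_ne_zero.2 (hs.ne_next i).symm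
  rw [exists_smul_of_det2_eq_zero hq h0, dotp_smul_right] at h1
  have := div_nonpos_of_nonpos_of_nonneg h3 ((plane_ne_zero_iff _).1 hq).le
  nlinarith

/-- A simple polygon that is traversed counterclockwise: the points to the right of its edges
are outside. -/
structure IsCcw (P : Polygon Plane n) : Prop where
  isSimple : P.IsSimple
  isOuter_right : ∀ i, LeftSide P.IsOuter (P (finRotate n i)) (P i)

/-- A simple polygon that is traversed clockwise. -/
structure IsCw (P : Polygon Plane n) : Prop where
  isSimple : P.IsSimple
  isOuter_left : ∀ i, LeftSide P.IsOuter (P i) (P (finRotate n i))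

/-- A left turn at one extreme vertex puts the escaping ray on the right of its edges, and from
there the outer side spreads along the whole polygon. -/
lemma IsSimple.isCcw {i : Fin n} (hs : P.IsSimple) (hi : P.IsExtreme i) (h : 0 < P.turn i) :
    P.IsCcw := by
  refine ⟨hs, hs.rightSide_of_rightSide P.locConst_isOuter (i := i) ?_⟩
  rw [turn_eq] at h
  exact (P.isNeighbors i).leftSide_isOuter hs hi h

lemma IsSimple.isCw {i : Fin n} (hs : P.IsSimple) (hi : P.IsExtreme i) (h : P.turn i < 0) :
    P.IsCw := by
  rw [turn_eq, det2_swap] at h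
  have h2 := (P.isNeighbors i).symm.leftSide_isOuter hs hi (by linarith)
  refine ⟨hs, hs.leftSide_of_leftSide P.locConst_isOuter (i := (finRotate n).symm i) ?_⟩
  rwa [Equiv.apply_symm_apply]

lemma midpoint_notMem_segment {i j : Fin n} (hs : P.IsSimple) (hij : j ≠ i) :
    midpoint ℝ (P i) (P (finRotate n i)) ∉ segment ℝ (P j) (P (finRotate n j)) := by
  intro hm
  have hne := hs.ne_next i
  rcases (hs.inter hij hm (midpoint_mem_segment _ _)).2 with h | h
  · exact hne ((midpoint_eq_left_iff ℝ).1 h)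
  · exact hne ((midpoint_eq_right_iff ℝ).1 h)

lemma IsSimple.not_outer_both_sides (hs : P.IsSimple) (i : Fin n)
    (h1 : LeftSide (fun x => P.winding x = 0) (P i) (P (finRotate n i)))
    (h2 : LeftSide (fun x => P.winding x = 0) (P (finRotate n i)) (P i)) : False := by
  refine P.not_winding_eq_zero_both_sides i (hs.ne_next i)
    (fun j hj => midpoint_notMem_segment hs hj) h1 ?_
  have : -perp (P (finRotate n i) - P i) = perp (P i - P (finRotate n i)) := by
    apply plane_ext <;> simp
  rw [this, midpoint_comm]
  exact h2

lemma germ_mono {F G : Plane → Prop} {p d : Plane} (h : Germ F p d) (hFG : ∀ x, F x → G x) :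
    Germ G p d := Eventually.mono h fun _ ht => hFG _ ht

lemma germ_or_germ_not {F : Plane → Prop} {i : Fin n} (hs : P.IsSimple)
    (hF : P.LocConst F) (hF' : P.LocConst fun x => ¬F x) :
    LeftSide F (P i) (P (finRotate n i)) ∨
      LeftSide (fun x => ¬F x) (P i) (P (finRotate n i)) := by
  have he : P.IsEdge (P i) (P (finRotate n i)) := ⟨i, Or.inl ⟨rfl, rfl⟩⟩
  have hq : P (finRotate n i) - P i ≠ 0 := sub_ne_zero.2 (hs.ne_next i).symm
  have hd := (det2_perp_self_pos hq).ne'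
  obtain ⟨τ, h1, h2, h3⟩ := ((he.eventually_germ_iff hs hF hd).and
    ((he.eventually_germ_iff hs hF' hd).and (he.eventually_thin hs hd))).exists
  rw [LeftSide, LeftSide, ← h1, ← h2]
  set d := P (finRotate n i) - P i + τ • perp (P (finRotate n i) - P i)
  set T : Set Plane := (fun t : ℝ => P i + t • d) '' Set.Ioc 0 (1 / 2)
  have hT : T ⊆ (P.boundary ℝ)ᶜ := by
    rintro _ ⟨t, ht, rfl⟩
    exact h3 t ht
  have hpre : IsPreconnected T := isPreconnected_Ioc.image _ (by fun_prop)
  have hev : ∀ᶠ t : ℝ in 𝓝[>] 0, P i + t • d ∈ T := by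
    filter_upwards [Ioo_mem_nhdsGT (show (0 : ℝ) < 1 / 2 by norm_num)] with t ht
    exact ⟨t, ⟨ht.1, ht.2.le⟩, rfl⟩
  obtain ⟨t, ht⟩ := hev.exists
  by_cases hx : F (P i + t • d)
  · left
    filter_upwards [hev] with s hs'
    exact hF T hT hpre _ ht _ hs' hx
  · right
    filter_upwards [hev] with s hs'
    exact hF' T hT hpre _ ht _ hs' hx

/-- The winding number vanishes on the right of each edge and jumps across it. This is the
substitute for the Jordan curve theorem. -/
lemma IsCcw.winding_ne_zero_left (h : P.IsCcw) (i : Fin n) :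
    LeftSide (fun x => P.winding x ≠ 0) (P i) (P (finRotate n i)) :=
  (germ_or_germ_not h.isSimple (P.locConst_winding fun q => q = 0)
    (P.locConst_winding fun q => q ≠ 0)).resolve_left fun h1 =>
      h.isSimple.not_outer_both_sides i h1 (germ_mono (h.isOuter_right i) fun _ hx => hx.2)

lemma IsCcw.not_isCw (h : P.IsCcw) (h' : P.IsCw) : False := by
  have i : Fin n := ⟨0, by have := h.isSimple.1; omega⟩
  exact h.isSimple.not_outer_both_sides i (germ_mono (h'.isOuter_left i) fun _ hx => hx.2)
    (germ_mono (h.isOuter_right i) fun _ hx => hx.2)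

lemma IsCcw.turn_pos (h : P.IsCcw) {i : Fin n} (hi : P.IsExtreme i) : 0 < P.turn i := by
  rcases lt_or_gt_of_ne (hi.turn_ne_zero h.isSimple) with h1 | h1
  · exact (h.not_isCw (h.isSimple.isCw hi h1)).elim
  · exact h1

lemma IsCw.turn_neg (h : P.IsCw) {i : Fin n} (hi : P.IsExtreme i) : P.turn i < 0 := by
  rcases lt_or_gt_of_ne (hi.turn_ne_zero h.isSimple) with h1 | h1
  · exact h1
  · exact ((h.isSimple.isCcw hi h1).not_isCw h).elim

lemma IsCcw.germ_isOuter (h : P.IsCcw) {i : Fin n} {d : Plane}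
    (hd : LeftSector (P ((finRotate n).symm i) - P i) (P (finRotate n i) - P i) d) :
    Germ P.IsOuter (P i) d :=
  ((P.isNeighbors i).symm.germ_iff_leftSide_prev h.isSimple P.locConst_isOuter hd).2
    (h.isOuter_right i)

lemma IsCcw.germ_winding_ne_zero (h : P.IsCcw) {i : Fin n} {d : Plane}
    (hd : LeftSector (P (finRotate n i) - P i) (P ((finRotate n).symm i) - P i) d) :
    Germ (fun x => P.winding x ≠ 0) (P i) d :=
  ((P.isNeighbors i).germ_iff_leftSide_next h.isSimple
    (P.locConst_winding fun q => q ≠ 0) hd).2 (h.winding_ne_zero_left i)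

lemma germ_notMem_boundary {i : Fin n} {d : Plane} (hs : P.IsSimple)
    (hd : LeftSector (P (finRotate n i) - P i) (P ((finRotate n).symm i) - P i) d) :
    Germ (· ∉ P.boundary ℝ) (P i) d :=
  ((P.isNeighbors i).germ_iff_leftSide_next hs (fun _ hT _ _ _ _ hy _ => hT hy) hd).2 <| by
    have hq : P (finRotate n i) - P i ≠ 0 := sub_ne_zero.2 (hs.ne_next i).symm
    have he : P.IsEdge (P i) (P (finRotate n i)) := ⟨i, Or.inl ⟨rfl, rfl⟩⟩
    obtain ⟨τ, h1, h2⟩ := ((he.eventually_germ_iff hs (F := (· ∉ P.boundary ℝ))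
      (fun _ hT _ _ _ _ hy _ => hT hy) (det2_perp_self_pos hq).ne').and
      (he.eventually_thin hs (det2_perp_self_pos hq).ne')).exists
    refine h1.1 ?_
    filter_upwards [Ioo_mem_nhdsGT (show (0 : ℝ) < 1 / 2 by norm_num)] with t ht
    exact h2 t ⟨ht.1, ht.2.le⟩

lemma sbtw_of_turn_eq_zero {i : Fin n} (hs : P.IsSimple) (h0 : P.turn i = 0) :
    Sbtw ℝ (P ((finRotate n).symm i)) (P i) (P (finRotate n i)) := by
  rw [turn_eq] at h0
  have h3 := (P.isNeighbors i).not_same_direction hs h0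
  have hq : P (finRotate n i) - P i ≠ 0 := sub_ne_zero.2 (hs.ne_next i).symm
  have hp : P ((finRotate n).symm i) - P i ≠ 0 :=
    sub_ne_zero.2 ((P.isNeighbors i).symm.isEdge.ne hs).symm
  have h4 := exists_smul_of_det2_eq_zero hq h0
  set μ := dotp (P (finRotate n i) - P i) (P ((finRotate n).symm i) - P i) /
    dotp (P (finRotate n i) - P i) (P (finRotate n i) - P i)
  have hμ : μ ≤ 0 := div_nonpos_of_nonpos_of_nonneg h3 ((plane_ne_zero_iff _).1 hq).le
  refine ⟨?_, (sub_ne_zero.1 hp).symm, hs.ne_next i⟩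
  have e : P ((finRotate n).symm i) = P i + μ • (P (finRotate n i) - P i) := by
    rw [← h4]; abel
  rw [← mem_segment_iff_wbtw]
  have hpos : (0 : ℝ) < 1 - μ := by linarith
  refine ⟨1 / (1 - μ), -μ / (1 - μ), by positivity, div_nonneg (by linarith) hpos.le,
    by field_simp; ring, ?_⟩
  rw [e]
  apply plane_ext
  · simp; field_simp; ring
  · simp; field_simp; ring

lemma lineMap_midpoint (v p q : Plane) (t : ℝ) :
    AffineMap.lineMap v (midpoint ℝ p q) t = v + t • (midpoint ℝ p q - v) := by
  rw [AffineMap.lineMap_apply]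
  simp [add_comm]

/-- In a counterclockwise simple polygon, the reflex vertices are the right turns. -/
lemma IsCcw.isReflex_iff (h : P.IsCcw) (i : Fin n) : P.IsReflex i ↔ P.turn i < 0 := by
  have hs := h.isSimple
  set u := P ((finRotate n).symm i) with hu
  set w := P (finRotate n i) with hw
  have hle := EuclideanGeometry.angle_le_pi u (P i) w
  rcases lt_trichotomy (P.turn i) 0 with h0 | h0 | h0
  -- At a right turn the convex sector, which contains the direction of the midpoint, is the outer
  -- one.
  · have hsec : LeftSector (u - P i) (w - P i) (midpoint ℝ u w - P i) := by
      rw [turn_eq, det2_swap] at h0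
      rw [midpoint_comm]
      refine Or.inl ⟨by linarith, ?_, ?_⟩
      · rw [det2_sub_midpoint_left]; linarith
      · rw [det2_sub_midpoint_right]; linarith
    have hg := h.germ_isOuter hsec
    have hcond : ¬∀ᶠ t : ℝ in 𝓝[>] 0,
        AffineMap.lineMap (P i) (midpoint ℝ u w) t ∈ P.interiorRegion := by
      intro hev
      obtain ⟨t, h1, h2⟩ := (hev.and hg).exists
      rw [lineMap_midpoint] at h1
      exact h2.1 h1
    have hne : EuclideanGeometry.angle u (P i) w ≠ Real.pi := by
      rw [Ne, EuclideanGeometry.angle_eq_pi_iff_sbtw]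
      intro hsb
      have hseg := mem_segment_iff_wbtw.2 hsb.1
      obtain ⟨a, b, ha, hb, hab, e⟩ := hseg
      have : P.turn i = 0 := by
        have ha' : a = 1 - b := by linarith
        subst ha'
        rw [turn, ← hu, ← hw, ← e]
        simp only [det2, PiLp.sub_apply, PiLp.add_apply, PiLp.smul_apply, smul_eq_mul]
        ring
      linarith
    have hlt := lt_of_le_of_ne hle hne
    rw [IsReflex, interiorAngle, if_neg hcond]
    exact ⟨fun _ => h0, fun _ => by linarith⟩
  · rw [IsReflex, interiorAngle,
      EuclideanGeometry.angle_eq_pi_iff_sbtw.2 (sbtw_of_turn_eq_zero hs h0)]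
    have : Real.pi = 2 * Real.pi - Real.pi := by ring
    rw [← this, ite_self]
    exact ⟨fun h => absurd h (lt_irrefl _), fun h => by linarith⟩
  · have hsec : LeftSector (w - P i) (u - P i) (midpoint ℝ u w - P i) := by
      rw [turn_eq] at h0
      refine Or.inl ⟨h0, ?_, ?_⟩
      · rw [det2_sub_midpoint_left]; linarith
      · rw [det2_sub_midpoint_right]; linarith
    have hcond : ∀ᶠ t : ℝ in 𝓝[>] 0,
        AffineMap.lineMap (P i) (midpoint ℝ u w) t ∈ P.interiorRegion := by
      filter_upwards [h.germ_winding_ne_zero hsec, germ_notMem_boundary hs hsec] with t h1 h2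
      rw [lineMap_midpoint]
      exact mem_interiorRegion_of_winding_ne_zero h2 h1
    rw [IsReflex, interiorAngle, if_pos hcond]
    exact ⟨fun h => absurd h (not_lt.2 hle), fun h => by linarith⟩

lemma IsCcw.reflexCount_eq (h : P.IsCcw) : P.reflexCount = Set.ncard {i | P.turn i < 0} := by
  simp only [reflexCount, h.isReflex_iff]

end Polygon

/-! ### Reversing a polygon -/

lemma finRotate_rev {n : ℕ} (i : Fin n) : finRotate n i.rev = ((finRotate n).symm i).rev := by
  obtain ⟨m, rfl⟩ : ∃ m, n = m + 1 := ⟨n - 1, by have := i.2; omega⟩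
  obtain ⟨j, rfl⟩ := (finRotate (m + 1)).surjective i
  rw [Equiv.symm_apply_apply]
  apply Fin.ext
  rw [coe_finRotate, Fin.val_rev]
  by_cases hj : j = Fin.last m
  · subst hj
    rw [finRotate_last]
    simp
  · have h1 := coe_finRotate_of_ne_last hj
    have h2 : (finRotate (m + 1) j).rev ≠ Fin.last m := by
      intro h
      have := congrArg Fin.val h
      rw [Fin.val_rev, h1, Fin.val_last] at this
      have := j.2
      omega
    rw [if_neg h2, Fin.val_rev, h1]
    have := j.2
    have : (j : ℕ) ≠ m := fun h => hj (Fin.ext h)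
    omega

/-- Twice the product of `a - z` and `a - b` equals `|a - z|² - |b - z|² + |a - b|²`, which is
positive. So a farthest point from `z` is the unique maximum of a linear functional. -/
lemma dotp_farthest {z a b : Plane} (hne : b ≠ a)
    (h : dotp (b - z) (b - z) ≤ dotp (a - z) (a - z)) : dotp (a - z) b < dotp (a - z) a := by
  have h1 := (plane_ne_zero_iff (b - a)).1 (sub_ne_zero.2 hne)
  simp only [dotp, PiLp.sub_apply] at *
  nlinarith

namespace Polygon

variable {n : ℕ}

/-- The polygon traversed in the opposite direction. -/
def reverse (P : Polygon Plane n) : Polygon Plane n := ⟨fun i => P i.rev⟩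

lemma reverse_apply (P : Polygon Plane n) (i : Fin n) : P.reverse i = P i.rev := rfl

lemma reverse_next (P : Polygon Plane n) (i : Fin n) :
    P.reverse (finRotate n i) = P ((finRotate n).symm i.rev) := by
  rw [reverse_apply]
  congr 1
  rw [Equiv.eq_symm_apply, finRotate_rev, Equiv.symm_apply_apply]

lemma reverse_prev (P : Polygon Plane n) (i : Fin n) :
    P.reverse ((finRotate n).symm i) = P (finRotate n i.rev) := by
  rw [reverse_apply, finRotate_rev]

lemma reverse_edgeSet (P : Polygon Plane n) (i : Fin n) :
    P.reverse.edgeSet ℝ i = P.edgeSet ℝ ((finRotate n).symm i.rev) := by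
  rw [edgeSet_eq_segment, edgeSet_eq_segment, reverse_next, reverse_apply,
    Equiv.apply_symm_apply, segment_symm]

lemma reverse_boundary (P : Polygon Plane n) : P.reverse.boundary ℝ = P.boundary ℝ := by
  simp only [boundary, reverse_edgeSet]
  exact ((Fin.revPerm (n := n)).trans (finRotate n).symm).iSup_comp (g := P.edgeSet ℝ)

lemma reverse_interiorAngle (P : Polygon Plane n) (i : Fin n) :
    P.reverse.interiorAngle i = P.interiorAngle i.rev := by
  have hint : P.reverse.interiorRegion = P.interiorRegion := by
    simp only [interiorRegion, reverse_boundary]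
  rw [interiorAngle, interiorAngle, reverse_next, reverse_prev, reverse_apply, hint,
    midpoint_comm, EuclideanGeometry.angle_comm]

lemma reverse_reflexCount (P : Polygon Plane n) : P.reverse.reflexCount = P.reflexCount := by
  simp only [reflexCount, IsReflex, reverse_interiorAngle]
  rw [← Set.ncard_image_of_injective _ Fin.rev_injective]
  congr 1
  ext i
  constructor
  · rintro ⟨j, hj, rfl⟩
    exact hj
  · intro hi
    exact ⟨i.rev, by simpa using hi, by simp⟩

lemma IsSimple.reverse {P : Polygon Plane n} (hs : P.IsSimple) : P.reverse.IsSimple := by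
  refine ⟨hs.1, fun i j h => Fin.rev_injective (hs.2.1 h), fun i j hij => ?_⟩
  rw [reverse_edgeSet, reverse_edgeSet, reverse_next, reverse_next, reverse_apply, reverse_apply]
  have := hs.2.2 ((finRotate n).symm i.rev) ((finRotate n).symm j.rev)
    fun h => hij (Fin.rev_injective ((finRotate n).symm.injective h))
  rw [Equiv.apply_symm_apply, Equiv.apply_symm_apply] at this
  rwa [Set.pair_comm (P i.rev), Set.pair_comm (P j.rev)]

lemma reverse_range (P : Polygon Plane n) : Set.range P.reverse.vertices = Set.range P.vertices :=
  Function.Surjective.range_comp Fin.rev_surjective P.vertices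

lemma reverse_turn (P : Polygon Plane n) (i : Fin n) : P.reverse.turn i = -P.turn i.rev := by
  rw [turn, turn_eq, reverse_next, reverse_prev, reverse_apply]
  simp only [det2, PiLp.sub_apply]
  ring

lemma isExtreme_of_farthest {P : Polygon Plane n} (hinj : Function.Injective P.vertices)
    {z : Plane} {i : Fin n}
    (h : ∀ j, dotp (P j - z) (P j - z) ≤ dotp (P i - z) (P i - z)) : P.IsExtreme i :=
  ⟨P i - z, fun j hj => dotp_farthest (fun he => hj (hinj he)) (h j)⟩

/-- The vertex farthest from the origin is extreme, and the sign of its turn decides whether to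
reverse. -/
lemma IsSimple.exists_isCcw {P : Polygon Plane n} (hs : P.IsSimple) :
    ∃ Q : Polygon Plane n, Q.IsCcw ∧ Set.range Q.vertices = Set.range P.vertices ∧
      Q.reflexCount = P.reflexCount := by
  have : Nonempty (Fin n) := ⟨⟨0, by have := hs.1; omega⟩⟩
  obtain ⟨i, hi⟩ := Finite.exists_max fun i => dotp (P i - 0) (P i - 0)
  have hext := isExtreme_of_farthest hs.2.1 hi
  rcases lt_or_gt_of_ne (hext.turn_ne_zero hs) with h | h
  · have hext' : P.reverse.IsExtreme i.rev := by
      refine isExtreme_of_farthest hs.reverse.2.1 (z := 0) fun j => ?_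
      rw [reverse_apply, reverse_apply, Fin.rev_rev]
      exact hi _
    refine ⟨P.reverse, hs.reverse.isCcw hext' ?_, P.reverse_range, P.reverse_reflexCount⟩
    rw [reverse_turn, Fin.rev_rev]
    linarith
  · exact ⟨P, hs.isCcw hext h, rfl, rfl⟩

end Polygon

/-! ### Tangents and supporting lines of finite sets -/

/-- Twice the signed area of a triangle; it is positive if `c` lies to the left of the line
from `a` to `b`. -/
noncomputable def orient (a b c : Plane) : ℝ := det2 (b - a) (c - a)

lemma orient_cycle (a b c : Plane) : orient a b c = orient b c a := by
  simp only [orient, det2, PiLp.sub_apply]; ring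

lemma orient_swap (a b c : Plane) : orient a b c = -orient a c b := by
  simp only [orient, det2, PiLp.sub_apply]; ring

@[simp] lemma orient_left (a b : Plane) : orient a b a = 0 := by simp [orient]

@[simp] lemma orient_right (a b : Plane) : orient a b b = 0 := by simp [orient]

lemma orient_line (a b v u : Plane) (t : ℝ) :
    orient a b (v + t • (u - v)) = (1 - t) * orient a b v + t * orient a b u := by
  simp only [orient, det2, PiLp.sub_apply, PiLp.add_apply, PiLp.smul_apply, smul_eq_mul]; ring

lemma orient_combo (a b x y : Plane) {s t : ℝ} (h : s + t = 1) :
    orient a b (s • x + t • y) = s * orient a b x + t * orient a b y := by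
  have hs : s = 1 - t := by linarith
  subst hs
  simp only [orient, det2, PiLp.sub_apply, PiLp.add_apply, PiLp.smul_apply, smul_eq_mul]; ring

lemma convex_orient_nonneg (a b : Plane) : Convex ℝ {y | 0 ≤ orient a b y} := by
  intro x hx y hy s t hs ht hst
  simp only [Set.mem_ofPred_eq] at *
  rw [orient_combo a b x y hst]
  positivity

/-- Adding a convex part of the boundary line to an open half-plane keeps it convex. Such sets
enclose hulls that touch a line only along a prescribed ray or point. -/
lemma convex_orient_pos_union (a b : Plane) {R : Set Plane} (hR : Convex ℝ R)
    (h0 : ∀ y ∈ R, orient a b y = 0) : Convex ℝ ({y | 0 < orient a b y} ∪ R) := by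
  have key : ∀ x y : Plane, ∀ s t : ℝ, 0 ≤ s → 0 ≤ t → s + t = 1 → 0 < orient a b x →
      0 ≤ orient a b y → y ∈ ({y | 0 < orient a b y} ∪ R) →
      s • x + t • y ∈ ({y | 0 < orient a b y} ∪ R) := by
    intro x y s t hs ht hst hx hy hyR
    rcases hs.eq_or_lt with rfl | hs
    · have : t = 1 := by linarith
      simpa [this] using hyR
    · left
      simp only [Set.mem_ofPred_eq]
      rw [orient_combo a b x y hst]
      have := mul_pos hs hx
      have := mul_nonneg ht hy
      linarith
  intro x hx y hy s t hs ht hst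
  have hx' := hx
  have hy' := hy
  rcases hx with hx | hx
  · exact key x y s t hs ht hst hx (hy.elim (fun h => le_of_lt h) fun h => (h0 y h).ge) hy'
  · rcases hy with hy | hy
    · rw [add_comm]
      exact key y x t s ht hs (by linarith) hy (h0 x hx).ge hx'
    · exact Or.inr (hR hx hy hs ht hst)

/-- `u` is the first point of `A` met by a ray that turns counterclockwise around `v`. -/
def IsTangent (v : Plane) (A : Finset Plane) (u : Plane) : Prop :=
  u ∈ A ∧ ∀ x ∈ A, 0 < orient v u x ∨ ∃ t : ℝ, 1 ≤ t ∧ x = v + t • (u - v)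

lemma IsTangent.orient_nonneg {v u : Plane} {A : Finset Plane} (h : IsTangent v A u) {x : Plane}
    (hx : x ∈ A) : 0 ≤ orient v u x := by
  rcases h.2 x hx with h1 | ⟨t, _, rfl⟩
  · exact h1.le
  · simp [orient_line]

/-- All points lie strictly to the left of `c` as seen from `v`, so minus the cotangent of the angle
from `c` orders them by direction. The lexicographic minimum selects the first direction and, on it,
the nearest point. -/
lemma exists_isTangent {v c : Plane} {A : Finset Plane} (hA : A.Nonempty)
    (hc : ∀ x ∈ A, 0 < det2 c (x - v)) : ∃ u, IsTangent v A u := by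
  obtain ⟨u, hu, hmin⟩ := A.exists_min_image
    (fun x => toLex (-dotp c (x - v) / det2 c (x - v), det2 c (x - v))) hA
  have hcu := hc u hu
  have hc0 : c ≠ 0 := by
    rintro rfl
    simp at hcu
  have hcc := (plane_ne_zero_iff c).1 hc0
  refine ⟨u, hu, fun x hx => ?_⟩
  have hcx := hc x hx
  have key : dotp c c * orient v u x =
      -(dotp c (x - v) * det2 c (u - v)) + dotp c (u - v) * det2 c (x - v) := by
    simp only [orient, dotp, det2]; ring
  rcases Prod.Lex.toLex_le_toLex.1 (hmin x hx) with h | ⟨h1, h2⟩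
  · left
    rw [div_lt_div_iff₀ hcu hcx] at h
    by_contra hle
    nlinarith [mul_nonneg hcc.le (neg_nonneg.2 (not_lt.1 hle))]
  · right
    rw [div_eq_div_iff hcu.ne' hcx.ne'] at h1
    have h0 : orient v u x = 0 := by
      have : dotp c c * orient v u x = 0 := by rw [key]; linarith
      exact (mul_eq_zero.1 this).resolve_left hcc.ne'
    have huv : u - v ≠ 0 := by
      intro h
      rw [h] at hcu
      simp at hcu
    have h3 := exists_smul_of_det2_eq_zero huv h0
    refine ⟨_, ?_, by rw [← h3]; abel⟩
    set μ := dotp (u - v) (x - v) / dotp (u - v) (u - v)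
    rw [h3, det2_smul_right] at h2
    dsimp only at h2
    by_contra hlt
    nlinarith

/-- The hull of `A` lies in the open left half-plane of the tangent together with the ray that
starts at `u`. -/
lemma IsTangent.eq_of_mem_segment {v u y : Plane} {A : Finset Plane} (h : IsTangent v A u)
    (hy : y ∈ segment ℝ v u) (hyA : y ∈ convexHull ℝ (A : Set Plane)) : y = u := by
  by_cases huv : u = v
  · subst huv
    simpa using hy
  have hsub : convexHull ℝ (A : Set Plane) ⊆
      {y | 0 < orient v u y} ∪ ((fun t : ℝ => v + t • (u - v)) '' Set.Ici 1) := by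
    apply convexHull_min
    · intro x hx
      rcases h.2 x hx with h1 | ⟨t, ht, rfl⟩
      · exact Or.inl h1
      · exact Or.inr ⟨t, ht, rfl⟩
    · apply convex_orient_pos_union
      · rintro _ ⟨a, ha, rfl⟩ _ ⟨b, hb, rfl⟩ s t hs ht hst
        have ha : 1 ≤ a := ha
        have hb : 1 ≤ b := hb
        refine ⟨s * a + t * b, ?_, ?_⟩
        · have : 1 = s * 1 + t * 1 := by linarith
          rw [Set.mem_Ici, this]
          gcongr
        · have hs' : s = 1 - t := by linarith
          subst hs'
          module
      · rintro _ ⟨t, -, rfl⟩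
        simp [orient_line]
  rw [segment_eq_image'] at hy
  obtain ⟨θ, hθ, rfl⟩ := hy
  dsimp only at *
  rcases hsub hyA with h1 | ⟨t, ht, e⟩
  · simp [orient_line] at h1
  · have ht : 1 ≤ t := ht
    have e' : (t - θ) • (u - v) = 0 := by
      have := add_left_cancel e
      rw [sub_smul, this, sub_self]
    have := (smul_eq_zero.1 e').resolve_right (sub_ne_zero.2 huv)
    have hθ1 : θ = 1 := by linarith [hθ.2]
    subst hθ1
    simp

/-- The points of `X` lie on one side of some line through `x`. -/
def OnBoundary (x : Plane) (X : Set Plane) : Prop :=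
  ∃ d, d ≠ 0 ∧ ∀ y ∈ X, 0 ≤ det2 d (y - x)

lemma OnBoundary.mono {x : Plane} {X Y : Set Plane} (h : OnBoundary x Y) (hXY : X ⊆ Y) :
    OnBoundary x X :=
  h.imp fun _ hd => ⟨hd.1, fun y hy => hd.2 y (hXY hy)⟩

lemma eq_zero_of_det2_eq_zero {d x y : Plane} (hx : det2 d x = 0) (hy : det2 d y = 0)
    (hxy : det2 x y ≠ 0) : d = 0 := by
  simp only [det2] at *
  apply plane_ext
  · have : d 0 * (x 0 * y 1 - x 1 * y 0) = 0 := by linear_combination x 0 * hy - y 0 * hx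
    simpa using (mul_eq_zero.1 this).resolve_right hxy
  · have : d 1 * (x 0 * y 1 - x 1 * y 0) = 0 := by linear_combination x 1 * hy - y 1 * hx
    simpa using (mul_eq_zero.1 this).resolve_right hxy

/-- Seen from `w`, the three vectors to the corners have a vanishing combination with positive
coefficients, so a functional that is nonnegative on all of them vanishes on all of them. -/
lemma not_onBoundary_of_triangle {w x y z : Plane} {X : Set Plane} (hx : x ∈ X) (hy : y ∈ X)
    (hz : z ∈ X) (h1 : 0 < orient w x y) (h2 : 0 < orient w y z) (h3 : 0 < orient w z x) :
    ¬OnBoundary w X := by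
  rintro ⟨d, hd, h⟩
  have ha := h x hx
  have hb := h y hy
  have hc := h z hz
  simp only [orient] at h1 h2 h3
  have key : det2 (y - w) (z - w) * det2 d (x - w) + det2 (z - w) (x - w) * det2 d (y - w) +
      det2 (x - w) (y - w) * det2 d (z - w) = 0 := by
    simp only [det2]; ring
  have m1 := mul_nonneg h2.le ha
  have m2 := mul_nonneg h3.le hb
  have m3 := mul_nonneg h1.le hc
  have e1 : det2 d (x - w) = 0 := (mul_eq_zero.1 (by linarith :
    det2 (y - w) (z - w) * det2 d (x - w) = 0)).resolve_left h2.ne'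
  have e2 : det2 d (y - w) = 0 := (mul_eq_zero.1 (by linarith :
    det2 (z - w) (x - w) * det2 d (y - w) = 0)).resolve_left h3.ne'
  exact hd (eq_zero_of_det2_eq_zero e1 e2 h1.ne')

/-- The point `w` lies strictly between `q` and `u`, so a supporting line has to contain both; but
`v` and `o` lie strictly on different sides of that line. -/
lemma not_onBoundary_of_mem_segment {q w u v o : Plane} {X : Set Plane} (hq : q ∈ X) (hu : u ∈ X)
    (hv : v ∈ X) (ho : o ∈ X) {t : ℝ} (ht : 1 < t) (e : u = q + t • (w - q))
    (h1 : orient q w v < 0) (h2 : 0 < orient q w o) : ¬OnBoundary w X := by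
  rintro ⟨d, hd, h⟩
  have hwq : w - q ≠ 0 := by
    intro h
    simp [orient, h] at h1
  have e1 : q - w = (-1 : ℝ) • (w - q) := by module
  have e2 : u - w = (t - 1) • (w - q) := by rw [e]; module
  have a1 := h q hq
  have a2 := h u hu
  rw [e1, det2_smul_right] at a1
  rw [e2, det2_smul_right] at a2
  have h0 : det2 (w - q) d = 0 := by
    rw [det2_swap]
    have : det2 d (w - q) ≤ 0 := by linarith
    have : 0 ≤ det2 d (w - q) := by
      by_contra hneg
      nlinarith
    linarith
  have hdd := exists_smul_of_det2_eq_zero hwq h0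
  set lam := dotp (w - q) d / dotp (w - q) (w - q)
  have a3 := h v hv
  have a4 := h o ho
  rw [hdd, det2_smul_left] at a3 a4
  have b1 : det2 (w - q) (v - w) = orient q w v := by
    simp only [orient, det2, PiLp.sub_apply]; ring
  have b2 : det2 (w - q) (o - w) = orient q w o := by
    simp only [orient, det2, PiLp.sub_apply]; ring
  rw [b1] at a3
  rw [b2] at a4
  have hl : lam = 0 := by
    apply le_antisymm
    · by_contra hp
      nlinarith
    · by_contra hp
      nlinarith
  rw [hl, zero_smul] at hdd
  exact hd hdd

/-- The point `w` that follows `q` on the hull of `A` is an inner point, seen from `v`. -/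
lemma not_onBoundary_next {v q u w o : Plane} {A : Finset Plane} {X : Set Plane} (hq : q ∈ X)
    (hu : u ∈ X) (hv : v ∈ X) (ho : o ∈ X) (huA : u ∈ A) (hwu : w ≠ u)
    (h2 : 0 < orient v u w ∨ ∃ t : ℝ, 1 ≤ t ∧ w = v + t • (u - v))
    (hw : IsTangent q A w) (h3 : orient q w v < 0) (h4 : 0 < orient q w o) :
    ¬OnBoundary w X := by
  have h2' : 0 < orient v u w := by
    rcases h2 with h2 | ⟨t, ht, e⟩
    · exact h2
    · exfalso
      have ht1 : t ≠ 1 := by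
        rintro rfl
        exact hwu (by rw [e]; simp)
      have ht' : 1 < t := lt_of_le_of_ne ht (Ne.symm ht1)
      have h5 := orient_line q w v u t
      rw [← e, orient_right] at h5
      have := hw.orient_nonneg huA
      nlinarith
  rcases hw.2 u huA with h5 | ⟨t, ht, e⟩
  · refine not_onBoundary_of_triangle hv hu hq ?_ ?_ ?_
    · rwa [orient_cycle]
    · rwa [← orient_cycle]
    · rw [orient_swap, ← orient_cycle]
      linarith
  · have ht1 : t ≠ 1 := by
      rintro rfl
      exact hwu (by rw [e]; simp)
    exact not_onBoundary_of_mem_segment hq hu hv ho (lt_of_le_of_ne ht (Ne.symm ht1)) e h3 h4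

/-! ### Peeling paths and pivots -/

/-- Each segment of the path meets the convex hull of the rest of the path only in its end. -/
def Peels : List Plane → Prop
  | a :: b :: r => (∀ y ∈ segment ℝ a b, y ∈ convexHull ℝ {z | z ∈ b :: r} → y = b) ∧
      Peels (b :: r)
  | _ => True

open Classical in
/-- The number of right turns of a path. -/
noncomputable def rightTurns : List Plane → ℕ
  | a :: b :: c :: r => (if orient a b c < 0 then 1 else 0) + rightTurns (b :: c :: r)
  | _ => 0

lemma rightTurns_cons_le (a b : Plane) (l : List Plane) :
    rightTurns (a :: b :: l) ≤ 1 + rightTurns (b :: l) := by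
  cases l with
  | nil => simp [rightTurns]
  | cons c r =>
    rw [rightTurns]
    split_ifs <;> omega

lemma rightTurns_cons_eq {a b : Plane} {l : List Plane} (h : ∀ x ∈ l, 0 ≤ orient a b x) :
    rightTurns (a :: b :: l) = rightTurns (b :: l) := by
  cases l with
  | nil => simp [rightTurns]
  | cons c r =>
    rw [rightTurns, if_neg (not_lt.2 (h c (by simp))), zero_add]

/-- A path from `v` through all points of `A` that ends at `p`. -/
structure IsPeelPath (v : Plane) (A : Finset Plane) (p : Plane) (l : List Plane) : Prop where
  nodup : l.Nodup
  mem_iff : ∀ x, x ∈ l ↔ x ∈ A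
  last : l.getLast? = some p
  peels : Peels (v :: l)

lemma isPeelPath_singleton (v p : Plane) : IsPeelPath v {p} p [p] := by
  refine ⟨by simp, by simp, by simp, ?_, trivial⟩
  intro y _ hy
  simpa using hy

lemma IsPeelPath.cons [DecidableEq Plane] {v u p : Plane} {A : Finset Plane} {l : List Plane}
    (h : IsPeelPath u (A.erase u) p l) (hu : u ∈ A)
    (hv : ∀ y ∈ segment ℝ v u, y ∈ convexHull ℝ (A : Set Plane) → y = u) :
    IsPeelPath v A p (u :: l) := by
  have hmem : ∀ x, x ∈ u :: l ↔ x ∈ A := by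
    intro x
    rw [List.mem_cons, h.mem_iff, Finset.mem_erase]
    constructor
    · rintro (rfl | hx)
      exacts [hu, hx.2]
    · intro hx
      by_cases hxu : x = u
      · exact Or.inl hxu
      · exact Or.inr ⟨hxu, hx⟩
  refine ⟨List.nodup_cons.2 ⟨fun hc => ?_, h.nodup⟩, hmem, ?_, ?_, h.peels⟩
  · rw [h.mem_iff] at hc
    simp at hc
  · rw [List.getLast?_cons, h.last]
    simp
  · have : {z | z ∈ u :: l} = (A : Set Plane) := by
      ext z
      exact hmem z
    rwa [this]

/-- A point `o` from which the points of `T` are seen in general position, except for those on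
the ray through the point `p` of `T`, which is close to `o`. -/
structure IsPivot (T : Finset Plane) (o p : Plane) : Prop where
  mem : p ∈ T
  ne : p ≠ o
  cover : ∀ x ∈ T, 0 < orient p o x ∨ ∃ t : ℝ, 1 ≤ t ∧ x = o + t • (p - o)
  generic : ∀ x ∈ T, ∀ y ∈ T, x ≠ y → 0 < orient p o x → 0 < orient p o y → orient o x y ≠ 0
  compat : ∀ x ∈ T, ∀ y ∈ T, 0 < orient p o x → 0 < orient p o y → 0 < orient o x y →
    0 ≤ orient p x y

/-- Points on a ray are visited in the order of decreasing distance. -/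
lemma exists_path_on_ray {o p : Plane} (hne : p ≠ o) (A : Finset Plane) (hp : p ∈ A)
    (hA : ∀ x ∈ A, ∃ t : ℝ, 1 ≤ t ∧ x = o + t • (p - o)) (v : Plane)
    (hv : 0 < orient p o v ∨
      ∃ s : ℝ, v = o + s • (p - o) ∧ ∀ t : ℝ, o + t • (p - o) ∈ A → t < s) :
    ∃ l, IsPeelPath v A p l ∧ rightTurns (v :: l) = 0 := by
  classical
  induction A using Finset.strongInduction generalizing v with
  | H A ih =>
  have hpo : p - o ≠ 0 := sub_ne_zero.2 hne
  obtain ⟨z, hz, hmax⟩ := A.exists_max_image (fun x => dotp (p - o) (x - o)) ⟨p, hp⟩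
  obtain ⟨s, hs, es⟩ := hA z hz
  have hle : ∀ t : ℝ, o + t • (p - o) ∈ A → t ≤ s := by
    intro t ht
    have := hmax _ ht
    rw [es, add_sub_cancel_left, add_sub_cancel_left, dotp_smul_right, dotp_smul_right] at this
    exact le_of_mul_le_mul_right this ((plane_ne_zero_iff _).1 hpo)
  have htan : IsTangent v A z := by
    refine ⟨hz, fun x hx => ?_⟩
    obtain ⟨t, ht, et⟩ := hA x hx
    have hts := hle t (et ▸ hx)
    rcases hv with hv | ⟨r, er, hr⟩
    · rcases hts.eq_or_lt with h | h
      · right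
        refine ⟨1, le_rfl, ?_⟩
        rw [et, h, ← es]
        simp
      · left
        have : orient v z x = (s - t) * orient p o v := by
          rw [et, es]
          simp only [orient, det2, PiLp.sub_apply, PiLp.add_apply, PiLp.smul_apply, smul_eq_mul]
          ring
        rw [this]
        exact mul_pos (by linarith) hv
    · right
      have hrs : s < r := hr s (es ▸ hz)
      refine ⟨(r - t) / (r - s), ?_, ?_⟩
      · rw [le_div_iff₀ (by linarith)]
        linarith
      · have h0 : r - s ≠ 0 := by linarith
        have e1 : z - v = (-(r - s)) • (p - o) := by rw [es, er]; module
        have e2 : (r - t) / (r - s) * -(r - s) = t - r := by field_simp; ring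
        rw [e1, smul_smul, e2, et, er]
        module
  have hseg := fun y => htan.eq_of_mem_segment (y := y)
  by_cases hzp : z = p
  · have hAp : A = {p} := by
      refine Finset.eq_singleton_iff_unique_mem.2 ⟨hp, fun x hx => ?_⟩
      obtain ⟨t, ht, et⟩ := hA x hx
      have hts := hle t (et ▸ hx)
      have hs1 : s = 1 := by
        have : (s - 1) • (p - o) = 0 := by
          have h1 : s • (p - o) = p - o := by
            rw [hzp] at es
            exact (sub_eq_iff_eq_add'.2 es).symm
          rw [sub_smul, h1, one_smul, sub_self]
        have := (smul_eq_zero.1 this).resolve_right hpo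
        linarith
      have : t = 1 := by linarith
      rw [et, this]
      simp
    rw [hAp]
    exact ⟨[p], isPeelPath_singleton v p, rfl⟩
  · obtain ⟨l, hl, hr⟩ := ih (A.erase z) (Finset.erase_ssubset hz)
      (Finset.mem_erase.2 ⟨Ne.symm hzp, hp⟩) (fun x hx => hA x (Finset.mem_of_mem_erase hx)) z
      (Or.inr ⟨s, es, fun t ht => by
        have h1 := Finset.mem_erase.1 ht
        exact lt_of_le_of_ne (hle t h1.2) fun h => h1.1 (by rw [h, ← es])⟩)
    refine ⟨z :: l, hl.cons hz hseg, ?_⟩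
    rw [rightTurns_cons_eq, hr]
    intro x hx
    exact htan.orient_nonneg (Finset.mem_of_mem_erase ((hl.mem_iff x).1 hx))

/-! ### Counting inner points, and the greedy path -/

section InnerPoints

open Classical in
/-- The number of points of `A` that lie inside the convex hull of `A`, `v` and `o`. -/
noncomputable def innerCount (o v : Plane) (A : Finset Plane) : ℕ :=
  (A.filter fun x => ¬OnBoundary x (insert o (insert v (A : Set Plane)))).card

open Classical in
-- A point inside the smaller hull is inside the larger one, so the count cannot grow when the path
-- advances; `C` collects points that stop being inner or leave the set.
lemma innerCount_add_le {o v q : Plane} {A B : Finset Plane} (C : Finset Plane)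
    (hC : ∀ x ∈ C, x ∈ A ∧ ¬OnBoundary x (insert o (insert v (A : Set Plane))))
    (hCB : ∀ x ∈ C, x ∈ B → OnBoundary x (insert o (insert q (B : Set Plane))))
    (hBA : B ⊆ A) (hq : q ∈ A) : innerCount o q B + C.card ≤ innerCount o v A := by
  rw [innerCount, innerCount, ← Finset.card_union_of_disjoint]
  · apply Finset.card_le_card
    intro x hx
    rw [Finset.mem_union, Finset.mem_filter] at hx
    rw [Finset.mem_filter]
    rcases hx with ⟨h1, h2⟩ | h
    · refine ⟨hBA h1, fun h => h2 (h.mono ?_)⟩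
      apply Set.insert_subset_insert
      intro y hy
      rcases hy with rfl | hy
      · exact Or.inr hq
      · exact Or.inr (hBA hy)
    · exact hC x h
  · rw [Finset.disjoint_left]
    intro x hx hxC
    rw [Finset.mem_filter] at hx
    exact hx.2 (hCB x hxC hx.1)

lemma innerCount_le {o v q : Plane} {A B : Finset Plane} (hBA : B ⊆ A) (hq : q ∈ A) :
    innerCount o q B ≤ innerCount o v A := by
  have := innerCount_add_le (o := o) (v := v) (q := q) (A := A) (B := B) ∅ (by simp) (by simp)
    hBA hq
  simpa using this

lemma innerCount_le_card (o v : Plane) (A : Finset Plane) : innerCount o v A ≤ A.card := by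
  classical
  rw [innerCount]
  exact Finset.card_filter_le _ _

end InnerPoints

/-- Genericity makes the first direction around `o` belong to a single point, and the points on the
ray through `p` come after all others. -/
lemma IsPivot.exists_first {T A : Finset Plane} {o p : Plane} (h : IsPivot T o p) (hA : A ⊆ T)
    (hN : ∃ x ∈ A, 0 < orient p o x) :
    ∃ q ∈ A, 0 < orient p o q ∧ ∀ x ∈ A, x ≠ q → 0 < orient o q x := by
  classical
  set N := A.filter fun x => 0 < orient p o x
  have e : ∀ x, det2 (o - p) (x - o) = orient p o x := by
    intro x
    simp only [orient, det2, PiLp.sub_apply]; ring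
  obtain ⟨x, hx, hx0⟩ := hN
  obtain ⟨q, hq, hmin⟩ := exists_isTangent (v := o) (c := o - p) (A := N)
    ⟨x, Finset.mem_filter.2 ⟨hx, hx0⟩⟩ fun x hx => by
      rw [e]
      exact (Finset.mem_filter.1 hx).2
  obtain ⟨hqA, hq0⟩ := Finset.mem_filter.1 hq
  refine ⟨q, hqA, hq0, fun x hx hxq => ?_⟩
  rcases h.cover x (hA hx) with hx0 | ⟨t, ht, rfl⟩
  · have hne := h.generic q (hA hqA) x (hA hx) (Ne.symm hxq) hq0 hx0
    rcases hmin x (Finset.mem_filter.2 ⟨hx, hx0⟩) with h1 | ⟨t, _, e⟩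
    · exact h1
    · exact absurd (by rw [e, orient_line]; simp) hne
  · rw [orient_line, orient_left, mul_zero, zero_add, ← orient_cycle]
    positivity

/-- The line through `o` and `q` separates `v` from `A`. -/
lemma eq_of_mem_segment_of_orient_neg {o q v y : Plane} {A : Finset Plane}
    (hv : orient o q v < 0) (hA : ∀ x ∈ A, 0 ≤ orient o q x) (hy : y ∈ segment ℝ v q)
    (hyA : y ∈ convexHull ℝ (A : Set Plane)) : y = q := by
  have h0 : 0 ≤ orient o q y := convexHull_min hA (convex_orient_nonneg o q) hyA
  rw [segment_eq_image'] at hy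
  obtain ⟨θ, hθ, rfl⟩ := hy
  dsimp only at *
  rw [orient_line, orient_right, mul_zero, add_zero] at h0
  have : θ = 1 := by
    by_contra hne
    have : θ < 1 := lt_of_le_of_ne hθ.2 hne
    nlinarith
  rw [this]
  simp

lemma eq_of_mem_segment_of_orient_pos {q v y : Plane} {A : Finset Plane}
    (hA : ∀ x ∈ A, x ≠ q → 0 < orient q v x) (hy : y ∈ segment ℝ v q)
    (hyA : y ∈ convexHull ℝ (A : Set Plane)) : y = q := by
  have hsub : convexHull ℝ (A : Set Plane) ⊆ {y | 0 < orient q v y} ∪ {q} := by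
    apply convexHull_min
    · intro x hx
      by_cases hxq : x = q
      · exact Or.inr hxq
      · exact Or.inl (hA x hx hxq)
    · apply convex_orient_pos_union q v (convex_singleton q)
      rintro y rfl
      simp
  rw [segment_eq_image'] at hy
  obtain ⟨θ, hθ, rfl⟩ := hy
  rcases hsub hyA with h | h
  · simp [orient_line] at h
  · exact h

/-- If the point `p` close to `o` follows `q` on the hull of `A`, then `A` is `{q, p}`. -/
lemma IsPivot.erase_eq_singleton [DecidableEq Plane] {T A : Finset Plane} {o p q : Plane}
    (h : IsPivot T o p) (hA : A ⊆ T) (hq : q ∈ A) (hq0 : 0 < orient p o q)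
    (hfirst : ∀ x ∈ A, x ≠ q → 0 < orient o q x) (hw : IsTangent q (A.erase q) p) :
    A.erase q = {p} := by
  refine Finset.eq_singleton_iff_unique_mem.2 ⟨hw.1, fun x hx => ?_⟩
  by_contra hxp
  obtain ⟨hxq, hxA⟩ := Finset.mem_erase.1 hx
  rcases h.cover x (hA hxA) with hx0 | ⟨s, hs, e⟩
  -- The order around `o` persists weakly around `p`, which leaves `x` on or to the right of the
  -- line from `q` to `p`, against tangency. Beyond `p` on that line it would violate `hx0`.
  · have h1 := h.compat q (hA hq) x (hA hxA) hq0 hx0 (hfirst x hxA hxq)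
    have h2 : orient q p x = -orient p q x := by
      simp only [orient, det2, PiLp.sub_apply]; ring
    rcases hw.2 x hx with h3 | ⟨t, ht, e⟩
    · linarith
    · rw [e, orient_line] at hx0
      simp only [orient_left, mul_zero, add_zero] at hx0
      nlinarith
  · have hs1 : 1 < s := by
      refine lt_of_le_of_ne hs fun h => hxp ?_
      rw [e, ← h]
      simp
    have h2 : orient q p x = -((s - 1) * orient p o q) := by
      rw [e]
      simp only [orient, det2, PiLp.sub_apply, PiLp.add_apply, PiLp.smul_apply, smul_eq_mul]; ring
    have := hw.orient_nonneg hx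
    nlinarith

open Classical in
/-- The path visits points on the hull of the remaining set without right turns, and makes a right
turn only where at least two points that were inside the hull come to its boundary. -/
lemma IsPivot.exists_path {T : Finset Plane} {o p : Plane} (h : IsPivot T o p) (A : Finset Plane)
    (hA : A ⊆ T) (hp : p ∈ A) :
    (∀ v, (∀ x ∈ A, 0 < orient p o x → 0 < orient o v x) →
      (0 < orient p o v ∨ ∃ x ∈ A, 0 < orient p o x) →
      ∃ l, IsPeelPath v A p l ∧ rightTurns (v :: l) ≤ (innerCount o v A + 1) / 2) ∧
    (∀ v q, q ∈ A → 0 < orient p o q → (∀ x ∈ A, x ≠ q → 0 < orient o q x) →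
      (∀ x ∈ A, x ≠ q → 0 < orient q v x) →
      ∃ l, IsPeelPath v A p l ∧ rightTurns (v :: l) ≤ (innerCount o v A + 2) / 2) := by
  -- Two states of the greedy walk. In the first, `v` precedes all remaining points off the ray in
  -- the order around `o`. In the second, the first point `q` has been postponed and `v` is its
  -- former successor on the hull; the debt raises the bound from `(inner + 1) / 2` to `(inner + 2)
  -- / 2`.
  induction A using Finset.strongInduction with
  | H A ih =>
  have pne : ∀ q, 0 < orient p o q → p ≠ q := by
    rintro q hq rfl
    simp at hq
  -- the facts about the first point `q` around `o` and its successor `w` on the hull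
  have next : ∀ q ∈ A, 0 < orient p o q → (∀ x ∈ A, x ≠ q → 0 < orient o q x) →
      ∃ w, IsTangent q (A.erase q) w ∧ 0 < orient q w o ∧
        (∃ l, IsPeelPath q (A.erase q) p l ∧
          rightTurns (q :: l) ≤ (innerCount o q (A.erase q) + 1) / 2) := by
    intro q hq hq0 hfirst
    have hpq : p ∈ A.erase q := Finset.mem_erase.2 ⟨pne q hq0, hp⟩
    obtain ⟨w, hw⟩ := exists_isTangent (v := q) (c := q - o) (A := A.erase q) ⟨p, hpq⟩
      fun x hx => by
        obtain ⟨h1, h2⟩ := Finset.mem_erase.1 hx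
        have := hfirst x h2 h1
        have e : det2 (q - o) (x - q) = orient o q x := by
          simp only [orient, det2, PiLp.sub_apply]; ring
        rwa [e]
    obtain ⟨hwq, hwA⟩ := Finset.mem_erase.1 hw.1
    refine ⟨w, hw, ?_, ?_⟩
    · rw [← orient_cycle]
      exact hfirst w hwA hwq
    · refine (ih (A.erase q) (Finset.erase_ssubset hq) ((Finset.erase_subset _ _).trans hA)
        hpq).1 q ?_ (Or.inl hq0)
      intro x hx _
      obtain ⟨h1, h2⟩ := Finset.mem_erase.1 hx
      exact hfirst x h2 h1
  -- The line from `q` to its successor `w` supports `A` and `o`, so `q` and `w` are boundary points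
  -- as soon as `z` is not on its right.
  have bd : ∀ q w z, q ∈ A → IsTangent q (A.erase q) w → 0 < orient q w o → 0 ≤ orient q w z →
      ∀ x, x = q ∨ x = w → OnBoundary x (insert o (insert z (A : Set Plane))) := by
    intro q w z hq hw hwo hz x hx
    refine ⟨w - q, ?_, ?_⟩
    · intro h0
      simp [orient, h0] at hwo
    · have e : ∀ y, det2 (w - q) (y - x) = orient q w y := by
        intro y
        rcases hx with rfl | rfl
        · rfl
        · simp only [orient, det2, PiLp.sub_apply]; ring
      rintro y (rfl | rfl | hy)
      · rw [e]; exact hwo.le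
      · rw [e]; exact hz
      · rw [e]
        by_cases hyq : y = q
        · rw [hyq, orient_left]
        · exact hw.orient_nonneg (Finset.mem_erase.2 ⟨hyq, hy⟩)
  have bd' : ∀ q w, q ∈ A → IsTangent q (A.erase q) w → 0 < orient q w o →
      OnBoundary w (insert o (insert q ((A.erase q : Finset Plane) : Set Plane))) := by
    intro q w hq hw hwo
    refine (bd q w q hq hw hwo (by simp) w (Or.inr rfl)).mono ?_
    apply Set.insert_subset_insert
    apply Set.insert_subset_insert
    exact_mod_cast Finset.erase_subset q A
  have zero : ∀ q, 0 < orient p o q → innerCount o q {p} = 0 := by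
    intro q hq0
    rw [innerCount, Finset.card_eq_zero, Finset.filter_eq_empty_iff]
    intro x hx
    rw [Finset.mem_singleton] at hx
    subst hx
    rw [not_not]
    refine ⟨o - x, sub_ne_zero.2 h.ne.symm, ?_⟩
    intro y hy
    have hy' : y = o ∨ y = q ∨ y = x := by simpa using hy
    rcases hy' with rfl | rfl | rfl
    · simp
    · exact hq0.le
    · simp
  -- a hull move to the successor of `q`
  have move : ∀ v q u, q ∈ A → 0 < orient p o q → (∀ x ∈ A, x ≠ q → 0 < orient o q x) →
      IsTangent v A u → IsTangent q (A.erase q) u → 0 < orient v u q → u ≠ p →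
      ∃ l, IsPeelPath v A p l ∧
        rightTurns (v :: l) ≤ (innerCount o u (A.erase u) + 2) / 2 := by
    intro v q u hq hq0 hfirst hu hw huq hup
    obtain ⟨huq', huA⟩ := Finset.mem_erase.1 hw.1
    obtain ⟨l, hl, hr⟩ := (ih (A.erase u) (Finset.erase_ssubset huA)
      ((Finset.erase_subset _ _).trans hA) (Finset.mem_erase.2 ⟨hup.symm, hp⟩)).2 u q
      (Finset.mem_erase.2 ⟨huq'.symm, hq⟩) hq0
      (fun x hx hxq => hfirst x (Finset.mem_of_mem_erase hx) hxq) (fun x hx hxq => by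
        obtain ⟨hxu, hxA⟩ := Finset.mem_erase.1 hx
        rcases hw.2 x (Finset.mem_erase.2 ⟨hxq, hxA⟩) with h1 | ⟨t, ht, e⟩
        · exact h1
        -- A point beyond `u` on the ray from `q` would lie to the right of the tangent from `v`,
        -- because `q` is strictly on its left.
        · exfalso
          have ht1 : 1 < t := by
            refine lt_of_le_of_ne ht fun h => hxu ?_
            rw [e, ← h]
            simp
          have h2 := hu.orient_nonneg hxA
          rw [e, orient_line, orient_right, mul_zero, add_zero] at h2
          nlinarith)
    refine ⟨u :: l, hl.cons huA fun y => hu.eq_of_mem_segment, ?_⟩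
    rw [rightTurns_cons_eq]
    · exact hr
    · intro x hx
      exact hu.orient_nonneg (Finset.mem_of_mem_erase ((hl.mem_iff x).1 hx))
  refine ⟨fun v hv hv0 => ?_, fun v q hq hq0 hfirst hvq => ?_⟩
  · by_cases hN : ∃ x ∈ A, 0 < orient p o x
    · obtain ⟨q, hq, hq0, hfirst⟩ := h.exists_first hA hN
      have hoqv : orient o q v < 0 := by
        have := hv q hq hq0
        rw [orient_swap]
        linarith
      have hnonneg : ∀ x ∈ A, 0 ≤ orient o q x := by
        intro x hx
        by_cases hxq : x = q
        · rw [hxq, orient_right]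
        · exact (hfirst x hx hxq).le
      obtain ⟨u, hu⟩ := exists_isTangent (v := v) (c := q - o) (A := A) ⟨p, hp⟩ fun x hx => by
        have e : det2 (q - o) (x - v) = orient o q x - orient o q v := by
          simp only [orient, det2, PiLp.sub_apply]; ring
        rw [e]
        linarith [hnonneg x hx]
      obtain ⟨w, hw, hwo, l, hl, hr⟩ := next q hq hq0 hfirst
      -- If the tangent point is the first point itself, advancing to it costs no right turn.
      by_cases huq : u = q
      · subst huq
        refine ⟨u :: l, hl.cons hq fun y => hu.eq_of_mem_segment, ?_⟩
        rw [rightTurns_cons_eq]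
        · have := innerCount_le (o := o) (v := v) (Finset.erase_subset u A) hq
          omega
        · intro x hx
          exact hu.orient_nonneg (Finset.mem_of_mem_erase ((hl.mem_iff x).1 hx))
      · have hvuq : 0 < orient v u q := by
          rcases hu.2 q hq with h1 | ⟨t, ht, e⟩
          · exact h1
          · exfalso
            have h1 := hfirst u hu.1 huq
            have h2 := orient_line o q v u t
            rw [← e, orient_right] at h2
            nlinarith
        -- Otherwise `q` lies strictly inside the triangle `v`, `u`, `o`.
        have hqin : ¬OnBoundary q (insert o (insert v (A : Set Plane))) := by
          refine not_onBoundary_of_triangle (x := v) (y := u) (z := o)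
            (Or.inr (Or.inl rfl)) (Or.inr (Or.inr hu.1)) (Or.inl rfl) ?_ ?_ ?_
          · rwa [orient_cycle]
          · rw [← orient_cycle]
            exact hfirst u hu.1 huq
          · have := hv q hq hq0
            rwa [orient_cycle]
        have hwv : orient q w v < 0 := by
          by_contra hge
          exact hqin (bd q w v hq hw hwo (not_lt.1 hge) q (Or.inl rfl))
        by_cases hwu : w = u
        · subst hwu
          by_cases hwp : w = p
          · subst hwp
            have he := h.erase_eq_singleton hA hq hq0 hfirst hw
            rw [he, zero q hq0] at hr
            refine ⟨q :: l, hl.cons hq fun y =>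
              eq_of_mem_segment_of_orient_neg hoqv hnonneg, ?_⟩
            have h1 := rightTurns_cons_le v q l
            have h2 := innerCount_add_le (o := o) (v := v) (q := q) (A := A) (B := ∅) {q}
              (by simpa using ⟨hq, hqin⟩) (by simp) (by simp) hq
            rw [Finset.card_singleton] at h2
            omega
          -- The tangent from `v` ends at the successor of `q`: follow it and postpone `q`. The
          -- point `q` ceases to be inner, which pays for the debt of the second state.
          · obtain ⟨l', hl', hr'⟩ := move v q w hq hq0 hfirst hu hw hvuq hwp
            refine ⟨l', hl', hr'.trans ?_⟩
            have h2 := innerCount_add_le (o := o) (v := v) (q := w) (A := A) (B := A.erase w) {q}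
              (by simpa using ⟨hq, hqin⟩) (by
                intro x hx _
                rw [Finset.mem_singleton] at hx
                refine (bd q w w hq hw hwo (by simp) x (Or.inl hx)).mono ?_
                apply Set.insert_subset_insert
                apply Set.insert_subset_insert
                exact_mod_cast Finset.erase_subset w A) (Finset.erase_subset _ _) hu.1
            rw [Finset.card_singleton] at h2
            omega
        -- Going to `q` may cost one right turn, but both `q` and its successor `w` were inner: `q`
        -- leaves the set and `w` comes to the boundary.
        · refine ⟨q :: l, hl.cons hq fun y =>
            eq_of_mem_segment_of_orient_neg hoqv hnonneg, ?_⟩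
          have huq' : u ∈ A.erase q := Finset.mem_erase.2 ⟨huq, hu.1⟩
          obtain ⟨hwq, hwA⟩ := Finset.mem_erase.1 hw.1
          have hwin : ¬OnBoundary w (insert o (insert v (A : Set Plane))) :=
            not_onBoundary_next (Or.inr (Or.inr hq)) (Or.inr (Or.inr hu.1)) (Or.inr (Or.inl rfl))
              (Or.inl rfl) huq' hwu (hu.2 w hwA) hw hwv hwo
          have h1 := rightTurns_cons_le v q l
          have h2 := innerCount_add_le (o := o) (v := v) (q := q) (A := A) (B := A.erase q) {q, w}
            (by
              intro x hx
              rw [Finset.mem_insert, Finset.mem_singleton] at hx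
              rcases hx with rfl | rfl
              exacts [⟨hq, hqin⟩, ⟨hwA, hwin⟩]) (by
              intro x hx hxA
              rw [Finset.mem_insert, Finset.mem_singleton] at hx
              rcases hx with rfl | rfl
              · simp at hxA
              · exact bd' q x hq hw hwo) (Finset.erase_subset _ _) hq
          rw [Finset.card_pair hwq.symm] at h2
          omega
    · have hv1 : 0 < orient p o v := hv0.resolve_right hN
      obtain ⟨l, hl, hr⟩ := exists_path_on_ray h.ne A hp (fun x hx =>
        (h.cover x (hA hx)).resolve_left fun h1 => hN ⟨x, hx, h1⟩) v (Or.inl hv1)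
      exact ⟨l, hl, by omega⟩
  · have hpq : p ∈ A.erase q := Finset.mem_erase.2 ⟨pne q hq0, hp⟩
    obtain ⟨u, hu'⟩ := exists_isTangent (v := v) (c := v - q) (A := A.erase q) ⟨p, hpq⟩
      fun x hx => by
        obtain ⟨h1, h2⟩ := Finset.mem_erase.1 hx
        have e : det2 (v - q) (x - v) = orient q v x := by
          simp only [orient, det2, PiLp.sub_apply]; ring
        rw [e]
        exact hvq x h2 h1
    obtain ⟨huq, huA⟩ := Finset.mem_erase.1 hu'.1
    have hvuq : 0 < orient v u q := by
      rw [← orient_cycle]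
      exact hvq u huA huq
    -- The postponed point `q` lies to the left as well, so the tangent to the rest is a tangent to
    -- all of `A`.
    have hu : IsTangent v A u := by
      refine ⟨huA, fun x hx => ?_⟩
      by_cases hxq : x = q
      · subst hxq
        exact Or.inl hvuq
      · exact hu'.2 x (Finset.mem_erase.2 ⟨hxq, hx⟩)
    obtain ⟨w, hw, hwo, l, hl, hr⟩ := next q hq hq0 hfirst
    obtain ⟨hwq, hwA⟩ := Finset.mem_erase.1 hw.1
    have hwv : orient q w v < 0 := by
      have := hvq w hwA hwq
      rw [orient_swap]
      linarith
    have hpath : IsPeelPath v A p (q :: l) :=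
      hl.cons hq fun y => eq_of_mem_segment_of_orient_pos hvq
    have h1 := rightTurns_cons_le v q l
    by_cases hwu : w = u
    · subst hwu
      by_cases hwp : w = p
      · subst hwp
        have he := h.erase_eq_singleton hA hq hq0 hfirst hw
        rw [he, zero q hq0] at hr
        exact ⟨q :: l, hpath, by omega⟩
      · obtain ⟨l', hl', hr'⟩ := move v q w hq hq0 hfirst hu hw hvuq hwp
        refine ⟨l', hl', hr'.trans ?_⟩
        have h2 := innerCount_le (o := o) (v := v) (Finset.erase_subset w A) hwA
        omega
    -- Return to `q` and to the first state: one right turn, paid for by `w` and the debt.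
    · refine ⟨q :: l, hpath, ?_⟩
      have hwin : ¬OnBoundary w (insert o (insert v (A : Set Plane))) :=
        not_onBoundary_next (Or.inr (Or.inr hq)) (Or.inr (Or.inr hu.1)) (Or.inr (Or.inl rfl))
          (Or.inl rfl) hu'.1 hwu (hu.2 w hwA) hw hwv hwo
      have h2 := innerCount_add_le (o := o) (v := v) (q := q) (A := A) (B := A.erase q) {w}
        (by simpa using ⟨hwA, hwin⟩) (by
          intro x hx _
          rw [Finset.mem_singleton] at hx
          subst hx
          exact bd' q x hq hw hwo) (Finset.erase_subset _ _) hq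
      rw [Finset.card_singleton] at h2
      omega

/-! ### From a peeling path to a simple polygon -/

lemma finRotate_val {n : ℕ} (i : Fin n) :
    (finRotate n i : ℕ) = if (i : ℕ) + 1 = n then 0 else (i : ℕ) + 1 := by
  obtain ⟨m, rfl⟩ : ∃ m, n = m + 1 := ⟨n - 1, by have := i.2; omega⟩
  rw [coe_finRotate]
  simp only [Fin.ext_iff, Fin.val_last, Nat.add_right_cancel_iff]

lemma finRotate_symm_val {n : ℕ} (i : Fin n) :
    ((finRotate n).symm i : ℕ) = if (i : ℕ) = 0 then n - 1 else (i : ℕ) - 1 := by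
  obtain ⟨j, rfl⟩ := (finRotate n).surjective i
  rw [Equiv.symm_apply_apply, finRotate_val]
  have := j.2
  by_cases h : (j : ℕ) + 1 = n
  · simp [h]
    omega
  · simp [h]

namespace Polygon

/-- The polygon with the vertices `f 0`, …, `f (n - 1)`. -/
def ofFun (f : ℕ → Plane) (n : ℕ) : Polygon Plane n := ⟨fun i => f i⟩

variable {f : ℕ → Plane} {n : ℕ}

lemma ofFun_apply (f : ℕ → Plane) (i : Fin n) : ofFun f n i = f i := rfl

lemma ofFun_next {i : Fin n} (hi : (i : ℕ) + 1 < n) : ofFun f n (finRotate n i) = f (i + 1) := by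
  rw [ofFun_apply, finRotate_val, if_neg hi.ne]

lemma ofFun_next_last {i : Fin n} (hi : (i : ℕ) + 1 = n) : ofFun f n (finRotate n i) = f 0 := by
  rw [ofFun_apply, finRotate_val, if_pos hi]

lemma ofFun_turn_first (hn : 2 ≤ n) {i : Fin n} (hi : (i : ℕ) = 0) :
    (ofFun f n).turn i = orient (f (n - 1)) (f 0) (f 1) := by
  have e : ofFun f n ((finRotate n).symm i) = f (n - 1) := by
    rw [ofFun_apply, finRotate_symm_val, if_pos hi]
  rw [turn, e, ofFun_next (by omega), ofFun_apply, hi]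
  simp only [orient, det2, PiLp.sub_apply]
  ring

lemma ofFun_turn_last {i : Fin n} (h0 : 0 < (i : ℕ)) (hi : (i : ℕ) + 1 = n) :
    (ofFun f n).turn i = orient (f (i - 1)) (f i) (f 0) := by
  have e : ofFun f n ((finRotate n).symm i) = f (i - 1) := by
    rw [ofFun_apply, finRotate_symm_val, if_neg h0.ne']
  rw [turn, e, ofFun_next_last hi, ofFun_apply]
  simp only [orient, det2, PiLp.sub_apply]
  ring

lemma ofFun_turn {i : Fin n} (h0 : 0 < (i : ℕ)) (hi : (i : ℕ) + 1 < n) :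
    (ofFun f n).turn i = orient (f (i - 1)) (f i) (f (i + 1)) := by
  have e : ofFun f n ((finRotate n).symm i) = f (i - 1) := by
    rw [ofFun_apply, finRotate_symm_val, if_neg h0.ne']
  rw [turn, e, ofFun_next hi, ofFun_apply]
  simp only [orient, det2, PiLp.sub_apply]
  ring

lemma isSimple_ofFun (hn : 3 ≤ n) (hinj : ∀ i < n, ∀ j < n, f i = f j → i = j)
    (h : ∀ i j, i < j → j + 1 < n → ∀ y ∈ segment ℝ (f i) (f (i + 1)),
      y ∈ segment ℝ (f j) (f (j + 1)) → y = f (i + 1) ∧ j = i + 1)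
    (hc : ∀ i, i + 1 < n → ∀ y ∈ segment ℝ (f i) (f (i + 1)), y ∈ segment ℝ (f (n - 1)) (f 0) →
      (y = f 0 ∧ i = 0) ∨ (y = f (n - 1) ∧ i + 1 = n - 1)) : (ofFun f n).IsSimple := by
  refine ⟨hn, fun i j hij => Fin.ext (hinj i i.2 j j.2 hij), ?_⟩
  have key : ∀ i j : Fin n, i < j → (ofFun f n).edgeSet ℝ i ∩ (ofFun f n).edgeSet ℝ j ⊆
      ({ofFun f n i, ofFun f n (finRotate n i)} : Set Plane) ∩
        {ofFun f n j, ofFun f n (finRotate n j)} := by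
    intro i j hij y hy
    rw [edgeSet_eq_segment, edgeSet_eq_segment] at hy
    obtain ⟨h1, h2⟩ := hy
    have hij' : (i : ℕ) < j := hij
    have hi : (i : ℕ) + 1 < n := by have := j.2; omega
    rw [ofFun_next hi] at h1 ⊢
    rw [ofFun_apply] at h1 h2 ⊢
    by_cases hj : (j : ℕ) + 1 < n
    · rw [ofFun_next hj] at h2 ⊢
      obtain ⟨e, e'⟩ := h i j hij' hj y h1 h2
      subst e
      simp [ofFun_apply, e']
    · have hj' : (j : ℕ) + 1 = n := by have := j.2; omega
      have hj'' : (j : ℕ) = n - 1 := by omega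
      rw [ofFun_next_last hj'] at h2 ⊢
      rw [hj''] at h2
      rw [ofFun_apply, hj'']
      rcases hc i hi y h1 h2 with ⟨e, e'⟩ | ⟨e, e'⟩
      · simp [e, e']
      · simp [e, e']
  intro i j hij
  rcases lt_or_gt_of_ne hij with h1 | h1
  · exact key i j h1
  · rw [Set.inter_comm, Set.inter_comm {ofFun f n i, _}]
    exact key j i h1

end Polygon

lemma Peels.eq_of_mem {L : List Plane} (h : Peels L) {i : ℕ} (hi : i + 1 < L.length) {y : Plane}
    (hy : y ∈ segment ℝ (L.getD i 0) (L.getD (i + 1) 0))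
    (hy' : y ∈ convexHull ℝ ((fun k => L.getD k 0) '' {k | i < k ∧ k < L.length})) :
    y = L.getD (i + 1) 0 := by
  induction i generalizing L with
  | zero =>
    match L, h, hi with
    | a :: b :: r, h, _ =>
      refine h.1 y hy (convexHull_mono ?_ hy')
      rintro _ ⟨k, ⟨h1, h2⟩, rfl⟩
      obtain ⟨k, rfl⟩ : ∃ m, k = m + 1 := ⟨k - 1, by omega⟩
      have h2 : k < (b :: r).length := by simpa using h2
      dsimp only
      rw [List.getD_cons_succ, List.getD_eq_getElem _ _ h2]
      exact List.getElem_mem h2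
  | succ i ih =>
    match L, h, hi with
    | [a], _, hi => simp at hi
    | a :: b :: r, h, hi =>
      rw [List.getD_cons_succ]
      refine ih h.2 (by simpa using hi) hy (convexHull_mono ?_ hy')
      rintro _ ⟨k, ⟨h1, h2⟩, rfl⟩
      obtain ⟨k, rfl⟩ : ∃ m, k = m + 1 := ⟨k - 1, by omega⟩
      exact ⟨k, ⟨by omega, by simpa using h2⟩, rfl⟩

open Classical in
lemma rightTurns_eq_sum (L : List Plane) : rightTurns L = ∑ k ∈ Finset.range (L.length - 2),
    if orient (L.getD k 0) (L.getD (k + 1) 0) (L.getD (k + 2) 0) < 0 then 1 else 0 := by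
  induction L with
  | nil => rfl
  | cons a L ih =>
    match L, ih with
    | [], _ => rfl
    | [b], _ => rfl
    | b :: c :: r, ih =>
      have e : (a :: b :: c :: r).length - 2 = ((b :: c :: r).length - 2) + 1 := by simp
      rw [rightTurns, ih, e, Finset.sum_range_succ', add_comm]
      rfl

/-- A peeling path through points to the left of its closing edge bounds a polygon. -/
lemma isCcw_of_peels {L : List Plane} {n : ℕ} (hn : L.length = n) (h3 : 3 ≤ n) (hnd : L.Nodup)
    (hL : Peels L)
    (hc : ∀ k, 0 < k → k < n → 0 < orient (L.getD (n - 1) 0) (L.getD 0 0) (L.getD k 0) ∨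
      ∃ t : ℝ, 1 ≤ t ∧ L.getD k 0 = L.getD 0 0 + t • (L.getD (n - 1) 0 - L.getD 0 0))
    (hext : ∃ c, ∀ k, 0 < k → k < n → dotp c (L.getD k 0) < dotp c (L.getD 0 0)) :
    (Polygon.ofFun (fun k => L.getD k 0) n).IsCcw ∧
      (Polygon.ofFun (fun k => L.getD k 0) n).reflexCount ≤ rightTurns L := by
  classical
  set f : ℕ → Plane := fun k => L.getD k 0
  have hinj : ∀ i < n, ∀ j < n, f i = f j → i = j := by
    intro i hi j hj h
    have hi' : i < L.length := by omega
    have hj' : j < L.length := by omega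
    simp only [f] at h
    rw [List.getD_eq_getElem _ _ hi', List.getD_eq_getElem _ _ hj'] at h
    exact (hnd.getElem_inj_iff).1 h
  have hpeel : ∀ i j, i < j → j + 1 < n → ∀ y ∈ segment ℝ (f i) (f (i + 1)),
      y ∈ segment ℝ (f j) (f (j + 1)) → y = f (i + 1) := by
    intro i j hij hj y h1 h2
    refine hL.eq_of_mem (by omega) h1 (segment_subset_convexHull ?_ ?_ h2)
    · exact ⟨j, ⟨hij, by omega⟩, rfl⟩
    · exact ⟨j + 1, ⟨by omega, by omega⟩, rfl⟩
  have hnonneg : ∀ k < n, 0 ≤ orient (f (n - 1)) (f 0) (f k) := by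
    intro k hk
    rcases Nat.eq_zero_or_pos k with rfl | h0
    · simp
    · rcases hc k h0 hk with h1 | ⟨t, _, e⟩
      · exact h1.le
      · simp only [f]
        rw [e, orient_line]
        simp
  have hne : f (n - 1) ≠ f 0 := fun h => by
    have := hinj _ (by omega) _ (by omega) h
    omega
  -- the rest of the path meets the closing edge only in its end
  have hclose : ∀ y ∈ convexHull ℝ (f '' {k | 0 < k ∧ k < n}), y ∈ segment ℝ (f (n - 1)) (f 0) →
      y = f (n - 1) := by
    intro y hy hy'
    have hsub : convexHull ℝ (f '' {k | 0 < k ∧ k < n}) ⊆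
        {y | 0 < orient (f (n - 1)) (f 0) y} ∪
          ((fun t : ℝ => f 0 + t • (f (n - 1) - f 0)) '' Set.Ici 1) := by
      apply convexHull_min
      · rintro _ ⟨k, ⟨hk, hk'⟩, rfl⟩
        rcases hc k hk hk' with h1 | ⟨t, ht, e⟩
        · exact Or.inl h1
        · exact Or.inr ⟨t, ht, e.symm⟩
      · apply convex_orient_pos_union
        · rintro _ ⟨a, ha, rfl⟩ _ ⟨b, hb, rfl⟩ s t hs ht hst
          have ha : 1 ≤ a := ha
          have hb : 1 ≤ b := hb
          refine ⟨s * a + t * b, ?_, ?_⟩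
          · have : 1 = s * 1 + t * 1 := by linarith
            rw [Set.mem_Ici, this]
            gcongr
          · have hs' : s = 1 - t := by linarith
            subst hs'
            module
        · rintro _ ⟨t, -, rfl⟩
          simp [orient_line]
    rw [segment_symm, segment_eq_image'] at hy'
    obtain ⟨θ, hθ, rfl⟩ := hy'
    dsimp only
    rcases hsub hy with h1 | ⟨t, ht, e⟩
    · simp [orient_line] at h1
    · have ht : 1 ≤ t := ht
      have e' : (t - θ) • (f (n - 1) - f 0) = 0 := by
        have := add_left_cancel e
        rw [sub_smul, this, sub_self]
      have := (smul_eq_zero.1 e').resolve_right (sub_ne_zero.2 hne)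
      have hθ1 : θ = 1 := by linarith [hθ.2]
      rw [hθ1]
      simp
  have hs : (Polygon.ofFun f n).IsSimple := by
    refine Polygon.isSimple_ofFun h3 hinj ?_ ?_
    · intro i j hij hj y h1 h2
      have hy := hpeel i j hij hj y h1 h2
      refine ⟨hy, ?_⟩
      by_contra hji
      have h4 : f (i + 1) = f (i + 1 + 1) := by
        refine hpeel (i + 1) j (by omega) hj _ (left_mem_segment ..) ?_
        rw [← hy]
        exact h2
      have := hinj _ (by omega) _ (by omega) h4
      omega
    · intro i hi y h1 h2
      rcases Nat.eq_zero_or_pos i with rfl | h0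
      · left
        refine ⟨?_, rfl⟩
        rcases hc 1 one_pos (by omega) with h4 | ⟨t, ht, e⟩
        · rw [segment_symm, segment_eq_image'] at h2
          rw [segment_eq_image'] at h1
          obtain ⟨θ, hθ, rfl⟩ := h1
          obtain ⟨θ', hθ', e'⟩ := h2
          have h5 := congrArg (orient (f (n - 1)) (f 0)) e'
          simp only [orient_line, orient_left, orient_right, mul_zero, zero_add] at h5
          have h6 : θ = 0 := (mul_eq_zero.1 h5.symm).resolve_right h4.ne'
          simp [h6]
        -- If the first segment ran along the closing edge, it would contain the last point, and
        -- peeling would identify the last point with `f 1`, against `n ≥ 3`.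
        · exfalso
          have hp1 : f (n - 1) = f 1 := by
            refine hL.eq_of_mem (i := 0) (by omega) (y := f (n - 1)) ?_
              (subset_convexHull ℝ _ ⟨n - 1, ⟨by omega, by omega⟩, rfl⟩)
            rw [segment_eq_image']
            have ht0 : 0 < t := by linarith
            refine ⟨1 / t, ⟨by positivity, by rw [div_le_one ht0]; exact ht⟩, ?_⟩
            have e1 : L.getD (0 + 1) 0 - L.getD 0 0 = t • (f (n - 1) - f 0) := by
              rw [zero_add, e, add_sub_cancel_left]
            dsimp only
            rw [e1, smul_smul, one_div_mul_cancel ht0.ne', one_smul]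
            exact add_sub_cancel _ _
          have := hinj _ (by omega) _ (by omega) hp1
          omega
      · right
        have hy : y = f (n - 1) := by
          refine hclose y (segment_subset_convexHull ?_ ?_ h1) h2
          · exact ⟨i, ⟨h0, by omega⟩, rfl⟩
          · exact ⟨i + 1, ⟨by omega, by omega⟩, rfl⟩
        refine ⟨hy, ?_⟩
        have : f (n - 1) = f (i + 1) := by
          rw [← hy]
          refine hL.eq_of_mem (by omega) h1 (subset_convexHull ℝ _ ?_)
          rw [hy]
          exact ⟨n - 1, ⟨by omega, by omega⟩, rfl⟩
        exact (hinj _ (by omega) _ (by omega) this).symm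
  obtain ⟨c, hcf⟩ := hext
  have hx : (Polygon.ofFun f n).IsExtreme ⟨0, by omega⟩ := by
    refine ⟨c, fun j hj => hcf j ?_ j.2⟩
    by_contra h0
    exact hj (Fin.ext (by simpa using h0))
  have ht0 : (Polygon.ofFun f n).turn ⟨0, by omega⟩ = orient (f (n - 1)) (f 0) (f 1) :=
    Polygon.ofFun_turn_first (by omega) rfl
  have hccw : (Polygon.ofFun f n).IsCcw := by
    refine hs.isCcw hx (lt_of_le_of_ne ?_ (hx.turn_ne_zero hs).symm)
    rw [ht0]
    exact hnonneg 1 (by omega)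
  refine ⟨hccw, ?_⟩
  rw [hccw.reflexCount_eq, rightTurns_eq_sum, ← Finset.card_filter, hn]
  -- The turns at both ends of the closing edge are not right turns, since all points lie weakly to
  -- the left of it; so only inner vertices of the path count.
  have hpos : ∀ i : Fin n, (Polygon.ofFun f n).turn i < 0 → 0 < (i : ℕ) ∧ (i : ℕ) + 1 < n := by
    intro i hi
    constructor
    · by_contra h0
      have h0 : (i : ℕ) = 0 := by omega
      rw [Polygon.ofFun_turn_first (by omega) h0] at hi
      exact absurd hi (not_lt.2 (hnonneg 1 (by omega)))
    · by_contra h0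
      have h1 : (i : ℕ) + 1 = n := by have := i.2; omega
      rw [Polygon.ofFun_turn_last (by omega) h1, orient_cycle] at hi
      have h2 : (i : ℕ) = n - 1 := by omega
      have := hnonneg (i - 1) (by omega)
      rw [h2] at hi this
      linarith
  rw [← Set.ncard_coe_finset]
  -- The turn at vertex `i` is the term of index `i - 1` in the sum for the path.
  refine Set.ncard_le_ncard_of_injOn (fun i : Fin n => (i : ℕ) - 1) ?_ ?_ (Finset.finite_toSet _)
  · intro i hi
    obtain ⟨h1, h2⟩ := hpos i hi
    have hi : (Polygon.ofFun f n).turn i < 0 := hi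
    rw [Polygon.ofFun_turn h1 h2] at hi
    rw [Finset.mem_coe, Finset.mem_filter, Finset.mem_range]
    rw [show (i : ℕ) - 1 + 1 = i by omega, show (i : ℕ) - 1 + 2 = i + 1 by omega]
    exact ⟨by omega, hi⟩
  · intro i hi j hj hij
    have h1 := hpos i hi
    have h2 := hpos j hj
    dsimp only at hij
    exact Fin.ext (by omega)

/-! ### The pivot and the upper bound -/

/-- Exchange of the coordinates. -/
noncomputable def swapCoord (a : Plane) : Plane := !₂[a 1, a 0]

@[simp] lemma swapCoord_zero_coord (a : Plane) : swapCoord a 0 = a 1 := by simp [swapCoord]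

@[simp] lemma swapCoord_one_coord (a : Plane) : swapCoord a 1 = a 0 := by simp [swapCoord]

/-- Exchanging the coordinates reverses orientation and turns this into the existence of a left
tangent. -/
lemma exists_right_tangent {v c : Plane} {A : Finset Plane} (hA : A.Nonempty)
    (hc : ∀ x ∈ A, 0 < det2 c (x - v)) :
    ∃ u ∈ A, ∀ x ∈ A, 0 < orient u v x ∨ ∃ t : ℝ, 1 ≤ t ∧ x = v + t • (u - v) := by
  classical
  obtain ⟨u, hu, h⟩ := exists_isTangent (v := swapCoord v) (c := -swapCoord c)
    (A := A.image swapCoord) (hA.image _) (by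
      intro x hx
      obtain ⟨z, hz, rfl⟩ := Finset.mem_image.1 hx
      have := hc z hz
      simp only [det2, PiLp.sub_apply, PiLp.neg_apply, swapCoord_zero_coord,
        swapCoord_one_coord] at *
      linarith)
  obtain ⟨w, hw, rfl⟩ := Finset.mem_image.1 hu
  refine ⟨w, hw, fun x hx => ?_⟩
  rcases h _ (Finset.mem_image_of_mem _ hx) with h | ⟨t, ht, e⟩
  · left
    simp only [orient, det2, PiLp.sub_apply, swapCoord_zero_coord, swapCoord_one_coord] at *
    linarith
  · refine Or.inr ⟨t, ht, ?_⟩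
    have e0 := congrArg (fun z : Plane => z 0) e
    have e1 := congrArg (fun z : Plane => z 1) e
    simp only [PiLp.add_apply, PiLp.smul_apply, PiLp.sub_apply, smul_eq_mul,
      swapCoord_zero_coord, swapCoord_one_coord] at e0 e1
    apply plane_ext
    · simpa using e1
    · simpa using e0

/-- A nonzero constant term fixes the sign for small `ε`; if it vanishes, the slope keeps the value
away from zero. It serves the conditions `generic` and `compat` of a pivot. -/
lemma eventually_pos_iff_of_affine {a b : ℝ} (h : a = 0 → b ≠ 0) :
    ∀ᶠ ε : ℝ in 𝓝[>] 0, a + ε * b ≠ 0 ∧ (0 < a + ε * b → 0 ≤ a) := by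
  have hcont : Tendsto (fun ε : ℝ => a + ε * b) (𝓝[>] 0) (𝓝 a) := by
    have : Continuous fun ε : ℝ => a + ε * b := by fun_prop
    have h1 := (this.tendsto 0).mono_left (nhdsWithin_le_nhds (s := Set.Ioi 0))
    simpa using h1
  rcases lt_trichotomy a 0 with ha | ha | ha
  · filter_upwards [hcont.eventually_lt_const ha] with ε hε
    exact ⟨hε.ne, fun h => absurd h (not_lt.2 hε.le)⟩
  · filter_upwards [self_mem_nhdsWithin] with ε hε
    have hε : 0 < ε := hε
    rw [ha, zero_add]
    exact ⟨mul_ne_zero hε.ne' (h ha), fun _ => le_rfl⟩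
  · filter_upwards [hcont.eventually_const_lt ha] with ε hε
    exact ⟨hε.ne', fun _ => ha.le⟩

lemma collinear_of_orient_eq_zero {S : Set Plane} {a b : Plane} (hab : a ≠ b)
    (h : ∀ x ∈ S, orient a b x = 0) : Collinear ℝ S := by
  rw [collinear_iff_exists_forall_eq_smul_vadd]
  refine ⟨a, b - a, fun x hx => ?_⟩
  have := exists_smul_of_det2_eq_zero (sub_ne_zero.2 hab.symm) (h x hx)
  exact ⟨_, by rw [← this]; simp⟩

lemma orient_add_smul (p e x y : Plane) (ε : ℝ) : orient (p + ε • (e - p)) x y =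
    orient p x y + ε * (orient e x y - orient p x y) := by
  simp only [orient, det2, PiLp.sub_apply, PiLp.add_apply, PiLp.smul_apply, smul_eq_mul]; ring

/-- A pivot on the edge of the convex hull that joins `p` and `a`. -/
lemma exists_isPivot {T : Finset Plane} {p a : Plane} (hp : p ∈ T) (hpa : p ≠ a)
    (hT : ∀ x ∈ T, 0 < orient p a x ∨ ∃ t : ℝ, 1 ≤ t ∧ x = a + t • (p - a)) :
    ∃ ε : ℝ, 0 < ε ∧ ε < 1 ∧ IsPivot T (p + ε • (a - p)) p := by
  have hpos : ∀ x y : Plane, ∀ᶠ ε : ℝ in 𝓝[>] 0, x ≠ y → 0 < orient p a x → 0 < orient p a y →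
      orient (p + ε • (a - p)) x y ≠ 0 ∧
        (0 < orient (p + ε • (a - p)) x y → 0 ≤ orient p x y) := by
    intro x y
    by_cases hxy : x = y
    · exact Eventually.of_forall fun _ h => absurd hxy h
    by_cases hx : 0 < orient p a x
    · simp only [orient_add_smul]
      refine (eventually_pos_iff_of_affine ?_).mono fun ε hε _ _ _ => hε
      -- If constant and slope both vanished, `p` and `a` would lie on the line through `x` and `y`,
      -- so that `x` would lie on the line `p a`.
      intro h0 h1
      have h2 : orient a x y = 0 := by linarith
      have hyx : y - x ≠ 0 := sub_ne_zero.2 (Ne.symm hxy)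
      have e1 := exists_smul_of_det2_eq_zero (b := p - x) hyx (by
        rw [orient_cycle] at h0
        exact h0)
      have e2 := exists_smul_of_det2_eq_zero (b := a - x) hyx (by
        rw [orient_cycle] at h2
        exact h2)
      have : orient p a x = 0 := by
        rw [orient_cycle, orient_cycle, orient, e1, e2, det2_smul_left, det2_smul_right,
          det2_self, mul_zero, mul_zero]
      linarith
    · exact Eventually.of_forall fun _ _ h => absurd h hx
  have hall : ∀ᶠ ε : ℝ in 𝓝[>] 0, ∀ x ∈ T, ∀ y ∈ T, x ≠ y → 0 < orient p a x → 0 < orient p a y →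
      orient (p + ε • (a - p)) x y ≠ 0 ∧
        (0 < orient (p + ε • (a - p)) x y → 0 ≤ orient p x y) :=
    (Finset.eventually_all T).2 fun x _ => (Finset.eventually_all T).2 fun y _ => hpos x y
  obtain ⟨ε, hε, hε0, hε1⟩ := (hall.and ((eventually_mem_nhdsWithin (a := (0 : ℝ))).and
    (Ioo_mem_nhdsGT one_pos))).exists
  have hε0 : 0 < ε := hε0
  have hε1 : ε < 1 := hε1.2
  have scale : ∀ x, orient p (p + ε • (a - p)) x = ε * orient p a x := by
    intro x
    simp only [orient, det2, PiLp.sub_apply, PiLp.add_apply, PiLp.smul_apply, smul_eq_mul]; ring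
  have iff : ∀ x, 0 < orient p (p + ε • (a - p)) x → 0 < orient p a x := by
    intro x hx
    rw [scale] at hx
    exact (pos_iff_pos_of_mul_pos hx).1 hε0
  refine ⟨ε, hε0, hε1, hp, ?_, ?_, ?_, ?_⟩
  · intro h
    have : ε • (a - p) = 0 := by simpa using h.symm
    exact hpa (sub_eq_zero.1 ((smul_eq_zero.1 this).resolve_left hε0.ne')).symm
  · intro x hx
    rcases hT x hx with h | ⟨t, ht, e⟩
    · left
      rw [scale]
      positivity
    · right
      refine ⟨1 + (t - 1) / ε, ?_, ?_⟩
      · have : 0 ≤ (t - 1) / ε := div_nonneg (by linarith) hε0.le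
        linarith
      · have e1 : p - (p + ε • (a - p)) = (-ε) • (a - p) := by module
        have e2 : (1 + (t - 1) / ε) * -ε = 1 - t - ε := by field_simp; ring
        rw [e1, smul_smul, e2, e]
        module
  · intro x hx y hy hxy h1 h2
    exact (hε x hx y hy hxy (iff x h1) (iff y h2)).1
  · intro x hx y hy h1 h2 h3
    have hxy : x ≠ y := by
      rintro rfl
      simp at h3
    exact (hε x hx y hy hxy (iff x h1) (iff y h2)).2 h3

/-- Every set of `n` points that are not on one line has a polygonalization with at most `n / 2`
reflex vertices. -/
lemma exists_isPolygonalization_reflexCount_le {S : Finset Plane}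
    (hS : ¬Collinear ℝ (S : Set Plane)) :
    ∃ (n : ℕ) (P : Polygon Plane n), P.IsPolygonalization S ∧ P.reflexCount ≤ S.card / 2 := by
  classical
  have hne : S.Nonempty := by
    by_contra h
    rw [Finset.not_nonempty_iff_eq_empty] at h
    exact hS (by simp [h, collinear_empty])
  obtain ⟨a, ha, hmax⟩ := S.exists_max_image (fun x => dotp (x - 0) (x - 0)) hne
  have hext : ∀ x ∈ S.erase a, dotp (a - 0) x < dotp (a - 0) a := fun x hx =>
    dotp_farthest (Finset.ne_of_mem_erase hx) (hmax x (Finset.mem_of_mem_erase hx))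
  have hTne : (S.erase a).Nonempty := by
    by_contra h
    rw [Finset.not_nonempty_iff_eq_empty, Finset.erase_eq_empty_iff] at h
    rcases h with h | h
    · exact hS (by simp [h, collinear_empty])
    · exact hS (by simp [h, collinear_singleton])
  obtain ⟨p, hp, hT⟩ := exists_right_tangent (v := a) (c := perp (a - 0)) hTne fun x hx => by
    rw [det2_perp_left, dotp_sub_right]
    linarith [hext x hx]
  have hpa : p ≠ a := Finset.ne_of_mem_erase hp
  obtain ⟨ε, hε0, hε1, hpiv⟩ := exists_isPivot hp hpa hT
  obtain ⟨z, hz, hz0⟩ : ∃ z ∈ S.erase a, 0 < orient p a z := by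
    by_contra! h
    refine hS (collinear_of_orient_eq_zero hpa fun x hx => ?_)
    by_cases hxa : x = a
    · rw [hxa, orient_right]
    · have hx' := Finset.mem_erase.2 ⟨hxa, hx⟩
      rcases hT x hx' with h1 | ⟨t, _, e⟩
      · exact absurd h1 (not_lt.2 (h x hx'))
      · rw [e, orient_line]
        simp
  have scale : ∀ x, orient p (p + ε • (a - p)) x = ε * orient p a x := by
    intro x
    simp only [orient, det2, PiLp.sub_apply, PiLp.add_apply, PiLp.smul_apply, smul_eq_mul]; ring
  have scale' : ∀ x, orient (p + ε • (a - p)) a x = (1 - ε) * orient p a x := by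
    intro x
    simp only [orient, det2, PiLp.sub_apply, PiLp.add_apply, PiLp.smul_apply, smul_eq_mul]; ring
  obtain ⟨l, hl, hr⟩ := (hpiv.exists_path (S.erase a) (Finset.Subset.refl _) hp).1 a
    (fun x _ hx => by
      rw [scale] at hx
      rw [scale']
      have := (pos_iff_pos_of_mul_pos hx).1 hε0
      exact mul_pos (by linarith) this)
    (Or.inr ⟨z, hz, by rw [scale]; positivity⟩)
  have hmem : ∀ x, x ∈ a :: l ↔ x ∈ S := by
    intro x
    rw [List.mem_cons, hl.mem_iff, Finset.mem_erase]
    by_cases hxa : x = a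
    · simp [hxa, ha]
    · simp [hxa]
  have hnd : (a :: l).Nodup := List.nodup_cons.2 ⟨fun h => by simp [hl.mem_iff] at h, hl.nodup⟩
  have hlen : (a :: l).length = S.card := by
    rw [← List.toFinset_card_of_nodup hnd]
    congr 1
    ext x
    rw [List.mem_toFinset, hmem]
  have hcard : 3 ≤ S.card := by
    have hpz : p ≠ z := by
      rintro rfl
      simp at hz0
    have hza : z ≠ a := Finset.ne_of_mem_erase hz
    rw [← Finset.card_eq_three.2 ⟨p, z, a, hpz, hpa, hza, rfl⟩]
    apply Finset.card_le_card
    intro x hx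
    simp only [Finset.mem_insert, Finset.mem_singleton] at hx
    rcases hx with rfl | rfl | rfl
    exacts [Finset.mem_of_mem_erase hp, Finset.mem_of_mem_erase hz, ha]
  have hget : ∀ k, 0 < k → k < S.card → (a :: l).getD k 0 ∈ S.erase a := by
    intro k h0 hk
    obtain ⟨k, rfl⟩ : ∃ m, k = m + 1 := ⟨k - 1, by omega⟩
    have hk' : k < l.length := by
      rw [List.length_cons] at hlen
      omega
    rw [List.getD_cons_succ, List.getD_eq_getElem _ _ hk', ← hl.mem_iff]
    exact List.getElem_mem hk'
  have hlast : (a :: l).getD (S.card - 1) 0 = p := by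
    have h1 := hl.last
    rw [List.getLast?_eq_getElem?] at h1
    have h2 : S.card - 1 = (l.length - 1) + 1 := by
      rw [List.length_cons] at hlen
      omega
    rw [h2, List.getD_cons_succ, List.getD_eq_getElem?_getD, h1]
    rfl
  obtain ⟨hccw, hcount⟩ := isCcw_of_peels hlen hcard hnd hl.peels (fun k h0 hk => by
    rw [hlast]
    exact hT _ (hget k h0 hk)) ⟨a - 0, fun k h0 hk => hext _ (hget k h0 hk)⟩
  refine ⟨_, _, ⟨hccw.isSimple, ?_⟩, hcount.trans (hr.trans ?_)⟩
  · ext x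
    rw [Finset.mem_coe, ← hmem, List.mem_iff_getElem]
    constructor
    · rintro ⟨i, rfl⟩
      have hi : (i : ℕ) < (a :: l).length := by rw [hlen]; exact i.2
      exact ⟨i, hi, (List.getD_eq_getElem _ _ hi).symm⟩
    · rintro ⟨i, hi, rfl⟩
      exact ⟨⟨i, by rw [← hlen]; exact hi⟩, List.getD_eq_getElem _ _ hi⟩
  -- One point is used as the start, so the bound is `((n - 1) + 1) / 2 = n / 2`.
  · have h1 := innerCount_le_card (p + ε • (a - p)) a (S.erase a)
    rw [Finset.card_erase_of_mem ha] at h1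
    omega

lemma worstCaseReflexivity_le (n : ℕ) : worstCaseReflexivity n ≤ ((n / 2 : ℕ) : ℕ∞) := by
  refine iSup_le fun S => iSup_le fun hn => iSup_le fun hS => ?_
  obtain ⟨m, P, hP, hle⟩ := exists_isPolygonalization_reflexCount_le hS
  refine (iInf_le_of_le m (iInf_le_of_le P (iInf_le _ hP))).trans ?_
  rw [← hn]
  exact_mod_cast hle

/-! ### Right turns behind an unused hull edge -/

namespace Polygon

variable {n : ℕ} {P : Polygon Plane n}

lemma exists_iterate_eq (i j : Fin n) : ∃ t, (finRotate n)^[t] i = j := by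
  refine forall_of_finRotate (p := fun j => ∃ t, (finRotate n)^[t] i = j) ?_ ⟨0, rfl⟩ j
  rintro _ ⟨t, rfl⟩
  exact ⟨t + 1, Function.iterate_succ_apply' _ _ _⟩

/-- If the path from `i` to `j` is closed by an edge of the convex hull, then the hull vertices of
the resulting polygon are reflex vertices of the original polygon. -/
lemma IsCcw.exists_turn_neg_between (h : P.IsCcw) {i j : Fin n} (hi : P.IsExtreme i)
    (hij : i ≠ j) (hlid : ∀ l, l ≠ i → l ≠ j → 0 < orient (P i) (P j) (P l))
    (hnext : finRotate n i ≠ j) :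
    ∃ t, P.turn ((finRotate n)^[t] i) < 0 ∧
      ∀ t', 0 < t' → t' ≤ t → ¬P.IsExtreme ((finRotate n)^[t'] i) := by
  classical
  have hs := h.isSimple
  have hex := exists_iterate_eq i j
  set s := Nat.find hex
  have hsj : (finRotate n)^[s] i = j := Nat.find_spec hex
  have hmin : ∀ t < s, (finRotate n)^[t] i ≠ j := fun t ht => Nat.find_min hex ht
  have hs2 : 2 ≤ s := by
    by_contra hlt
    have : s = 0 ∨ s = 1 := by omega
    rcases this with h0 | h0
    · rw [h0] at hsj
      exact hij hsj
    · rw [h0] at hsj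
      exact hnext hsj
  have key : ∀ a b, a < b → b ≤ s → (finRotate n)^[a] i ≠ (finRotate n)^[b] i := by
    intro a b hab hb he
    have h1 := congrArg (finRotate n)^[s - b] he
    rw [← Function.iterate_add_apply, ← Function.iterate_add_apply, Nat.sub_add_cancel hb,
      hsj] at h1
    exact hmin _ (by omega) h1
  have hinj' : ∀ a ≤ s, ∀ b ≤ s, (finRotate n)^[a] i = (finRotate n)^[b] i → a = b := by
    intro a ha b hb he
    rcases lt_trichotomy a b with hab | hab | hab
    · exact absurd he (key a b hab hb)
    · exact hab
    · exact absurd he.symm (key b a hab ha)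
  set f : ℕ → Plane := fun t => P ((finRotate n)^[t] i)
  have hinj : ∀ a ≤ s, ∀ b ≤ s, f a = f b → a = b := fun a ha b hb he =>
    hinj' a ha b hb (hs.2.1 he)
  have hf0 : f 0 = P i := rfl
  have hfs : f s = P j := by
    simp only [f]
    rw [hsj]
  have hsucc : ∀ a, f (a + 1) = P (finRotate n ((finRotate n)^[a] i)) := fun a => by
    simp only [f]
    rw [Function.iterate_succ_apply']
  have hpos : ∀ a, 0 < a → a < s → 0 < orient (f 0) (f s) (f a) := by
    intro a h0 ha
    rw [hfs]
    refine hlid _ ?_ (hmin a ha)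
    intro he
    have := hinj' a ha.le 0 (by omega) he
    omega
  -- The path inherits simplicity from the polygon, and it meets the closing edge only at its ends
  -- because its inner vertices lie strictly to the left.
  have hZ : (ofFun f (s + 1)).IsSimple := by
    refine isSimple_ofFun (by omega) (fun a ha b hb => hinj a (by omega) b (by omega)) ?_ ?_
    · intro a b hab hb y h1 h2
      rw [hsucc] at h1 h2
      obtain ⟨e1, e2⟩ := hs.inter (fun he => by
        have := hinj' a (by omega) b (by omega) he
        omega) h1 h2
      rw [← hsucc] at e1 e2
      rcases e1 with e1 | e1 <;> rcases e2 with e2 | e2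
      · have := hinj a (by omega) b (by omega) (e1.symm.trans e2)
        omega
      · have := hinj a (by omega) (b + 1) (by omega) (e1.symm.trans e2)
        omega
      · exact ⟨e1, (hinj (a + 1) (by omega) b (by omega) (e1.symm.trans e2)).symm⟩
      · have := hinj (a + 1) (by omega) (b + 1) (by omega) (e1.symm.trans e2)
        omega
    · intro a ha y h1 h2
      rw [Nat.add_sub_cancel] at h2 ⊢
      have h0 : orient (f 0) (f s) y = 0 := by
        rw [segment_eq_image'] at h2
        obtain ⟨θ, _, rfl⟩ := h2
        simp [orient_line]
      rw [segment_eq_image'] at h1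
      obtain ⟨θ, hθ, rfl⟩ := h1
      simp only [orient_line] at h0
      have hθ0 := hθ.1
      have hθ1 : 0 ≤ 1 - θ := by linarith [hθ.2]
      rcases Nat.eq_zero_or_pos a with rfl | ha0
      · left
        rw [orient_left, mul_zero, zero_add] at h0
        have := (mul_eq_zero.1 h0).resolve_right (hpos (0 + 1) (by omega) (by omega)).ne'
        simp [this]
      · have ha1 := hpos a ha0 (by omega)
        by_cases has : a + 1 = s
        · right
          rw [has, orient_right, mul_zero, add_zero] at h0
          have := (mul_eq_zero.1 h0).resolve_right ha1.ne'
          have hθ : θ = 1 := by linarith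
          simp [hθ, has]
        · exfalso
          have ha2 := hpos (a + 1) (by omega) (by omega)
          have : 0 < (1 - θ) * orient (f 0) (f s) (f a) + θ * orient (f 0) (f s) (f (a + 1)) := by
            rcases hθ0.eq_or_lt with he | hlt
            · rw [← he]
              linarith
            · have := mul_pos hlt ha2
              have := mul_nonneg hθ1 ha1.le
              linarith
          linarith
  have hext : ∀ t (ht : t < s + 1), P.IsExtreme ((finRotate n)^[t] i) →
      (ofFun f (s + 1)).IsExtreme ⟨t, ht⟩ := by
    rintro t ht ⟨c, hc⟩
    refine ⟨c, fun l hl => hc _ fun he => hl (Fin.ext ?_)⟩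
    exact hinj' l (by have := l.2; omega) t (by omega) he
  -- The vertex `i` stays extreme, and coming back along the closing edge one turns right there.
  have hcw : (ofFun f (s + 1)).IsCw := by
    refine hZ.isCw (hext 0 (by omega) hi) ?_
    rw [ofFun_turn_first (by omega) rfl, Nat.add_sub_cancel]
    have := hpos 1 (by omega) (by omega)
    have e : orient (f s) (f 0) (f 1) = -orient (f 0) (f s) (f 1) := by
      simp only [orient, det2, PiLp.sub_apply]; ring
    linarith
  have hturn : ∀ t (ht : t < s + 1), 0 < t → t < s →
      (ofFun f (s + 1)).turn ⟨t, ht⟩ = P.turn ((finRotate n)^[t] i) := by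
    intro t ht h0 hts
    obtain ⟨t, rfl⟩ : ∃ m, t = m + 1 := ⟨t - 1, by omega⟩
    rw [ofFun_turn h0 (by simpa using hts)]
    simp only [Nat.add_sub_cancel]
    rw [hsucc (t + 1), turn, Function.iterate_succ_apply', Equiv.symm_apply_apply]
    simp only [f, Function.iterate_succ_apply', orient, det2, PiLp.sub_apply]
    ring
  -- the vertex farthest from a point far away from the closing edge
  have ho := hpos 1 (by omega) (by omega)
  set d := f s - f 0
  have hd : 0 < dotp d d := (plane_ne_zero_iff _).1 (by
    intro h0
    simp only [d] at h0
    have := hinj s le_rfl 0 (by omega) (sub_eq_zero.1 h0)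
    omega)
  -- The centre lies beyond the closing edge. With this `R` its squared distance to `f 1` is at
  -- least `(2 + R²)|d|²`, against `(1/4 + R²)|d|²` for the two ends, so a farthest vertex is not an
  -- end.
  set R := dotp d d / orient (f 0) (f s) (f 1)
  have hR : R * orient (f 0) (f s) (f 1) = dotp d d := div_mul_cancel₀ _ ho.ne'
  obtain ⟨k, hk⟩ := Finite.exists_max fun k : Fin (s + 1) =>
    dotp (ofFun f (s + 1) k - (midpoint ℝ (f 0) (f s) - R • perp d))
      (ofFun f (s + 1) k - (midpoint ℝ (f 0) (f s) - R • perp d))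
  have hkext := isExtreme_of_farthest hZ.2.1 hk
  have hk1 := hk ⟨1, by omega⟩
  have hfar : ∀ v, v = f 0 ∨ v = f s →
      dotp (v - (midpoint ℝ (f 0) (f s) - R • perp d))
        (v - (midpoint ℝ (f 0) (f s) - R • perp d)) <
      dotp (f 1 - (midpoint ℝ (f 0) (f s) - R • perp d))
        (f 1 - (midpoint ℝ (f 0) (f s) - R • perp d)) := by
    intro v hv
    have e1 : dotp (v - (midpoint ℝ (f 0) (f s) - R • perp d))
        (v - (midpoint ℝ (f 0) (f s) - R • perp d)) =
        dotp d d / 4 + R ^ 2 * dotp d d := by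
      rcases hv with rfl | rfl
      · simp only [d, dotp, PiLp.sub_apply, PiLp.smul_apply, smul_eq_mul, midpoint_coord,
          perp_zero_coord, perp_one_coord]
        ring
      · simp only [d, dotp, PiLp.sub_apply, PiLp.smul_apply, smul_eq_mul, midpoint_coord,
          perp_zero_coord, perp_one_coord]
        ring
    have e2 : dotp (f 1 - (midpoint ℝ (f 0) (f s) - R • perp d))
        (f 1 - (midpoint ℝ (f 0) (f s) - R • perp d)) =
        dotp (f 1 - midpoint ℝ (f 0) (f s)) (f 1 - midpoint ℝ (f 0) (f s)) +
          2 * (R * orient (f 0) (f s) (f 1)) + R ^ 2 * dotp d d := by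
      simp only [d, orient, det2, dotp, PiLp.sub_apply, PiLp.smul_apply, smul_eq_mul,
        midpoint_coord, perp_zero_coord, perp_one_coord]
      ring
    have h1 : 0 ≤ dotp (f 1 - midpoint ℝ (f 0) (f s)) (f 1 - midpoint ℝ (f 0) (f s)) := by
      exact add_nonneg (mul_self_nonneg _) (mul_self_nonneg _)
    rw [e1, e2, hR]
    linarith
  have hk0 : 0 < (k : ℕ) := by
    by_contra h0
    have h0 : (k : ℕ) = 0 := by omega
    have := hfar (ofFun f (s + 1) k) (Or.inl (by rw [ofFun_apply, h0]))
    exact absurd hk1 (not_le.2 this)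
  have hks : (k : ℕ) < s := by
    by_contra h0
    have h0 : (k : ℕ) = s := by have := k.2; omega
    have := hfar (ofFun f (s + 1) k) (Or.inr (by rw [ofFun_apply, h0]))
    exact absurd hk1 (not_le.2 this)
  refine ⟨k, ?_, fun t ht0 htk htext => ?_⟩
  · rw [← hturn k k.2 hk0 hks]
    exact hcw.turn_neg hkext
  -- An extreme vertex would turn left in the original polygon and right in the closed-off one, but
  -- the turns at inner vertices of the path agree.
  · have h1 := h.turn_pos htext
    rw [← hturn t (by omega) ht0 (by omega)] at h1
    have := hcw.turn_neg (hext t (by omega) htext)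
    linarith

end Polygon

/-! ### Points on a parabola and their pockets -/

/-- The points of a parabola. -/
noncomputable def hullPoint (i : ℕ) : Plane := !₂[(i : ℝ), (i : ℝ) ^ 2]

/-- A point slightly inside the edge from `hullPoint i` to `hullPoint (i + 1)`. -/
noncomputable def innerPoint (i : ℕ) : Plane := !₂[(i : ℝ) + 1 / 2, (i : ℝ) ^ 2 + i + 5 / 8]

@[simp] lemma hullPoint_zero_coord (i : ℕ) : hullPoint i 0 = i := by simp [hullPoint]

@[simp] lemma hullPoint_one_coord (i : ℕ) : hullPoint i 1 = (i : ℝ) ^ 2 := by simp [hullPoint]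

@[simp] lemma innerPoint_zero_coord (i : ℕ) : innerPoint i 0 = i + 1 / 2 := by simp [innerPoint]

@[simp] lemma innerPoint_one_coord (i : ℕ) : innerPoint i 1 = (i : ℝ) ^ 2 + i + 5 / 8 := by
  simp [innerPoint]

lemma hullPoint_injective : Function.Injective hullPoint := fun i j h => by
  have := congrArg (fun z : Plane => z 0) h
  simpa using this

lemma innerPoint_injective : Function.Injective innerPoint := fun i j h => by
  have := congrArg (fun z : Plane => z 0) h
  simpa using this

lemma hullPoint_coord_ne (i j : ℕ) : hullPoint i 0 ≠ innerPoint j 0 := by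
  rw [hullPoint_zero_coord, innerPoint_zero_coord]
  intro h
  have h1 : ((2 * i : ℕ) : ℝ) = ((2 * j + 1 : ℕ) : ℝ) := by
    push_cast
    linarith
  have := Nat.cast_injective h1
  omega

/-- The set of all points `hullPoint i` and `innerPoint i`. -/
def parabolaSet : Set Plane := Set.range hullPoint ∪ Set.range innerPoint

/-- The amount by which `z` lies above the line of slope `c` through `innerPoint i`. -/
noncomputable def above (i : ℕ) (c : ℝ) (z : Plane) : ℝ :=
  z 1 - ((i : ℝ) ^ 2 + i + 5 / 8) - c * (z 0 - (i + 1 / 2))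

lemma above_combo (i : ℕ) (c : ℝ) (x y : Plane) {s t : ℝ} (h : s + t = 1) :
    above i c (s • x + t • y) = s * above i c x + t * above i c y := by
  have hs : s = 1 - t := by linarith
  subst hs
  simp only [above, PiLp.add_apply, PiLp.smul_apply, smul_eq_mul]
  ring

lemma mul_sub_one_nonneg (a b : ℕ) : 0 ≤ ((a : ℝ) - b) * ((a : ℝ) - b - 1) := by
  have : 0 ≤ ((a : ℤ) - b) * ((a : ℤ) - b - 1) := by
    rcases le_or_gt ((a : ℤ) - b) 0 with h | h
    · exact mul_nonneg_of_nonpos_of_nonpos h (by omega)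
    · exact mul_nonneg h.le (by omega)
  exact_mod_cast this

lemma one_le_sq_of_ne {a b : ℕ} (h : a ≠ b) : 1 ≤ ((a : ℝ) - b) ^ 2 := by
  have h0 : (a : ℤ) - b ≠ 0 := by omega
  have : (1 : ℤ) ≤ ((a : ℤ) - b) ^ 2 := by
    have := sq_pos_of_ne_zero h0
    omega
  exact_mod_cast this

/-- The other points lie above the two lines. -/
lemma above_nonneg {i : ℕ} {z : Plane} (hz : z ∈ parabolaSet) (h0 : z ≠ hullPoint i)
    (h1 : z ≠ hullPoint (i + 1)) : 0 ≤ above i (2 * i) z ∧ 0 ≤ above i (2 * i + 2) z := by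
  rcases hz with ⟨j, rfl⟩ | ⟨j, rfl⟩
  · have e0 := one_le_sq_of_ne (a := j) (b := i) fun h => h0 (by rw [h])
    have e1 := one_le_sq_of_ne (a := j) (b := i + 1) fun h => h1 (by rw [h])
    simp only [above, hullPoint_zero_coord, hullPoint_one_coord]
    push_cast at e1
    constructor <;> nlinarith
  · have e0 := mul_sub_one_nonneg (j + 1) i
    have e1 := mul_sub_one_nonneg j i
    simp only [above, innerPoint_zero_coord, innerPoint_one_coord]
    push_cast at e0
    constructor <;> nlinarith

lemma orient_hullPoint_pos {i : ℕ} {z : Plane} (hz : z ∈ parabolaSet) (h0 : z ≠ hullPoint i)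
    (h1 : z ≠ hullPoint (i + 1)) : 0 < orient (hullPoint i) (hullPoint (i + 1)) z := by
  simp only [orient, det2, PiLp.sub_apply, hullPoint_zero_coord, hullPoint_one_coord]
  push_cast
  rcases hz with ⟨j, rfl⟩ | ⟨j, rfl⟩
  · have e := mul_sub_one_nonneg j i
    have e0 : (j : ℝ) - i ≠ 0 := by
      rw [sub_ne_zero]
      exact fun h => h0 (by rw [Nat.cast_injective h])
    have e1 : (j : ℝ) - i - 1 ≠ 0 := by
      rw [sub_sub, sub_ne_zero]
      intro h
      have : j = i + 1 := by exact_mod_cast h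
      exact h1 (by rw [this])
    have := lt_of_le_of_ne e (mul_ne_zero e0 e1).symm
    simp only [hullPoint_zero_coord, hullPoint_one_coord]
    nlinarith
  · simp only [innerPoint_zero_coord, innerPoint_one_coord]
    nlinarith [sq_nonneg ((j : ℝ) - i)]

/-- The functional has the tangent of the parabola at `hullPoint i` as a level line. -/
lemma hullPoint_extreme {i : ℕ} {z : Plane} (hz : z ∈ parabolaSet) (h0 : z ≠ hullPoint i) :
    dotp !₂[2 * (i : ℝ), -1] z < dotp !₂[2 * (i : ℝ), -1] (hullPoint i) := by
  rcases hz with ⟨j, rfl⟩ | ⟨j, rfl⟩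
  · have e0 := one_le_sq_of_ne (a := j) (b := i) fun h => h0 (by rw [h])
    simp [dotp]
    nlinarith
  · simp [dotp]
    nlinarith [sq_nonneg ((j : ℝ) - i + 1 / 2)]

/-- The open triangle below `innerPoint i`. -/
def pocket (i : ℕ) : Set Plane :=
  {z | 0 < orient (hullPoint i) (hullPoint (i + 1)) z ∧
    3 * above i (2 * i) z + 5 * above i (2 * i + 2) z < 0 ∧
    5 * above i (2 * i) z + 3 * above i (2 * i + 2) z < 0}

lemma convex_pocket (i : ℕ) : Convex ℝ (pocket i) := by
  rintro x ⟨x1, x2, x3⟩ y ⟨y1, y2, y3⟩ s t hs ht hst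
  have pos : ∀ a b : ℝ, 0 < a → 0 < b → 0 < s * a + t * b := by
    intro a b ha hb
    rcases hs.eq_or_lt with rfl | hs
    · have : t = 1 := by linarith
      simpa [this]
    · have := mul_pos hs ha
      have := mul_nonneg ht hb.le
      linarith
  refine ⟨?_, ?_, ?_⟩
  · rw [orient_combo _ _ x y hst]
    exact pos _ _ x1 y1
  · rw [above_combo i _ x y hst, above_combo i _ x y hst]
    have := pos _ _ (neg_pos.2 x2) (neg_pos.2 y2)
    linarith
  · rw [above_combo i _ x y hst, above_combo i _ x y hst]
    have := pos _ _ (neg_pos.2 x3) (neg_pos.2 y3)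
    linarith

/-- The weights 3 and 5 make the two sides of the pocket pass through the hull points: the first
form vanishes at `hullPoint i`, the second at `hullPoint (i + 1)`. Both are nonnegative at all
further points, so a segment with an end other than these two violates one of the strict
inequalities; the hull edge violates the orientation condition. -/
lemma notMem_pocket_of_mem_segment {i : ℕ} {a b z : Plane} (ha : a ∈ parabolaSet)
    (hb : b ∈ parabolaSet) (hz : z ∈ segment ℝ a b) : z ∉ pocket i := by
  rintro ⟨z1, z2, z3⟩
  obtain ⟨s, t, hs, ht, hst, rfl⟩ := hz
  rw [orient_combo _ _ a b hst] at z1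
  rw [above_combo i _ a b hst, above_combo i _ a b hst] at z2 z3
  have x0 : above i (2 * i) (hullPoint i) = -5 / 8 := by simp [above]; ring
  have x1 : above i (2 * i + 2) (hullPoint i) = 3 / 8 := by simp [above]; ring
  have y0 : above i (2 * i) (hullPoint (i + 1)) = 3 / 8 := by simp [above]; ring
  have y1 : above i (2 * i + 2) (hullPoint (i + 1)) = -5 / 8 := by simp [above]; ring
  have key : ∀ c : Plane, c ∈ parabolaSet → c = hullPoint i ∨ c = hullPoint (i + 1) ∨
      (0 ≤ above i (2 * i) c ∧ 0 ≤ above i (2 * i + 2) c) := by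
    intro c hc
    by_cases h0 : c = hullPoint i
    · exact Or.inl h0
    · by_cases h1 : c = hullPoint (i + 1)
      · exact Or.inr (Or.inl h1)
      · exact Or.inr (Or.inr (above_nonneg hc h0 h1))
  rcases key a ha with rfl | rfl | ⟨a1, a2⟩ <;> rcases key b hb with rfl | rfl | ⟨b1, b2⟩ <;>
    (try simp only [x0, x1, y0, y1, orient_left, orient_right, mul_zero, add_zero,
      lt_self_iff_false] at z1 z2 z3) <;> nlinarith

lemma germ_pocket_innerPoint (i : ℕ) : Germ (· ∈ pocket i) (innerPoint i) !₂[0, -1] := by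
  filter_upwards [Ioo_mem_nhdsGT (show (0 : ℝ) < 1 / 8 by norm_num)] with t ht
  obtain ⟨h0, h1⟩ := ht
  refine ⟨?_, ?_, ?_⟩
  · simp [orient, det2]
    nlinarith
  · simp [above]
    nlinarith
  · simp [above]
    nlinarith

/-- Together with `germ_pocket_innerPoint` this makes the pocket a bridge that carries the inner
side of the hull edge to the region just below the inner point. -/
lemma germ_pocket_midpoint (i : ℕ) : Germ (· ∈ pocket i)
    (midpoint ℝ (hullPoint i) (hullPoint (i + 1)))
    (perp (hullPoint (i + 1) - hullPoint i)) := by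
  have hcont : Tendsto (fun t : ℝ => t * (8 + (16 * i + 10) * (2 * i + 1))) (𝓝[>] 0) (𝓝 0) := by
    have : Continuous fun t : ℝ => t * (8 + (16 * (i : ℝ) + 10) * (2 * i + 1)) := by fun_prop
    have h1 := (this.tendsto 0).mono_left (nhdsWithin_le_nhds (s := Set.Ioi 0))
    simpa using h1
  filter_upwards [eventually_mem_nhdsWithin, hcont.eventually_lt_const one_pos] with t ht ht1
  have ht : 0 < t := ht
  have hi : (0 : ℝ) ≤ i := Nat.cast_nonneg i
  refine ⟨?_, ?_, ?_⟩
  · have : orient (hullPoint i) (hullPoint (i + 1)) (midpoint ℝ (hullPoint i) (hullPoint (i + 1)) +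
        t • perp (hullPoint (i + 1) - hullPoint i)) = t * (1 + (2 * i + 1) ^ 2) := by
      simp [orient, det2, midpoint_coord]
      ring
    rw [this]
    positivity
  · simp [above, midpoint_coord]
    nlinarith
  · simp [above, midpoint_coord]
    nlinarith [mul_nonneg ht.le hi]

lemma eq_innerPoint {i : ℕ} {z : Plane} (hz : z ∈ parabolaSet) (h : z 0 = innerPoint i 0) :
    z = innerPoint i := by
  rcases hz with ⟨j, rfl⟩ | ⟨j, rfl⟩
  · exact absurd h (hullPoint_coord_ne j i)
  · have : j = i := by simpa using h
    rw [this]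

namespace Polygon

variable {n : ℕ} {P : Polygon Plane n}

/-- An inner point is reflex if its pocket is cut off. -/
lemma IsCcw.turn_innerPoint_neg (h : P.IsCcw) (hn : 4 ≤ n)
    (hP : Set.range P.vertices ⊆ parabolaSet) {i : ℕ} {u v : Fin n} (hu : P u = hullPoint i)
    (hu' : P (finRotate n u) = hullPoint (i + 1)) (hv : P v = innerPoint i) : P.turn v < 0 := by
  have hmem : ∀ j, P j ∈ parabolaSet := fun j => hP ⟨j, rfl⟩
  have hinj : ∀ {j l}, P j = P l → j = l := fun h1 => h.isSimple.2.1 h1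
  by_contra hge
  have hpocket : pocket i ⊆ (P.boundary ℝ)ᶜ := by
    intro z hz hb
    obtain ⟨j, hj⟩ := (P.mem_boundary_iff z).1 hb
    exact notMem_pocket_of_mem_segment (hmem _) (hmem _) hj hz
  have hside : Germ (fun x => P.winding x ≠ 0) (innerPoint i) !₂[0, -1] := by
    refine (P.locConst_winding fun w => w ≠ 0).germ_of_germ hpocket
      (convex_pocket i).isPreconnected (germ_pocket_midpoint i) (germ_pocket_innerPoint i) ?_
    have := h.winding_ne_zero_left u
    rwa [LeftSide, hu, hu'] at this
  set b := P ((finRotate n).symm v)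
  set a := P (finRotate n v)
  have hne1 : b 0 ≠ innerPoint i 0 := by
    intro h1
    have h2 := hinj ((eq_innerPoint (hmem _) h1).trans hv.symm)
    have h3 := finRotate_ne_self (by omega) ((finRotate n).symm v)
    rw [Equiv.apply_symm_apply] at h3
    exact h3 h2.symm
  have hne2 : a 0 ≠ innerPoint i 0 := by
    intro h1
    exact finRotate_ne_self (by omega) v (hinj ((eq_innerPoint (hmem _) h1).trans hv.symm))
  have hdet : det2 (b - innerPoint i) (a - innerPoint i) ≤ 0 := by
    rw [not_lt, turn, hv] at hge
    have : det2 (b - innerPoint i) (a - innerPoint i) =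
        -det2 (innerPoint i - b) (a - innerPoint i) := by
      rw [← det2_neg_left, neg_sub]
    rw [this]
    linarith
  -- Without a right turn the outer sector has angle at least `π` and must avoid the downward
  -- direction, which is inner. This forces `b` to the right and `a` to the left of the inner point.
  have hsector : ¬(0 < det2 (b - innerPoint i) !₂[0, -1] ∨
      0 < det2 !₂[0, -1] (a - innerPoint i)) := by
    intro hd
    have houter := h.germ_isOuter (i := v) (d := !₂[0, -1]) (Or.inr (by
      rw [hv]
      exact ⟨hdet, hd⟩))
    rw [hv] at houter
    obtain ⟨t, h1, h2⟩ := (houter.and hside).exists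
    exact h2 h1.2
  rw [not_or, not_lt, not_lt] at hsector
  obtain ⟨hb0, ha0⟩ := hsector
  have e1 : det2 (b - innerPoint i) !₂[0, -1] = -(b 0 - innerPoint i 0) := by
    simp [det2]
  have e2 : det2 !₂[0, -1] (a - innerPoint i) = a 0 - innerPoint i 0 := by
    simp [det2]
  rw [e1] at hb0
  rw [e2] at ha0
  have hb0' := lt_of_le_of_ne (neg_nonpos.1 hb0) (sub_ne_zero.2 hne1).symm
  have ha0' := lt_of_le_of_ne ha0 (sub_ne_zero.2 hne2)
  simp only [det2, PiLp.sub_apply, innerPoint_zero_coord, innerPoint_one_coord] at hdet hb0' ha0'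
  have hbi : b ≠ hullPoint i := by
    intro he
    rw [he, hullPoint_zero_coord] at hb0'
    linarith
  have hai : a ≠ hullPoint (i + 1) := by
    intro he
    rw [he, hullPoint_zero_coord] at ha0'
    push_cast at ha0'
    linarith
  by_cases hb : b = hullPoint (i + 1)
  · by_cases ha : a = hullPoint i
    -- Both neighbours are ends of the hull edge, so the polygon closes up as a triangle, against `4
    -- ≤ n`. In the remaining cases the slopes force a right turn.
    · have h1 : finRotate n v = u := hinj (ha.trans hu.symm)
      have h2 : (finRotate n).symm v = finRotate n u := hinj (hb.trans hu'.symm)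
      rw [Equiv.symm_apply_eq, ← h1] at h2
      have h3 := congrArg Fin.val h2
      simp only [finRotate_val] at h3
      have := v.2
      split_ifs at h3 <;> omega
    · have h1 := (above_nonneg (hmem _) ha hai).1
      rw [above] at h1
      rw [hb, hullPoint_zero_coord, hullPoint_one_coord] at hdet
      push_cast at hdet
      nlinarith
  · have h1 := (above_nonneg (hmem _) hbi hb).2
    rw [above] at h1
    have h3 := mul_pos hb0' (neg_pos.2 ha0')
    have h4 := mul_nonneg h1 (neg_pos.2 ha0').le
    by_cases ha : a = hullPoint i
    · rw [ha, hullPoint_zero_coord, hullPoint_one_coord] at hdet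
      linarith
    · have h2 := (above_nonneg (hmem _) ha hai).1
      rw [above] at h2
      have := mul_nonneg h2 hb0'.le
      nlinarith

end Polygon

/-! ### The lower bound -/

lemma orient_eq_zero_of_collinear {S : Set Plane} (h : Collinear ℝ S) {a b c : Plane} (ha : a ∈ S)
    (hb : b ∈ S) (hc : c ∈ S) : orient a b c = 0 := by
  obtain ⟨v, hv⟩ := (collinear_iff_of_mem ha).1 h
  obtain ⟨s, rfl⟩ := hv b hb
  obtain ⟨t, rfl⟩ := hv c hc
  simp [orient, det2_smul_left, det2_smul_right]

open Classical in
/-- `m` points of a parabola and `k` points slightly inside the edges of their convex hull. -/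
noncomputable def pocketSet (m k : ℕ) : Finset Plane :=
  (Finset.range m).image hullPoint ∪ (Finset.range k).image innerPoint

lemma pocketSet_subset (m k : ℕ) : (pocketSet m k : Set Plane) ⊆ parabolaSet := by
  classical
  intro z hz
  rw [pocketSet, Finset.coe_union, Finset.coe_image, Finset.coe_image] at hz
  rcases hz with ⟨i, _, rfl⟩ | ⟨i, _, rfl⟩
  · exact Or.inl ⟨i, rfl⟩
  · exact Or.inr ⟨i, rfl⟩

lemma hullPoint_mem_pocketSet {m k i : ℕ} (hi : i < m) : hullPoint i ∈ pocketSet m k := by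
  classical
  exact Finset.mem_union_left _ (Finset.mem_image_of_mem _ (Finset.mem_range.2 hi))

lemma innerPoint_mem_pocketSet {m k i : ℕ} (hi : i < k) : innerPoint i ∈ pocketSet m k := by
  classical
  exact Finset.mem_union_right _ (Finset.mem_image_of_mem _ (Finset.mem_range.2 hi))

lemma card_pocketSet (m k : ℕ) : (pocketSet m k).card = m + k := by
  classical
  rw [pocketSet, Finset.card_union_of_disjoint, Finset.card_image_of_injective _
    hullPoint_injective, Finset.card_image_of_injective _ innerPoint_injective,
    Finset.card_range, Finset.card_range]
  rw [Finset.disjoint_left]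
  intro z hz hz'
  obtain ⟨i, _, rfl⟩ := Finset.mem_image.1 hz
  obtain ⟨j, _, h⟩ := Finset.mem_image.1 hz'
  exact hullPoint_coord_ne i j (by rw [h])

lemma not_collinear_pocketSet {m k : ℕ} (hm : 3 ≤ m) :
    ¬Collinear ℝ (pocketSet m k : Set Plane) := by
  intro h
  have := orient_eq_zero_of_collinear h (a := hullPoint 0) (b := hullPoint 1) (c := hullPoint 2)
    (hullPoint_mem_pocketSet (by omega)) (hullPoint_mem_pocketSet (by omega))
    (hullPoint_mem_pocketSet (by omega))
  have h1 := orient_hullPoint_pos (i := 0) (z := hullPoint 2) (Or.inl ⟨2, rfl⟩)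
    (fun h => by simpa using hullPoint_injective h) (fun h => by simpa using hullPoint_injective h)
  exact h1.ne' this

namespace Polygon

variable {n : ℕ} {P : Polygon Plane n}

/-- Each pocket leads to a reflex vertex, which comes from at most two pockets. -/
lemma IsCcw.le_reflexCount {m k : ℕ} (h : P.IsCcw) (hkm : k < m) (h4 : 4 ≤ m + k)
    (hP : Set.range P.vertices = (pocketSet m k : Set Plane)) : k ≤ 2 * P.reflexCount := by
  classical
  have hinj : Function.Injective P.vertices := h.isSimple.2.1
  have hn : 4 ≤ n := by
    have h1 : (Finset.univ.image P.vertices).card = n := by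
      rw [Finset.card_image_of_injective _ hinj, Finset.card_univ, Fintype.card_fin]
    have h2 : Finset.univ.image P.vertices = pocketSet m k := by
      apply Finset.coe_injective
      rw [Finset.coe_image, Finset.coe_univ, Set.image_univ, hP]
    rw [h2, card_pocketSet] at h1
    omega
  have hsub : Set.range P.vertices ⊆ parabolaSet := hP ▸ pocketSet_subset m k
  have hmem : ∀ j, P j ∈ parabolaSet := fun j => hsub ⟨j, rfl⟩
  have hu : ∀ i : Fin m, ∃ j, P j = hullPoint i := fun i => by
    have : hullPoint i ∈ Set.range P.vertices := hP ▸ hullPoint_mem_pocketSet i.2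
    exact this
  have hv : ∀ i : Fin k, ∃ j, P j = innerPoint i := fun i => by
    have : innerPoint i ∈ Set.range P.vertices := hP ▸ innerPoint_mem_pocketSet i.2
    exact this
  choose u hu using hu
  choose v hv using hv
  have hinj_u : Function.Injective u := fun i j he => Fin.ext (hullPoint_injective (by
    rw [← hu, ← hu, he]))
  have hinj_v : Function.Injective v := fun i j he => Fin.ext (innerPoint_injective (by
    rw [← hv, ← hv, he]))
  have hext : ∀ i, P.IsExtreme (u i) := fun i => by
    refine ⟨!₂[2 * ((i : ℕ) : ℝ), -1], fun j hj => ?_⟩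
    rw [hu]
    refine hullPoint_extreme (hmem j) fun he => hj (hinj ?_)
    exact he.trans (hu i).symm
  set R : Finset (Fin n) := Finset.univ.filter fun j => P.turn j < 0
  have hR : P.reflexCount = R.card := by
    rw [h.reflexCount_eq, ← Set.ncard_coe_finset]
    simp [R]
  let lo : Fin k → Fin m := fun i => ⟨i, by have := i.2; omega⟩
  let hi : Fin k → Fin m := fun i => ⟨i + 1, by have := i.2; omega⟩
  set A : Finset (Fin k) := Finset.univ.filter fun i => finRotate n (u (lo i)) = u (hi i)
  -- Used hull edges: the inner points themselves are distinct reflex vertices.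
  have hA : A.card ≤ R.card := by
    refine Finset.card_le_card_of_injOn v (fun i hiA => ?_) hinj_v.injOn
    have h1 : finRotate n (u (lo i)) = u (hi i) := (Finset.mem_filter.1 hiA).2
    refine Finset.mem_coe.2 (Finset.mem_filter.2 ⟨Finset.mem_univ _, ?_⟩)
    refine h.turn_innerPoint_neg hn hsub (hu (lo i)) ?_ (hv i)
    rw [h1, hu]
  have hB : Aᶜ.card ≤ R.card := by
    have hex : ∀ i : Fin k, ∃ t, i ∈ Aᶜ → P.turn ((finRotate n)^[t] (u (lo i))) < 0 ∧
        ∀ t', 0 < t' → t' ≤ t → ¬P.IsExtreme ((finRotate n)^[t'] (u (lo i))) := by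
      intro i
      by_cases hiA : i ∈ Aᶜ
      · have hne : finRotate n (u (lo i)) ≠ u (hi i) := by
          simpa [A] using hiA
        obtain ⟨t, ht⟩ := h.exists_turn_neg_between (hext (lo i)) (j := u (hi i)) (fun he => by
          have := congrArg Fin.val (hinj_u he)
          simp [lo, hi] at this) (fun l hl hl' => by
            rw [hu, hu]
            refine orient_hullPoint_pos (hmem l) (fun he => hl (hinj ?_))
              (fun he => hl' (hinj ?_))
            · exact he.trans (hu (lo i)).symm
            · exact he.trans (hu (hi i)).symm) hne
        exact ⟨t, fun _ => ht⟩
      · exact ⟨0, fun h => absurd h hiA⟩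
    choose t ht using hex
    -- If two unused edges led to the same vertex, the extreme start of one path would be met on the
    -- way along the other, which is excluded.
    have key : ∀ i j, i ∈ Aᶜ → t j ≤ t i →
        (finRotate n)^[t i] (u (lo i)) = (finRotate n)^[t j] (u (lo j)) → i = j := by
      intro i j hiA hle he
      have h1 : (finRotate n)^[t i - t j] (u (lo i)) = u (lo j) := by
        apply (finRotate n).injective.iterate (t j)
        rw [← Function.iterate_add_apply, Nat.add_sub_cancel' hle, he]
      rcases Nat.eq_zero_or_pos (t i - t j) with h0 | h0
      · rw [h0] at h1
        have := congrArg Fin.val (hinj_u h1)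
        exact Fin.ext this
      · refine absurd ?_ ((ht i hiA).2 _ h0 (Nat.sub_le _ _))
        rw [h1]
        exact hext _
    refine Finset.card_le_card_of_injOn (fun i => (finRotate n)^[t i] (u (lo i)))
      (fun i hiA => ?_) (fun i hiA j hjA he => ?_)
    · exact Finset.mem_coe.2 (Finset.mem_filter.2 ⟨Finset.mem_univ _,
        (ht i (Finset.mem_coe.1 hiA)).1⟩)
    · rcases le_total (t j) (t i) with hle | hle
      · exact key i j hiA hle he
      · exact (key j i hjA hle he.symm).symm
  have := Finset.card_add_card_compl A
  rw [Fintype.card_fin] at this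
  omega

end Polygon

lemma le_worstCaseReflexivity (n : ℕ) : ((n / 4 : ℕ) : ℕ∞) ≤ worstCaseReflexivity n := by
  rcases Nat.eq_zero_or_pos (n / 4) with h0 | h0
  · simp [h0]
  -- From `k ≤ 2ρ` with this odd `k` follows `ρ ≥ n / 4` by rounding, and the choice leaves `m > k`
  -- hull points, so that every inner point has its edge.
  set k := 2 * (n / 4) - 1
  set m := n - k
  have hm : 3 ≤ m := by omega
  refine le_iSup_of_le (pocketSet m k) (le_iSup_of_le (by rw [card_pocketSet]; omega)
    (le_iSup_of_le (not_collinear_pocketSet hm) ?_))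
  refine le_iInf fun N => le_iInf fun P => le_iInf fun hP => ?_
  obtain ⟨Q, hQ, hrange, hcount⟩ := hP.1.exists_isCcw
  have := hQ.le_reflexCount (m := m) (k := k) (by omega) (by omega) (hrange.trans hP.2)
  rw [← hcount]
  exact_mod_cast (show n / 4 ≤ Q.reflexCount by omega)

theorem corollary3 (n : ℕ) :
    ((⌊(n : ℝ) / 4⌋₊ : ℕ) : ℕ∞) ≤ worstCaseReflexivity n ∧
      worstCaseReflexivity n ≤ ((⌈(n : ℝ) / 2⌉₊ : ℕ) : ℕ∞) := by
  refine ⟨?_, (worstCaseReflexivity_le n).trans ?_⟩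
  · have h : ⌊(n : ℝ) / 4⌋₊ = n / 4 := by
      have := Nat.floor_div_eq_div (K := ℝ) n 4
      exact_mod_cast this
    rw [h]
    exact le_worstCaseReflexivity n
  · have h : n / 2 ≤ ⌈(n : ℝ) / 2⌉₊ := by
      have h1 : ((n / 2 : ℕ) : ℝ) ≤ ⌈(n : ℝ) / 2⌉₊ :=
        (Nat.cast_div_le (α := ℝ) (m := n) (n := 2)).trans (Nat.le_ceil _)
      exact_mod_cast h1
    exact_mod_cast h
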